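/- Let $d\ge 0$, let $(E,\rho)$ be a nonempty compact metric space with $\rho\le 1$, and let $\Omega=E^{\mathbb Z^d}$ with the shifts $(\theta_x\eta)(y)=\eta(y-x)$. The environment is a translation invariant Feller process $(\eta_t)_{t\ge0}$ on $\Omega$ with path space measures $\mathbb P^E_\eta$, semigroup $S^E_t$ on $C(\Omega)$ and generator $L^E$. Let $\widehat{\mathbb P}^E_{\eta,\xi}$ $(\eta,\xi\in\Omega)$ be a translation invariant coupling $(\eta^1_t,\eta^2_t)_{t\ge0}$ of $\mathbb P^E_\eta$ and $\mathbb P^E_\xi$ with the strong marginal Markov property: for $i=1,2$, every stopping time $\tau$ of the canonical filtration $(\mathcal F_t)$, every $t\ge 0$ and $f\in C(\Omega)$, $\widehat{\mathbb E}^E_{\eta,\xi}[1_{t\ge\tau}f(\eta^i_t)\mid\mathcal F_\tau]=1_{t\ge\tau}S^E_{t-\tau}f(\eta^i_\tau)$ almost surely. Put $g(t)=\sup_{\eta,\xi\in\Omega}\widehat{\mathbb E}^E_{\eta,\xi}\,\rho(\eta^1_t(0),\eta^2_t(0))$ and assume $\int_0^\infty t^d g(t)\,dt<\infty$ (Assumption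 1a). For $f\in C(\Omega)$ let $|||f|||=\sum_{x\in\mathbb Z^d}\sup \frac{f(\eta)-f(\xi)}{\rho(\eta(x),\xi(x))}$, each supremum being over the pairs $\eta,\xi$ that differ at $x$ and only there. Jump rates are functions $\alpha:\Omega\times\mathbb Z^d\to[0,\infty)$, continuous in the first variable, with $\sum_z\|z\|\sup_\eta\alpha(\eta,z)<\infty$ and $\sum_z|||\alpha(\cdot,z)|||<\infty$. Write $\|\alpha-\alpha'\|_0=\sum_z\sup_\eta|\alpha(\eta,z)-\alpha'(\eta,z)|$. For every such $\alpha$ there is exactly one Feller semigroup on $C(\Omega)$ with generator $$L^{EP}f(\eta)=L^Ef(\eta)+\sum_{z\in\mathbb Z^d}\alpha(\eta,z)\,[f(\theta_{-z}\eta)-f(\eta)],\qquad D(L^{EP})=D(L^E),$$ namely that of the environment process (the environment seen from the walker), and it has a unique invariant probability measure $\mu^{EP}_\alpha$. This measure depends continuously on the rates: (i) There are functions $C(\alpha)\ge 0$ and $p(\alpha)\in(0,1]$ such that for all jump rates $\alpha,\alpha'$ and all $f\in C(\Omega)$ with $|||f|||<\infty$, $$|\mu^{EP}_\alpha(f)-\mu^{EP}_{\alpha'}(f)|\le\frac{C(\alpha)}{p(\alpha)}\,\|\alpha-\alpha'\|_0\,|||f|||.$$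 Here $C(\alpha)>0$ if $E$ has more than one point, and $p(\alpha)<1$ if $\alpha$ depends on the environment. If $\alpha(\eta,z)=\alpha(z)$ does not depend on the environment, then $p(\alpha)=1$ and $C(\alpha)=\int_0^\infty g(t)\,dt$. (ii) The map $(\alpha,f)\mapsto\mu^{EP}_\alpha(f)$ is continuous in $\|\cdot\|_0\times|||\cdot|||$, where constants, on which $|||\cdot|||$ vanishes, are controlled by the value at a point: for all $\alpha$, all $f\in C(\Omega)$ with $|||f|||<\infty$ and all $\varepsilon>0$ there is $\delta>0$ such that $|\mu^{EP}_\alpha(f)-\mu^{EP}_{\alpha'}(f')|<\varepsilon$ for all jump rates $\alpha'$ and all $f'\in C(\Omega)$ with $\|\alpha-\alpha'\|_0<\delta$, $|||f-f'|||<\delta$ and $|f(\eta_0)-f'(\eta_0)|<\delta$ for some $\eta_0\in\Omega$. -/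

import Mathlib

open Set Filter Topology MeasureTheory
open scoped NNReal ENNReal

noncomputable section

/-! ### Feller semigroups, càdlàg paths and Feller processes -/

/-- A conservative Feller semigroup on `C(X)`, `X` compact: a strongly continuous semigroup of
positive operators that preserve the constant function `1`. -/
structure FellerSemigroup (X : Type*) [TopologicalSpace X] [CompactSpace X] where
  op : ℝ≥0 → C(X, ℝ) →L[ℝ] C(X, ℝ)
  op_zero : op 0 = ContinuousLinearMap.id ℝ C(X, ℝ)
  op_add : ∀ s t, op (s + t) = (op s).comp (op t)
  op_one : ∀ t, op t 1 = 1
  op_nonneg : ∀ t f, 0 ≤ f → 0 ≤ op t f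
  op_continuous : ∀ f, Tendsto (fun t => op t f) (𝓝 0) (𝓝 f)

/-- The graph of the infinitesimal generator: `f` is in the domain and is mapped to `g`, that is,
`(T_t f - f) / t → g` uniformly as `t ↓ 0`. -/
def FellerSemigroup.HasGenerator {X : Type*} [TopologicalSpace X] [CompactSpace X]
    (T : FellerSemigroup X) (f g : C(X, ℝ)) : Prop :=
  Tendsto (fun t : ℝ≥0 => (t : ℝ)⁻¹ • (T.op t f - f)) (𝓝[>] 0) (𝓝 g)

/-- `μ` is an invariant (stationary) probability measure of the semigroup. -/
def FellerSemigroup.IsInvariant {X : Type*} [TopologicalSpace X] [CompactSpace X]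
    [MeasurableSpace X] (T : FellerSemigroup X) (μ : ProbabilityMeasure X) : Prop :=
  ∀ (t : ℝ≥0) (f : C(X, ℝ)), ∫ x, T.op t f x ∂(μ : Measure X) = ∫ x, f x ∂(μ : Measure X)

/-- Right-continuous paths with left limits. The σ-algebra is the one generated by the coordinates
(the subtype and product instances). -/
abbrev CadlagPath (X : Type*) [TopologicalSpace X] : Type _ :=
  {ω : ℝ≥0 → X // ∀ t, ContinuousWithinAt ω (Ici t) t ∧ ∃ l, Tendsto ω (𝓝[<] t) (𝓝 l)}

/-- The image of a path under a continuous map. -/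
def CadlagPath.map {X Y : Type*} [TopologicalSpace X] [TopologicalSpace Y] (g : C(X, Y))
    (ω : CadlagPath X) : CadlagPath Y :=
  ⟨fun t => g (ω.1 t), fun t =>
    ⟨g.continuous.continuousAt.comp_continuousWithinAt (ω.2 t).1,
      (ω.2 t).2.imp' g fun l hl => (g.continuous.tendsto l).comp hl⟩⟩

theorem CadlagPath.measurable_eval {X : Type*} [TopologicalSpace X] [MeasurableSpace X]
    (t : ℝ≥0) : Measurable fun ω : CadlagPath X => ω.1 t :=
  (measurable_pi_apply t).comp measurable_subtype_coe

/-- The filtration generated by a process `Y`: `ℱ_t = σ(Y_s : s ≤ t)`. -/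
def generatedFiltration {W X : Type*} [mW : MeasurableSpace W] [mX : MeasurableSpace X]
    (Y : ℝ≥0 → W → X) (hY : ∀ t, Measurable (Y t)) : Filtration ℝ≥0 mW where
  seq t := ⨆ s : {s : ℝ≥0 // s ≤ t}, MeasurableSpace.comap (Y s) mX
  mono' _ _ h := iSup_le fun s =>
    le_iSup (fun s : {s : ℝ≥0 // s ≤ _} => MeasurableSpace.comap (Y s) mX) ⟨s.1, s.2.trans h⟩
  le' _ := iSup_le fun s => (hY s).comap_le

/-- The canonical filtration on path space. -/
def pathFiltration (X : Type*) [TopologicalSpace X] [MeasurableSpace X] :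
    Filtration ℝ≥0 (inferInstance : MeasurableSpace (CadlagPath X)) :=
  generatedFiltration (fun t ω => ω.1 t) CadlagPath.measurable_eval

/-- The canonical filtration on the space of pairs of paths. -/
def pairFiltration (X : Type*) [TopologicalSpace X] [MeasurableSpace X] :
    Filtration ℝ≥0 (inferInstance : MeasurableSpace (CadlagPath X × CadlagPath X)) :=
  generatedFiltration (fun t ω => (ω.1.1 t, ω.2.1 t)) fun t =>
    ((CadlagPath.measurable_eval t).comp measurable_fst).prodMk
      ((CadlagPath.measurable_eval t).comp measurable_snd)

/-- A Feller process on a compact space: path space measures `law x` on càdlàg paths that start in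
`x` and have the Markov property with a Feller semigroup. -/
structure FellerProcess (X : Type*) [TopologicalSpace X] [CompactSpace X]
    [MeasurableSpace X] where
  law : X → Measure (CadlagPath X)
  semigroup : FellerSemigroup X
  isProbabilityMeasure : ∀ x, IsProbabilityMeasure (law x)
  start : ∀ x, ∀ᵐ ω ∂(law x), ω.1 0 = x
  markov : ∀ (x : X) (s t : ℝ≥0) (f : C(X, ℝ)),
    (law x)[fun ω => f (ω.1 (s + t)) | pathFiltration X s]
      =ᵐ[law x] fun ω => semigroup.op t f (ω.1 s)

/-! ### Configurations and semi-norms -/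

/-- The lattice `ℤ^d`. -/
abbrev Site (d : ℕ) : Type := Fin d → ℤ

/-- The configuration space `Ω = E^{ℤ^d}`. -/
abbrev Config (d : ℕ) (E : Type*) : Type _ := Site d → E

/-- The shift `(θ_x η)(y) = η (y - x)`. -/
def shift {d : ℕ} {E : Type*} [TopologicalSpace E] (x : Site d) :
    C(Config d E, Config d E) where
  toFun η y := η (y - x)
  continuous_toFun := continuous_pi fun y => continuous_apply (y - x)

/-- `δ_f(x)`: the Lipschitz constant of `f` in the coordinate `η(x)`, the supremum running over
all pairs of configurations that differ at `x` and nowhere else. -/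
def siteLipschitz {d : ℕ} {E : Type*} [MetricSpace E] (f : Config d E → ℝ) (x : Site d) : ℝ≥0∞ :=
  ⨆ (η : Config d E) (ξ : Config d E) (_ : η x ≠ ξ x ∧ ∀ y, y ≠ x → η y = ξ y),
    ENNReal.ofReal ((f η - f ξ) / dist (η x) (ξ x))

/-- `|||f||| = ∑_x δ_f(x)`. -/
def tripleNorm {d : ℕ} {E : Type*} [MetricSpace E] (f : Config d E → ℝ) : ℝ≥0∞ :=
  ∑' x, siteLipschitz f x

/-- `∑_z ‖z‖^p sup_η |a(η, z)|`; it is `‖a‖_p^p` for `p ≥ 1`, and `‖a‖_0` for `p = 0`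
(every `z`, also `z = 0`, then has weight `1`). -/
def rateMoment {d : ℕ} {E : Type*} (p : ℕ) (a : Config d E → Site d → ℝ) : ℝ≥0∞ :=
  ∑' z, ‖z‖ₑ ^ p * ⨆ η, ‖a η z‖ₑ

/-- Jump rates `α(η, z)` of the walker: nonnegative, continuous in `η`, with
`‖α‖_1 < ∞` and `|||α||| = ∑_z |||α(·, z)||| < ∞`. -/
structure JumpRates (d : ℕ) (E : Type*) [MetricSpace E] where
  rate : Config d E → Site d → ℝ
  nonneg : ∀ η z, 0 ≤ rate η z
  continuous : ∀ z, Continuous fun η => rate η z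
  firstMoment : rateMoment 1 rate < ∞
  sensitivity : ∑' z, tripleNorm (fun η => rate η z) < ∞

/-- `‖α - α'‖_0 = ∑_z sup_η |α(η, z) - α'(η, z)|`. -/
def JumpRates.dist0 {d : ℕ} {E : Type*} [MetricSpace E] (α α' : JumpRates d E) : ℝ≥0∞ :=
  rateMoment 0 fun η z => α.rate η z - α'.rate η z

/-- The rates do not depend on the environment: `α(η, z) = α(z)`. -/
def JumpRates.EnvIndependent {d : ℕ} {E : Type*} [MetricSpace E] (α : JumpRates d E) : Prop :=
  ∀ η ξ z, α.rate η z = α.rate ξ z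

/-! ### The environment, its coupling, and the environment process -/

section Environment

variable {d : ℕ} {E : Type*} [MetricSpace E] [CompactSpace E] [MeasurableSpace E]

/-- Translation invariance: under `P_η` the shifted process `(θ_x η_t)_t` has law `P_{θ_x η}`. -/
def FellerProcess.TranslationInvariant (P : FellerProcess (Config d E)) : Prop :=
  ∀ x η, (P.law η).map (CadlagPath.map (shift x)) = P.law (shift x η)

/-- A coupling of the environment: for all `η, ξ` a law of a pair of paths whose marginals are the
environments started in `η` and in `ξ`. -/
structure EnvCoupling (P : FellerProcess (Config d E)) where
  law : Config d E → Config d E → Measure (CadlagPath (Config d E) × CadlagPath (Config d E))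
  isProbabilityMeasure : ∀ η ξ, IsProbabilityMeasure (law η ξ)
  map_fst : ∀ η ξ, (law η ξ).map Prod.fst = P.law η
  map_snd : ∀ η ξ, (law η ξ).map Prod.snd = P.law ξ

/-- Translation invariance of a coupling. -/
def EnvCoupling.TranslationInvariant {P : FellerProcess (Config d E)} (Q : EnvCoupling P) : Prop :=
  ∀ x η ξ, (Q.law η ξ).map (Prod.map (CadlagPath.map (shift x)) (CadlagPath.map (shift x)))
    = Q.law (shift x η) (shift x ξ)

/-- The strong marginal Markov property: for both components `i`, every stopping time `τ` of the
canonical filtration, every `t` and `f`,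
`E[1_{τ ≤ t} f(η^i_t) | ℱ_τ] = 1_{τ ≤ t} (S_{t-τ} f)(η^i_τ)`. -/
def EnvCoupling.StrongMarginalMarkov {P : FellerProcess (Config d E)} (Q : EnvCoupling P) : Prop :=
  ∀ (η ξ : Config d E) (τ : CadlagPath (Config d E) × CadlagPath (Config d E) → WithTop ℝ≥0)
    (hτ : IsStoppingTime (pairFiltration (Config d E)) τ) (t : ℝ≥0) (f : C(Config d E, ℝ)),
    ((Q.law η ξ)[{ω | τ ω ≤ t}.indicator fun ω => f (ω.1.1 t) | hτ.measurableSpace]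
      =ᵐ[Q.law η ξ] {ω | τ ω ≤ t}.indicator fun ω =>
        P.semigroup.op (t - (τ ω).untopD 0) f (ω.1.1 ((τ ω).untopD 0))) ∧
    ((Q.law η ξ)[{ω | τ ω ≤ t}.indicator fun ω => f (ω.2.1 t) | hτ.measurableSpace]
      =ᵐ[Q.law η ξ] {ω | τ ω ≤ t}.indicator fun ω =>
        P.semigroup.op (t - (τ ω).untopD 0) f (ω.2.1 ((τ ω).untopD 0)))

/-- `sup_{η, ξ} E_{η, ξ} ρ(η^1_t(0), η^2_t(0))`. -/
def EnvCoupling.supDist {P : FellerProcess (Config d E)} (Q : EnvCoupling P) (t : ℝ≥0) : ℝ :=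
  ⨆ p : Config d E × Config d E, ∫ ω, dist (ω.1.1 t 0) (ω.2.1 t 0) ∂(Q.law p.1 p.2)

/-- `T` is the semigroup of the environment process (the environment seen from a walker with
rates `α`): the generator of `T` is
`L^EP f(η) = L^E f(η) + ∑_z α(η, z) (f(θ_{-z} η) - f(η))`, with the domain of the generator `L^E`
of the environment. -/
def IsEnvProcessSemigroup (P : FellerProcess (Config d E)) (α : JumpRates d E)
    (T : FellerSemigroup (Config d E)) : Prop :=
  ∀ f g h : C(Config d E, ℝ),
    (∀ η, g η = h η + ∑' z, α.rate η z * (f (shift (-z) η) - f η)) →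
      (T.HasGenerator f g ↔ P.semigroup.HasGenerator f h)

/-- `ν` is an invariant probability measure of the environment process with rates `α`. -/
def IsEnvProcessInvariant (P : FellerProcess (Config d E)) (α : JumpRates d E)
    (ν : ProbabilityMeasure (Config d E)) : Prop :=
  ∃ T, IsEnvProcessSemigroup P α T ∧ T.IsInvariant ν

end Environment

end

set_option linter.unusedSectionVars false

/-! Write `B f = ∑_z α(·, z) (f ∘ θ_{-z} - f)`. This operator is bounded, so `L^E + B` generates a
Feller semigroup with the domain of `L^E` (`exists_perturbation`, by a damped variation of constants
formula). A generator determines its semigroup (`eq_of_hasGenerator_iff`), and compactness supplies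
an invariant law (`exists_isInvariant`).

Invariant laws are compared through the resolvent. Let `μ` be invariant for `α`, `ν` for `α'`, and
let `G` solve `(ε - L^E - B) G = f`. Integrating the two generators applied to `G` gives `μ(f) -
ν(f) = ε (μ(G) - ν(G)) + ν((B - B') G)`. If the oscillation of `G` is at most `K |||f|||` uniformly
in `ε`, then `ε → 0` leaves `|μ(f) - ν(f)| ≤ K ‖α - α'‖_0 |||f|||` (`ofReal_abs_integral_sub_le`).
Uniqueness is the case `α = α'`, and continuity follows as well.

The oscillation bound is a coupling argument in discrete time. For small `h`, `G` solves `G = h F +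
(1 - ε h) (1 + h B) S_h G` with `F` close to `f`. Two environments run under the given coupling, and
one walk makes only jumps allowed by both (`subWalk`). No probability space for the walk is needed:
its weights are functions of the two environment paths, and the marginal Markov property is applied
with these weights as adapted test functions. While the walk survives, the two values of `G`
separate only through the gaps of `f`; when it is lost they differ by at most the oscillation `D` of
`G`. If the gaps add up to at most `A` and the walk survives with mass at least `p`, then `D ≤ A +
(1 - p) D`, so `D ≤ A / p` (`resolvent_sub_le`).

For rates that ignore the environment nothing is lost, so `p = 1`, and the gaps add up to `|||f||| ∫
g`. In general the walk is held at the origin until a time `N` and then kept in a ball growing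
linearly in time. The ball has order `t^d` sites, so the discrepancies of the rates seen there cost
a multiple of `∫_N^∞ t^d g(t) dt`, which is small for large `N`; this is where the moment assumption
on `g` enters. Escape from the ball is controlled by a potential that needs only a first moment of
the jumps (`tsum_stepProb_mul_min_escape_le`). -/

noncomputable section

namespace FellerSemigroup

/-! ### Feller semigroups, generators and resolvents -/

section Basic

variable {X : Type*} [TopologicalSpace X] [CompactSpace X]

theorem ext_op {T T' : FellerSemigroup X} (h : ∀ t f, T.op t f = T'.op t f) : T = T' := by
  have : T.op = T'.op := by
    funext t
    ext1 f
    exact h t f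
  cases T
  cases T'
  congr

theorem op_add_apply (T : FellerSemigroup X) (s t : ℝ≥0) (f : C(X, ℝ)) :
    T.op (s + t) f = T.op s (T.op t f) := by
  rw [T.op_add]
  rfl

theorem op_mono (T : FellerSemigroup X) (t : ℝ≥0) {f g : C(X, ℝ)} (h : f ≤ g) :
    T.op t f ≤ T.op t g := by
  have := T.op_nonneg t (g - f) (sub_nonneg.2 h)
  rwa [map_sub, sub_nonneg] at this

theorem op_const (T : FellerSemigroup X) (t : ℝ≥0) (c : ℝ) :
    T.op t (ContinuousMap.const X c) = ContinuousMap.const X c := by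
  have : ContinuousMap.const X c = c • (1 : C(X, ℝ)) := by ext; simp
  rw [this, map_smul, T.op_one]

theorem norm_op_le (T : FellerSemigroup X) (t : ℝ≥0) (f : C(X, ℝ)) : ‖T.op t f‖ ≤ ‖f‖ := by
  rw [ContinuousMap.norm_le _ (norm_nonneg f)]
  intro x
  have h1 : f ≤ ContinuousMap.const X ‖f‖ := fun y =>
    (le_abs_self _).trans (f.norm_coe_le_norm y)
  have h2 : ContinuousMap.const X (-‖f‖) ≤ f := fun y =>
    neg_le_of_abs_le (f.norm_coe_le_norm y)
  have h3 := T.op_mono t h1 x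
  have h4 := T.op_mono t h2 x
  rw [op_const] at h3 h4
  exact abs_le.2 ⟨h4, h3⟩

/-- Contractivity reduces the increment between two times to the increment from time `0` over their
distance, so strong continuity at `0` suffices. -/
theorem continuous_op (T : FellerSemigroup X) (f : C(X, ℝ)) : Continuous fun t => T.op t f := by
  have key : ∀ s t : ℝ≥0, s ≤ t → dist (T.op s f) (T.op t f) ≤ dist (T.op (t - s) f) f := by
    intro s t hst
    obtain ⟨r, rfl⟩ := exists_add_of_le hst
    rw [add_tsub_cancel_left, dist_comm, dist_eq_norm, T.op_add, ContinuousLinearMap.comp_apply,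
      ← map_sub, dist_eq_norm]
    exact T.norm_op_le _ _
  have key' : ∀ s t : ℝ≥0, dist (T.op s f) (T.op t f) ≤ dist (T.op ((t - s) + (s - t)) f) f := by
    intro s t
    rcases le_total s t with h | h
    · simpa [tsub_eq_zero_of_le h] using key s t h
    · rw [dist_comm]
      simpa [tsub_eq_zero_of_le h] using key t s h
  rw [continuous_iff_continuousAt]
  intro t
  rw [ContinuousAt, tendsto_iff_dist_tendsto_zero]
  have h1 : Tendsto (fun s : ℝ≥0 => (t - s) + (s - t)) (𝓝 t) (𝓝 0) := by
    have : Continuous fun s : ℝ≥0 => (t - s) + (s - t) := by fun_prop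
    simpa using this.tendsto t
  have h2 := ((T.op_continuous f).comp h1).dist (tendsto_const_nhds (x := f))
  rw [dist_self] at h2
  exact squeeze_zero (fun _ => dist_nonneg) (fun s => key' s t) h2

theorem continuous_op_prod (T : FellerSemigroup X) :
    Continuous fun p : ℝ≥0 × C(X, ℝ) => T.op p.1 p.2 := by
  rw [continuous_iff_continuousAt]
  rintro ⟨t, f⟩
  rw [ContinuousAt, tendsto_iff_dist_tendsto_zero]
  have h : ∀ p : ℝ≥0 × C(X, ℝ), dist (T.op p.1 p.2) (T.op t f) ≤
      dist p.2 f + dist (T.op p.1 f) (T.op t f) := fun p => by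
    refine (dist_triangle _ (T.op p.1 f) _).trans (add_le_add ?_ le_rfl)
    rw [dist_eq_norm, ← map_sub, dist_eq_norm]
    exact T.norm_op_le _ _
  refine squeeze_zero (fun _ => dist_nonneg) h ?_
  have h1 : Continuous fun p : ℝ≥0 × C(X, ℝ) =>
      dist p.2 f + dist (T.op p.1 f) (T.op t f) := by
    have := T.continuous_op f
    fun_prop
  simpa using h1.tendsto (t, f)

/-- The orbit of `f`, with real time. -/
def orbit (T : FellerSemigroup X) (f : C(X, ℝ)) (t : ℝ) : C(X, ℝ) := T.op t.toNNReal f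

theorem continuous_orbit (T : FellerSemigroup X) (f : C(X, ℝ)) : Continuous (T.orbit f) :=
  (T.continuous_op f).comp continuous_real_toNNReal

theorem orbit_zero (T : FellerSemigroup X) (f : C(X, ℝ)) : T.orbit f 0 = f := by
  simp [orbit, T.op_zero]

theorem norm_orbit_le (T : FellerSemigroup X) (f : C(X, ℝ)) (t : ℝ) : ‖T.orbit f t‖ ≤ ‖f‖ :=
  T.norm_op_le _ _

theorem op_orbit (T : FellerSemigroup X) (f : C(X, ℝ)) (h : ℝ≥0) {t : ℝ} (ht : 0 ≤ t) :
    T.op h (T.orbit f t) = T.orbit f (h + t) := by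
  rw [orbit, orbit, ← ContinuousLinearMap.comp_apply, ← T.op_add,
    Real.toNNReal_add h.coe_nonneg ht, Real.toNNReal_coe]

theorem tendsto_coe_nhdsGT_zero : Tendsto (fun t : ℝ≥0 => (t : ℝ)) (𝓝[>] 0) (𝓝[>] 0) := by
  refine tendsto_nhdsWithin_iff.2 ⟨?_, ?_⟩
  · exact (NNReal.continuous_coe.tendsto 0).mono_left nhdsWithin_le_nhds
  · filter_upwards [self_mem_nhdsWithin] with t ht
    exact NNReal.coe_pos.2 ht

theorem tendsto_average_zero {V : Type*} [NormedAddCommGroup V] [NormedSpace ℝ V] [CompleteSpace V]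
    {c : ℝ → V} (hc : Continuous c) (a : ℝ) :
    Tendsto (fun t : ℝ≥0 => (t : ℝ)⁻¹ • ∫ s in a..a + t, c s) (𝓝[>] 0) (𝓝 (c a)) := by
  have h := (intervalIntegral.integral_hasDerivAt_right (hc.intervalIntegrable a a)
    (hc.stronglyMeasurableAtFilter _ _) hc.continuousAt)
  have h2 := h.tendsto_slope_zero_right
  have h3 := h2.comp tendsto_coe_nhdsGT_zero
  simpa [Function.comp_def] using h3

theorem HasGenerator.op {T : FellerSemigroup X} {f g : C(X, ℝ)} (h : T.HasGenerator f g)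
    (s : ℝ≥0) : T.HasGenerator (T.op s f) (T.op s g) := by
  have := ((T.op s).continuous.tendsto g).comp h
  refine this.congr fun t => ?_
  simp only [Function.comp_apply, map_smul, map_sub]
  rw [← ContinuousLinearMap.comp_apply, ← T.op_add, ← ContinuousLinearMap.comp_apply, ← T.op_add,
    add_comm]

theorem HasGenerator.add {T : FellerSemigroup X} {f g f' g' : C(X, ℝ)} (h : T.HasGenerator f g)
    (h' : T.HasGenerator f' g') : T.HasGenerator (f + f') (g + g') := by
  refine (Tendsto.add h h').congr fun t => ?_
  rw [← smul_add, map_add]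
  congr 1
  abel

theorem hasGenerator_const (T : FellerSemigroup X) (c : ℝ) :
    T.HasGenerator (ContinuousMap.const X c) 0 := by
  refine tendsto_const_nhds.congr fun t => ?_
  rw [op_const, sub_self, smul_zero]

theorem op_integral (T : FellerSemigroup X) (t : ℝ≥0) {c : ℝ → C(X, ℝ)} (hc : Continuous c)
    (a b : ℝ) : T.op t (∫ s in a..b, c s) = ∫ s in a..b, T.op t (c s) :=
  ((T.op t).intervalIntegral_comp_comm (hc.intervalIntegrable a b)).symm

/-- Applying `T_t` translates the window of integration, and all but its two end pieces of length
`t` cancels. These averages show that the domain is dense. -/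
theorem hasGenerator_integral_orbit (T : FellerSemigroup X) (f : C(X, ℝ)) (a : ℝ≥0) :
    T.HasGenerator (∫ s in (0 : ℝ)..a, T.orbit f s) (T.op a f - f) := by
  have hc := T.continuous_orbit f
  have h1 := (tendsto_average_zero hc a).sub (tendsto_average_zero hc 0)
  rw [orbit_zero] at h1
  have h2 : T.orbit f a = T.op a f := by simp [orbit]
  rw [h2] at h1
  refine h1.congr fun t => ?_
  rw [← smul_sub, op_integral _ _ hc]
  congr 1
  have h3 : ∫ s in (0 : ℝ)..a, T.op t (T.orbit f s) = ∫ s in (0 : ℝ)..a, T.orbit f (s + t) := by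
    refine intervalIntegral.integral_congr fun s hs => ?_
    rw [Set.uIcc_of_le a.coe_nonneg] at hs
    rw [op_orbit _ _ _ hs.1, add_comm]
  rw [h3, intervalIntegral.integral_comp_add_right (fun s => T.orbit f s)]
  have hi := fun a b : ℝ => hc.intervalIntegrable (μ := volume) a b
  simp only [zero_add]
  rw [sub_eq_sub_iff_add_eq_add, add_comm,
    intervalIntegral.integral_add_adjacent_intervals (hi _ _) (hi _ _),
    add_comm (∫ s in (t : ℝ)..a + t, T.orbit f s),
    intervalIntegral.integral_add_adjacent_intervals (hi _ _) (hi _ _)]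

theorem exists_hasGenerator_tendsto (T : FellerSemigroup X) (f : C(X, ℝ)) :
    ∃ F : ℝ≥0 → C(X, ℝ), (∀ t, ∃ g, T.HasGenerator (F t) g) ∧ Tendsto F (𝓝[>] 0) (𝓝 f) := by
  refine ⟨fun t => (t : ℝ)⁻¹ • ∫ s in (0 : ℝ)..t, T.orbit f s, fun t => ?_, ?_⟩
  · refine ⟨(t : ℝ)⁻¹ • (T.op t f - f), ?_⟩
    refine (Tendsto.const_smul (T.hasGenerator_integral_orbit f t) ((t : ℝ)⁻¹)).congr fun s => ?_
    rw [smul_comm, smul_sub, map_smul]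
  · simpa [orbit_zero] using tendsto_average_zero (T.continuous_orbit f) 0

/-- For `f` in the common domain the interpolation `s ↦ T_{t-s} T'_s f` has right derivative zero,
because `T'_s f` stays in the domain and the two generators agree on it. Its end points are `T_t f`
and `T'_t f`; density of the domain does the rest. -/
theorem eq_of_hasGenerator_iff {T T' : FellerSemigroup X}
    (h : ∀ f g, T.HasGenerator f g ↔ T'.HasGenerator f g) : T = T' := by
  have key : ∀ (t : ℝ≥0) (f g : C(X, ℝ)), T.HasGenerator f g → T.op t f = T'.op t f := by
    intro t f g hf
    let F : ℝ → C(X, ℝ) := fun s => T.op (t - s.toNNReal) (T'.op s.toNNReal f)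
    have hcont : Continuous F := by
      refine T.continuous_op_prod.comp (Continuous.prodMk ?_ ?_)
      · exact continuous_const.sub continuous_real_toNNReal
      · exact (T'.continuous_op f).comp continuous_real_toNNReal
    have hder : ∀ s ∈ Ico (0 : ℝ) t, HasDerivWithinAt F 0 (Ici s) s := by
      intro s hs
      rw [← hasDerivWithinAt_Ioi_iff_Ici, hasDerivWithinAt_iff_tendsto_slope' self_notMem_Ioi]
      lift s to ℝ≥0 using hs.1
      have hst : s < t := by exact_mod_cast hs.2
      set φ := T'.op s f with hφ
      have h1 : T'.HasGenerator φ (T'.op s g) := ((h _ _).1 hf).op s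
      have h2 : T.HasGenerator φ (T'.op s g) := (h _ _).2 h1
      have h3 : Tendsto (fun a : ℝ≥0 => (a : ℝ)⁻¹ • (T'.op a φ - T.op a φ)) (𝓝[>] 0) (𝓝 0) := by
        have := h1.sub h2
        rw [sub_self] at this
        refine this.congr fun a => ?_
        rw [← smul_sub]
        congr 1
        abel
      have hmap : Tendsto (fun y : ℝ => (y - s).toNNReal) (𝓝[>] (s : ℝ)) (𝓝[>] 0) := by
        refine tendsto_nhdsWithin_iff.2 ⟨?_, ?_⟩
        · have : Continuous fun y : ℝ => (y - s).toNNReal := by fun_prop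
          simpa using (this.tendsto (s : ℝ)).mono_left nhdsWithin_le_nhds
        · filter_upwards [self_mem_nhdsWithin] with y hy
          simpa using hy
      have h4 := (h3.comp hmap).norm
      rw [norm_zero] at h4
      refine squeeze_zero_norm' ?_ h4
      have hlt : ∀ᶠ y : ℝ in 𝓝[>] (s : ℝ), y < t :=
        nhdsWithin_le_nhds (Iio_mem_nhds (by exact_mod_cast hst))
      filter_upwards [self_mem_nhdsWithin, hlt] with y hy hyt
      have hy0 : (s : ℝ) < y := hy
      lift y to ℝ≥0 using s.2.trans hy0.le
      have hsy : s ≤ y := by exact_mod_cast hy0.le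
      have hyt' : y ≤ t := by exact_mod_cast hyt.le
      obtain ⟨a, rfl⟩ := exists_add_of_le hsy
      obtain ⟨b, rfl⟩ := exists_add_of_le hyt'
      have e1 : (((s + a : ℝ≥0) : ℝ) - s) = a := by push_cast; ring
      have e2 : F ((s + a : ℝ≥0) : ℝ) = T.op b (T'.op a φ) := by
        simp only [F, Real.toNNReal_coe, add_tsub_cancel_left]
        rw [add_comm s a, T'.op_add]
        rfl
      have e3 : F (s : ℝ) = T.op b (T.op a φ) := by
        simp only [F, Real.toNNReal_coe]
        rw [show s + a + b - s = b + a by rw [add_assoc, add_tsub_cancel_left, add_comm], T.op_add]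
        rfl
      rw [slope_def_module, e1, e2, e3, ← map_sub, ← map_smul]
      simp only [Function.comp_apply, e1, Real.toNNReal_coe]
      exact T.norm_op_le _ _
    have := constant_of_has_deriv_right_zero hcont.continuousOn hder t ⟨t.2, le_rfl⟩
    simp only [F, Real.toNNReal_coe, tsub_self, Real.toNNReal_zero, tsub_zero, T.op_zero,
      T'.op_zero, ContinuousLinearMap.id_apply] at this
    exact this.symm
  refine ext_op fun t f => ?_
  obtain ⟨F, hF, hlim⟩ := T.exists_hasGenerator_tendsto f
  have h1 := ((T.op t).continuous.tendsto f).comp hlim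
  have h2 := ((T'.op t).continuous.tendsto f).comp hlim
  refine tendsto_nhds_unique h1 (h2.congr fun a => ?_)
  obtain ⟨g, hg⟩ := hF a
  exact (key t _ g hg).symm

/-- The resolvent equation `(ε - L) G = f` is solvable for every `ε > 0`. -/
theorem exists_resolvent (T : FellerSemigroup X) {ε : ℝ} (hε : 0 < ε) (f : C(X, ℝ)) :
    ∃ G, T.HasGenerator G (ε • G - f) := by
  set c : ℝ → C(X, ℝ) := fun s => Real.exp (-ε * s) • T.orbit f s with hcdef
  have hc : Continuous c := by
    have := T.continuous_orbit f
    fun_prop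
  have hint : IntegrableOn c (Ioi 0) := by
    refine Integrable.mono' ((integrableOn_exp_mul_Ioi (neg_lt_zero.2 hε) 0).mul_const ‖f‖)
      hc.aestronglyMeasurable (Eventually.of_forall fun s => ?_)
    rw [hcdef, norm_smul, Real.norm_eq_abs, Real.abs_exp]
    gcongr
    exact T.norm_orbit_le f s
  refine ⟨∫ s in Ioi 0, c s, ?_⟩
  set G := ∫ s in Ioi 0, c s with hG
  have hexp : Tendsto (fun t : ℝ≥0 => Real.exp (ε * t)) (𝓝[>] 0) (𝓝 1) := by
    have : Continuous fun t : ℝ≥0 => Real.exp (ε * t) := by fun_prop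
    simpa using (this.tendsto 0).mono_left nhdsWithin_le_nhds
  have hexp' : Tendsto (fun t : ℝ≥0 => (t : ℝ)⁻¹ * (Real.exp (ε * t) - 1)) (𝓝[>] 0) (𝓝 ε) := by
    have h : HasDerivAt (fun t : ℝ => Real.exp (ε * t)) ε 0 := by
      simpa using ((hasDerivAt_id (0 : ℝ)).const_mul ε).exp
    simpa [Function.comp_def] using h.tendsto_slope_zero_right.comp tendsto_coe_nhdsGT_zero
  have h0 := tendsto_average_zero hc 0
  have hc0 : c 0 = f := by simp [hcdef, orbit_zero]
  rw [hc0] at h0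
  have h1 := (hexp'.smul_const G).sub (hexp.smul h0)
  rw [one_smul] at h1
  refine h1.congr fun t => ?_
  -- Translating time in the Laplace transform turns the action of `T_t` into a factor `e^{εt}` and
  -- the loss of the interval `[0, t]`.
  have e1 : T.op t G = Real.exp (ε * t) • ∫ s in Ioi (t : ℝ), c s := by
    rw [hG, ← (T.op t).integral_comp_comm hint, ← integral_smul,
      ← (measurePreserving_add_right volume (t : ℝ)).setIntegral_preimage_emb
        (measurableEmbedding_addRight (t : ℝ)) (fun s => Real.exp (ε * t) • c s) (Ioi (t : ℝ))]
    have hpre : (fun s : ℝ => s + t) ⁻¹' Ioi (t : ℝ) = Ioi 0 := by ext; simp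
    rw [hpre]
    refine setIntegral_congr_fun measurableSet_Ioi fun s hs => ?_
    simp only [hcdef, map_smul, smul_smul, ← Real.exp_add]
    rw [op_orbit _ _ _ (le_of_lt hs), add_comm s]
    congr 2
    ring
  have e2 : G = (∫ s in (0 : ℝ)..t, c s) + ∫ s in Ioi (t : ℝ), c s := by
    exact (intervalIntegral.integral_interval_add_Ioi hint
      (hint.mono_set (Ioi_subset_Ioi t.2))).symm
  rw [e1, zero_add]
  have e3 : ∫ s in Ioi (t : ℝ), c s = G - ∫ s in (0 : ℝ)..t, c s := by rw [e2]; abel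
  rw [e3, mul_smul, smul_comm (Real.exp (ε * t)), ← smul_sub]
  congr 1
  module

end Basic

/-! ### Bounded perturbation of a Feller generator -/

section Perturbation

open scoped BoundedContinuousFunction

variable {X : Type*} [TopologicalSpace X] [CompactSpace X]

/-- The integrand of the damped variation of constants formula. -/
def duhamelIntegrand (S : FellerSemigroup X) (J : C(X, ℝ) →L[ℝ] C(X, ℝ)) (c : ℝ)
    (w : ℝ≥0 → C(X, ℝ)) (t : ℝ≥0) (s : ℝ) : C(X, ℝ) :=
  Real.exp (-c * (t - s)) • S.op (t - s).toNNReal (J (w s.toNNReal))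

/-- The damped Duhamel convolution. -/
def duhamel (S : FellerSemigroup X) (J : C(X, ℝ) →L[ℝ] C(X, ℝ)) (c : ℝ)
    (w : ℝ≥0 → C(X, ℝ)) (t : ℝ≥0) : C(X, ℝ) :=
  ∫ s in (0 : ℝ)..t, S.duhamelIntegrand J c w t s

variable (S : FellerSemigroup X) (J : C(X, ℝ) →L[ℝ] C(X, ℝ)) (c : ℝ)

theorem continuous_duhamelIntegrand {w : ℝ≥0 → C(X, ℝ)} (hw : Continuous w) :
    Continuous (Function.uncurry (S.duhamelIntegrand J c w)) := by
  have h : Continuous fun p : ℝ≥0 × ℝ => (((p.1 : ℝ) - p.2).toNNReal, J (w p.2.toNNReal)) := by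
    fun_prop
  exact Continuous.smul (f := fun p : ℝ≥0 × ℝ => Real.exp (-c * (p.1 - p.2))) (by fun_prop)
    (S.continuous_op_prod.comp h)

theorem continuous_duhamelIntegrand_right {w : ℝ≥0 → C(X, ℝ)} (hw : Continuous w) (t : ℝ≥0) :
    Continuous (S.duhamelIntegrand J c w t) :=
  (S.continuous_duhamelIntegrand J c hw).comp (Continuous.prodMk continuous_const continuous_id)

theorem continuous_duhamel {w : ℝ≥0 → C(X, ℝ)} (hw : Continuous w) :
    Continuous (S.duhamel J c w) :=
  intervalIntegral.continuous_parametric_intervalIntegral_of_continuous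
    (S.continuous_duhamelIntegrand J c hw) NNReal.continuous_coe

theorem duhamel_zero (w : ℝ≥0 → C(X, ℝ)) : S.duhamel J c w 0 = 0 := by simp [duhamel]

theorem duhamel_add {w w' : ℝ≥0 → C(X, ℝ)} (hw : Continuous w) (hw' : Continuous w') (t : ℝ≥0) :
    S.duhamel J c (w + w') t = S.duhamel J c w t + S.duhamel J c w' t := by
  rw [duhamel, duhamel, duhamel, ← intervalIntegral.integral_add
    ((S.continuous_duhamelIntegrand_right J c hw t).intervalIntegrable _ _)
    ((S.continuous_duhamelIntegrand_right J c hw' t).intervalIntegrable _ _)]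
  simp only [duhamelIntegrand, Pi.add_apply, map_add, smul_add]

theorem duhamel_smul (a : ℝ) (w : ℝ≥0 → C(X, ℝ)) (t : ℝ≥0) :
    S.duhamel J c (a • w) t = a • S.duhamel J c w t := by
  rw [duhamel, duhamel, ← intervalIntegral.integral_smul]
  simp only [duhamelIntegrand, Pi.smul_apply, map_smul, smul_comm a]

variable {c} {J}

theorem integral_exp_neg_le {c : ℝ} (hc : 0 < c) (t : ℝ) :
    ∫ s in (0 : ℝ)..t, Real.exp (-c * (t - s)) ≤ 1 / c := by
  have h : ∀ s ∈ uIcc (0 : ℝ) t, HasDerivAt (fun s => Real.exp (-c * (t - s)) / c)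
      (Real.exp (-c * (t - s))) s := by
    intro s _
    have h1 : HasDerivAt (fun s : ℝ => -c * (t - s)) c s := by
      simpa using ((hasDerivAt_id s).const_sub t).const_mul (-c)
    convert! h1.exp.div_const c using 1
    field_simp
  rw [intervalIntegral.integral_eq_sub_of_hasDerivAt h
    (Continuous.intervalIntegrable (by fun_prop) _ _)]
  simp only [sub_self, mul_zero, Real.exp_zero]
  have := Real.exp_pos (-c * (t - 0))
  have h2 : 0 ≤ Real.exp (-c * (t - 0)) / c := by positivity
  linarith

/-- The damping factor has integral at most `1 / c` over every time interval, so the bound is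
uniform in `t`. -/
theorem norm_duhamel_le (hc : 0 < c) {w : ℝ≥0 → C(X, ℝ)} {M : ℝ}
    (hM : ∀ t, ‖w t‖ ≤ M) (t : ℝ≥0) : ‖S.duhamel J c w t‖ ≤ ‖J‖ * M / c := by
  have hM0 : 0 ≤ M := (norm_nonneg _).trans (hM 0)
  calc ‖S.duhamel J c w t‖
      ≤ ∫ s in (0 : ℝ)..t, Real.exp (-c * (t - s)) * (‖J‖ * M) := by
        refine intervalIntegral.norm_integral_le_of_norm_le t.coe_nonneg
          (Eventually.of_forall fun s _ => ?_) (Continuous.intervalIntegrable (by fun_prop) _ _)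
        rw [duhamelIntegrand, norm_smul, Real.norm_eq_abs, Real.abs_exp]
        gcongr
        exact (S.norm_op_le _ _).trans (J.le_opNorm_of_le (hM _))
    _ = (∫ s in (0 : ℝ)..t, Real.exp (-c * (t - s))) * (‖J‖ * M) := by
        rw [intervalIntegral.integral_mul_const]
    _ ≤ 1 / c * (‖J‖ * M) := by
        gcongr
        exact integral_exp_neg_le hc t
    _ = ‖J‖ * M / c := by ring

/-- `w` is a bounded continuous mild solution with initial value `f`. -/
structure IsMild (S : FellerSemigroup X) (J : C(X, ℝ) →L[ℝ] C(X, ℝ)) (c : ℝ) (f : C(X, ℝ))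
    (w : ℝ≥0 → C(X, ℝ)) : Prop where
  continuous : Continuous w
  bounded : ∃ M, ∀ t, ‖w t‖ ≤ M
  eq : ∀ t, w t = Real.exp (-c * t) • S.op t f + S.duhamel J c w t

/-- The fixed point map of the damped variation of constants formula. -/
def mildMap (S : FellerSemigroup X) (J : C(X, ℝ) →L[ℝ] C(X, ℝ)) {c : ℝ} (hc : 0 < c)
    (f : C(X, ℝ)) (w : ℝ≥0 →ᵇ C(X, ℝ)) : ℝ≥0 →ᵇ C(X, ℝ) :=
  BoundedContinuousFunction.ofNormedAddCommGroup
    (fun t => Real.exp (-c * t) • S.op t f + S.duhamel J c w t)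
    (by
      have := S.continuous_op f
      have := S.continuous_duhamel J c w.continuous
      fun_prop)
    (‖f‖ + ‖J‖ * ‖w‖ / c) (fun t => by
      refine norm_add_le_of_le ?_ (S.norm_duhamel_le hc w.norm_coe_le_norm t)
      rw [norm_smul, Real.norm_eq_abs, Real.abs_exp]
      refine (mul_le_of_le_one_left (norm_nonneg _) ?_).trans (S.norm_op_le t f)
      rw [Real.exp_le_one_iff]
      have := t.coe_nonneg
      nlinarith)

/-- With damping rate `c ≥ 2 ‖J‖` a single fixed point argument covers the whole half-line, without
gluing short time intervals. -/
theorem contractingWith_mildMap (hc : 0 < c) (hJc : 2 * ‖J‖ ≤ c) (f : C(X, ℝ)) :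
    ContractingWith 2⁻¹ (S.mildMap J hc f) := by
  refine ⟨by norm_num, LipschitzWith.of_dist_le_mul fun w w' => ?_⟩
  rw [BoundedContinuousFunction.dist_le (by positivity)]
  intro t
  have h1 : S.duhamel J c w t = S.duhamel J c w' t + S.duhamel J c (w - w' : ℝ≥0 →ᵇ C(X, ℝ)) t := by
    rw [← S.duhamel_add J c w'.continuous (w - w').continuous]
    congr 1
    ext1 s
    simp
  have h2 := S.norm_duhamel_le hc (J := J) (w - w').norm_coe_le_norm t
  rw [dist_eq_norm, dist_eq_norm w]
  change ‖(Real.exp (-c * t) • S.op t f + S.duhamel J c w t) -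
    (Real.exp (-c * t) • S.op t f + S.duhamel J c w' t)‖ ≤ _
  rw [h1, add_sub_add_left_eq_sub, add_sub_cancel_left]
  refine h2.trans ?_
  rw [div_le_iff₀ hc]
  push_cast
  have := norm_nonneg (w - w')
  nlinarith

theorem IsMild.unique (hc : 0 < c) (hJc : 2 * ‖J‖ ≤ c) {f : C(X, ℝ)} {w w' : ℝ≥0 → C(X, ℝ)}
    (hw : S.IsMild J c f w) (hw' : S.IsMild J c f w') : w = w' := by
  have key : ∀ w : ℝ≥0 → C(X, ℝ), S.IsMild J c f w → ∃ b : ℝ≥0 →ᵇ C(X, ℝ),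
      ⇑b = w ∧ Function.IsFixedPt (S.mildMap J hc f) b := by
    intro w hw
    obtain ⟨M, hM⟩ := hw.bounded
    refine ⟨BoundedContinuousFunction.ofNormedAddCommGroup w hw.continuous M hM, rfl, ?_⟩
    ext1 t
    exact (hw.eq t).symm
  obtain ⟨b, rfl, hb⟩ := key w hw
  obtain ⟨b', rfl, hb'⟩ := key w' hw'
  rw [(S.contractingWith_mildMap hc hJc f).fixedPoint_unique' hb hb']

/-- The Picard iterates started from `0` stay nonnegative because `S` and `J` are positive, and this
passes to the limit. -/
theorem exists_isMild (hc : 0 < c) (hJc : 2 * ‖J‖ ≤ c) (hJ : ∀ f, 0 ≤ f → 0 ≤ J f)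
    (f : C(X, ℝ)) : ∃ w, S.IsMild J c f w ∧ (0 ≤ f → ∀ t, 0 ≤ w t) := by
  have hcon := S.contractingWith_mildMap hc hJc f
  let b := ContractingWith.fixedPoint _ hcon
  have hb : S.mildMap J hc f b = b := hcon.fixedPoint_isFixedPt
  refine ⟨b, ⟨b.continuous, ⟨‖b‖, b.norm_coe_le_norm⟩, fun t => ?_⟩, fun hf => ?_⟩
  · conv_lhs => rw [← hb]
    rfl
  · have hlim := hcon.tendsto_iterate_fixedPoint 0
    have hnn : ∀ n t, 0 ≤ ((S.mildMap J hc f)^[n] 0) t := by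
      intro n
      induction n with
      | zero => intro t; exact le_rfl
      | succ n ih =>
        intro t
        rw [Function.iterate_succ_apply']
        refine add_nonneg (smul_nonneg (Real.exp_nonneg _) (S.op_nonneg _ _ hf)) ?_
        rw [ContinuousMap.le_def]
        intro x
        rw [duhamel]
        have hcc := S.continuous_duhamelIntegrand_right J c
          ((S.mildMap J hc f)^[n] 0).continuous t
        have e := (ContinuousMap.evalCLM ℝ x).intervalIntegral_comp_comm
          (hcc.intervalIntegrable (μ := volume) 0 t)
        simp only [ContinuousMap.evalCLM_apply] at e
        rw [← e]
        refine intervalIntegral.integral_nonneg t.coe_nonneg fun s _ => ?_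
        exact mul_nonneg (Real.exp_nonneg _) (S.op_nonneg _ _ (hJ _ (ih _)) x)
    intro t
    have h2 : Tendsto (fun n => ((S.mildMap J hc f)^[n] 0) t) atTop (𝓝 (b t)) :=
      (BoundedContinuousFunction.tendsto_iff_tendstoUniformly.1 hlim).tendsto_at t
    rw [ContinuousMap.le_def]
    intro x
    exact ge_of_tendsto' (((continuous_eval_const x).tendsto _).comp h2) fun n => hnn n t x

theorem IsMild.add {f g : C(X, ℝ)} {w w' : ℝ≥0 → C(X, ℝ)} (hw : S.IsMild J c f w)
    (hw' : S.IsMild J c g w') : S.IsMild J c (f + g) (w + w') := by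
  refine ⟨hw.continuous.add hw'.continuous, ?_, fun t => ?_⟩
  · obtain ⟨M, hM⟩ := hw.bounded
    obtain ⟨M', hM'⟩ := hw'.bounded
    exact ⟨M + M', fun t => norm_add_le_of_le (hM t) (hM' t)⟩
  · rw [S.duhamel_add J c hw.continuous hw'.continuous, Pi.add_apply, hw.eq t, hw'.eq t, map_add,
      smul_add]
    abel

theorem IsMild.smul (a : ℝ) {f : C(X, ℝ)} {w : ℝ≥0 → C(X, ℝ)} (hw : S.IsMild J c f w) :
    S.IsMild J c (a • f) (a • w) := by
  refine ⟨hw.continuous.const_smul a, ?_, fun t => ?_⟩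
  · obtain ⟨M, hM⟩ := hw.bounded
    refine ⟨‖a‖ * M, fun t => ?_⟩
    rw [Pi.smul_apply, norm_smul]
    gcongr
    exact hM t
  · rw [S.duhamel_smul J c, Pi.smul_apply, map_smul, smul_comm _ a, ← smul_add, ← hw.eq t]

/-- The convolution up to `t + r` is split at time `r`. Combined with uniqueness this is the
semigroup property. -/
theorem IsMild.shift {f : C(X, ℝ)} {w : ℝ≥0 → C(X, ℝ)} (hw : S.IsMild J c f w) (r : ℝ≥0) :
    S.IsMild J c (w r) (fun t => w (t + r)) := by
  refine ⟨hw.continuous.comp (by fun_prop), ?_, fun t => ?_⟩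
  · obtain ⟨M, hM⟩ := hw.bounded
    exact ⟨M, fun t => hM _⟩
  have hI := S.continuous_duhamelIntegrand_right J c hw.continuous
  have e1 : S.duhamel J c w (t + r) =
      Real.exp (-c * t) • S.op t (S.duhamel J c w r) + S.duhamel J c (fun t => w (t + r)) t := by
    rw [duhamel, ← intervalIntegral.integral_add_adjacent_intervals
      ((hI (t + r)).intervalIntegrable 0 r) ((hI (t + r)).intervalIntegrable r _)]
    congr 1
    · rw [duhamel, S.op_integral _ (hI r), ← intervalIntegral.integral_smul]
      refine intervalIntegral.integral_congr fun s hs => ?_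
      rw [uIcc_of_le r.coe_nonneg] at hs
      simp only [duhamelIntegrand, map_smul, smul_smul, ← Real.exp_add]
      rw [← op_add_apply]
      have h1 : ((t + r : ℝ≥0) - s : ℝ).toNNReal = t + (r - s).toNNReal := by
        rw [NNReal.coe_add, add_sub_assoc, Real.toNNReal_add t.coe_nonneg (sub_nonneg.2 hs.2),
          Real.toNNReal_coe]
      rw [h1]
      congr 2
      push_cast
      ring
    · have h2 := intervalIntegral.integral_comp_add_right (a := 0) (b := t)
        (S.duhamelIntegrand J c w (t + r)) (r : ℝ)
      rw [zero_add, ← NNReal.coe_add] at h2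
      rw [← h2, duhamel]
      refine intervalIntegral.integral_congr fun s hs => ?_
      rw [uIcc_of_le t.coe_nonneg] at hs
      have h3 : ((t + r : ℝ≥0) : ℝ) - (s + r) = t - s := by push_cast; ring
      simp only [duhamelIntegrand]
      rw [h3, Real.toNNReal_add hs.1 r.coe_nonneg, Real.toNNReal_coe]
  have e2 : w (t + r) = _ := hw.eq (t + r)
  have e3 : w r = _ := hw.eq r
  rw [e1] at e2
  rw [e2, e3, map_add, map_smul, smul_add, smul_smul, ← Real.exp_add, ← add_assoc,
    op_add_apply]
  congr 4
  push_cast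
  ring

theorem IsMild.zero_eq {f : C(X, ℝ)} {w : ℝ≥0 → C(X, ℝ)} (hw : S.IsMild J c f w) : w 0 = f := by
  rw [hw.eq 0, duhamel_zero]
  simp [S.op_zero]

/-- The explicit solution started from `1`: for it the Duhamel integrand is the derivative of `s ↦
e^{-ct} e^{ls}`. It yields conservation of mass once the damping is undone. -/
theorem isMild_one {l : ℝ} (hJ1 : J 1 = l • 1) (hlc : l ≤ c) :
    S.IsMild J c 1 (fun t => Real.exp ((l - c) * t) • 1) := by
  refine ⟨by fun_prop, ⟨‖(1 : C(X, ℝ))‖, fun t => ?_⟩, fun t => ?_⟩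
  · rw [norm_smul, Real.norm_eq_abs, Real.abs_exp]
    refine mul_le_of_le_one_left (norm_nonneg _) ?_
    rw [Real.exp_le_one_iff]
    have := t.coe_nonneg
    nlinarith
  · have h : ∀ s ∈ uIcc (0 : ℝ) t, HasDerivAt (fun s : ℝ =>
        (Real.exp (-c * t) * Real.exp (l * s)) • (1 : C(X, ℝ)))
        (S.duhamelIntegrand J c (fun t => Real.exp ((l - c) * t) • 1) t s) s := by
      intro s hs
      rw [uIcc_of_le t.coe_nonneg] at hs
      have h1 : HasDerivAt (fun s : ℝ => l * s) l s := by
        simpa using (hasDerivAt_id s).const_mul l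
      convert! (h1.exp.const_mul (Real.exp (-c * t))).smul_const (1 : C(X, ℝ)) using 1
      simp only [duhamelIntegrand, map_smul, hJ1, S.op_one, smul_smul]
      rw [Real.coe_toNNReal _ hs.1, ← mul_assoc, ← mul_assoc, ← Real.exp_add, ← Real.exp_add]
      congr 3
      ring
    rw [duhamel, intervalIntegral.integral_eq_sub_of_hasDerivAt h
      ((S.continuous_duhamelIntegrand_right J c (by fun_prop) t).intervalIntegrable _ _),
      S.op_one, ← Real.exp_add]
    simp only [mul_zero, Real.exp_zero, mul_one, add_sub_cancel]
    congr 2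
    ring

theorem IsMild.tendsto {f : C(X, ℝ)} {w : ℝ≥0 → C(X, ℝ)} (hw : S.IsMild J c f w) :
    Tendsto (fun t : ℝ≥0 => (t : ℝ)⁻¹ • S.duhamel J c w t) (𝓝[>] 0) (𝓝 (J f)) := by
  have hb : Continuous (fun s : ℝ => J (w s.toNNReal)) := by
    have := hw.continuous
    fun_prop
  have hu : Continuous fun p : ℝ × ℝ => S.duhamelIntegrand J c w p.1.toNNReal p.2 :=
    (S.continuous_duhamelIntegrand J c hw.continuous).comp
      (Continuous.prodMk (by fun_prop) (by fun_prop))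
  rw [Metric.tendsto_nhds]
  intro ε hε
  have h0 : S.duhamelIntegrand J c w (0 : ℝ).toNNReal 0 = J f := by
    simp [duhamelIntegrand, hw.zero_eq, S.op_zero]
  have hε2 : 0 < ε / 2 := by positivity
  have h1 := Metric.continuous_iff.1 hu (0, 0) (ε / 2) hε2
  obtain ⟨δ, hδ, h1⟩ := h1
  have hlt : ∀ᶠ t : ℝ≥0 in 𝓝[>] 0, t < δ.toNNReal :=
    nhdsWithin_le_nhds (Iio_mem_nhds (by simpa using hδ))
  filter_upwards [self_mem_nhdsWithin, hlt] with t ht htδ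
  have ht0 : (0 : ℝ) < t := NNReal.coe_pos.2 ht
  have htδ' : (t : ℝ) < δ := by
    rw [← Real.coe_toNNReal δ hδ.le]
    exact_mod_cast htδ
  have h2 : ‖∫ s in (0 : ℝ)..t, (S.duhamelIntegrand J c w t s - J f)‖ ≤ ε / 2 * |(t : ℝ) - 0| := by
    refine intervalIntegral.norm_integral_le_of_norm_le_const fun s hs => ?_
    rw [uIoc_of_le ht0.le] at hs
    have := h1 (t, s) (by
      rw [Prod.dist_eq, max_lt_iff, Real.dist_eq, Real.dist_eq]
      simp only [sub_zero, abs_of_pos hs.1, abs_of_pos ht0]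
      exact ⟨htδ', hs.2.trans_lt htδ'⟩)
    simp only [Real.toNNReal_coe, h0] at this
    rw [← dist_eq_norm]
    exact this.le
  rw [intervalIntegral.integral_sub
    ((S.continuous_duhamelIntegrand_right J c hw.continuous t).intervalIntegrable _ _)
    (continuous_const.intervalIntegrable _ _), intervalIntegral.integral_const, sub_zero,
    abs_of_pos ht0] at h2
  have h3 : (t : ℝ)⁻¹ • S.duhamel J c w t - J f =
      (t : ℝ)⁻¹ • (S.duhamel J c w t - (t : ℝ) • J f) := by
    rw [smul_sub, inv_smul_smul₀ ht0.ne']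
  rw [dist_eq_norm, h3, norm_smul, norm_inv, Real.norm_of_nonneg ht0.le, inv_mul_lt_iff₀ ht0]
  refine lt_of_le_of_lt h2 ?_
  nlinarith

/-- Bounded perturbation of a Feller generator by `J - l`, where `J` is positive and `J 1 = l`. -/
theorem exists_perturbation {l : ℝ} (hl : 0 ≤ l) (hJ : ∀ f, 0 ≤ f → 0 ≤ J f)
    (hJ1 : J 1 = l • 1) : ∃ T : FellerSemigroup X, ∀ f g : C(X, ℝ),
      T.HasGenerator f g ↔ S.HasGenerator f (g - (J f - l • f)) := by
  -- `2 ‖J‖ ≤ c` is for the contraction, and `l ≤ c` keeps the explicit solution started from `1`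
  -- bounded.
  obtain ⟨c, hc, hJc, hlc⟩ : ∃ c : ℝ, 0 < c ∧ 2 * ‖J‖ ≤ c ∧ l ≤ c :=
    ⟨2 * ‖J‖ + l + 1, by positivity, by linarith, by have := norm_nonneg J; linarith⟩
  choose w hw hw0 using S.exists_isMild hc hJc hJ
  have huniq := fun (f : C(X, ℝ)) (v v' : ℝ≥0 → C(X, ℝ)) => IsMild.unique S hc hJc (f := f)
    (w := v) (w' := v')
  have hadd : ∀ f g, w (f + g) = w f + w g := fun f g =>
    huniq _ _ _ (hw _) (IsMild.add S (hw f) (hw g))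
  have hsmul : ∀ (a : ℝ) f, w (a • f) = a • w f := fun a f =>
    huniq _ _ _ (hw _) (IsMild.smul S a (hw f))
  have hone : w 1 = fun t : ℝ≥0 => Real.exp ((l - c) * t) • 1 :=
    huniq _ _ _ (hw 1) (S.isMild_one hJ1 hlc)
  have hshift : ∀ f r t, w (w f r) t = w f (t + r) := fun f r t =>
    congrFun (huniq _ _ _ (hw _) (IsMild.shift S (hw f) r)) t
  -- The mild solution belongs to the generator of `S` plus `J - c`; the factor `e^{(c-l)t}` turns
  -- this into `J - l`.
  let A : ℝ≥0 → C(X, ℝ) →ₗ[ℝ] C(X, ℝ) := fun t =>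
    { toFun := fun f => Real.exp ((c - l) * t) • w f t
      map_add' := fun f g => by rw [hadd, Pi.add_apply, smul_add]
      map_smul' := fun a f => by rw [hsmul, Pi.smul_apply, smul_comm, RingHom.id_apply] }
  have hA : ∀ t f, A t f = Real.exp ((c - l) * t) • w f t := fun _ _ => rfl
  have hA1 : ∀ t, A t 1 = 1 := fun t => by
    rw [hA, hone, smul_smul, ← Real.exp_add]
    simp [← add_mul]
  have hA0 : ∀ t f, 0 ≤ f → 0 ≤ A t f := fun t f hf =>
    smul_nonneg (Real.exp_nonneg _) (hw0 f hf t)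
  have hAbd : ∀ t f, ‖A t f‖ ≤ 1 * ‖f‖ := by
    intro t f
    rw [one_mul, ContinuousMap.norm_le _ (norm_nonneg f)]
    intro x
    have h1 := hA0 t (‖f‖ • 1 - f) fun y => by
      simpa using (le_abs_self _).trans (f.norm_coe_le_norm y)
    have h2 := hA0 t (‖f‖ • 1 + f) fun y => by
      have h : -‖f‖ ≤ f y := neg_le_of_abs_le (f.norm_coe_le_norm y)
      have : 0 ≤ ‖f‖ * 1 + f y := by linarith
      exact this
    rw [map_sub, map_smul, hA1] at h1
    rw [map_add, map_smul, hA1] at h2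
    have h3 : 0 ≤ ‖f‖ * 1 - A t f x := h1 x
    have h4 : 0 ≤ ‖f‖ * 1 + A t f x := h2 x
    exact abs_le.2 ⟨by linarith, by linarith⟩
  let T : FellerSemigroup X :=
    { op := fun t => (A t).mkContinuous 1 (hAbd t)
      op_zero := by
        ext1 f
        simp [hA, IsMild.zero_eq S (hw f)]
      op_add := fun s t => by
        ext1 f
        simp only [LinearMap.mkContinuous_apply, ContinuousLinearMap.comp_apply, hA, hsmul,
          Pi.smul_apply, hshift, smul_smul, ← Real.exp_add]
        congr 2
        push_cast
        ring
      op_one := hA1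
      op_nonneg := hA0
      op_continuous := fun f => by
        have h : Continuous fun t : ℝ≥0 => Real.exp ((c - l) * t) • w f t := by
          have := (hw f).continuous
          fun_prop
        simpa [hA, IsMild.zero_eq S (hw f)] using h.tendsto 0 }
  refine ⟨T, fun f g => ?_⟩
  have hT : ∀ t, T.op t f = Real.exp (-l * t) • S.op t f +
      Real.exp ((c - l) * t) • S.duhamel J c (w f) t := fun t => by
    change Real.exp ((c - l) * t) • w f t = _
    rw [(hw f).eq t, smul_add, smul_smul, ← Real.exp_add]
    congr 3
    ring
  have hexp : ∀ a : ℝ, Tendsto (fun t : ℝ≥0 => Real.exp (a * t)) (𝓝[>] 0) (𝓝 1) := fun a => by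
    have : Continuous fun t : ℝ≥0 => Real.exp (a * t) := by fun_prop
    simpa using (this.tendsto 0).mono_left nhdsWithin_le_nhds
  have hexp' : Tendsto (fun t : ℝ≥0 => (t : ℝ)⁻¹ * (Real.exp (-l * t) - 1)) (𝓝[>] 0)
      (𝓝 (-l)) := by
    have h : HasDerivAt (fun t : ℝ => Real.exp (-l * t)) (-l) 0 := by
      simpa using ((hasDerivAt_id (0 : ℝ)).const_mul (-l)).exp
    simpa [Function.comp_def] using h.tendsto_slope_zero_right.comp tendsto_coe_nhdsGT_zero
  have hScont : Tendsto (fun t : ℝ≥0 => S.op t f) (𝓝[>] 0) (𝓝 f) :=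
    (S.op_continuous f).mono_left nhdsWithin_le_nhds
  -- For every `f`, in the domain or not, the difference quotients of `T` and `S` differ by a
  -- convergent term. Hence the two domains coincide.
  have hdiff : Tendsto (fun t : ℝ≥0 => (t : ℝ)⁻¹ • (T.op t f - f) - (t : ℝ)⁻¹ • (S.op t f - f))
      (𝓝[>] 0) (𝓝 (J f - l • f)) := by
    have h := (hexp'.smul hScont).add ((hexp (c - l)).smul (IsMild.tendsto S (hw f)))
    rw [one_smul, neg_smul, neg_add_eq_sub] at h
    refine h.congr fun t => ?_
    rw [hT, smul_comm (Real.exp _)]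
    module
  constructor
  · intro h
    have := Tendsto.sub h hdiff
    exact this.congr fun t => by abel
  · intro h
    have := Tendsto.add h hdiff
    rw [sub_add_cancel] at this
    exact this.congr fun t => by abel

end Perturbation

/-! ### Existence of invariant measures -/

section Invariant

variable {X : Type*} [TopologicalSpace X] [CompactSpace X] [T2Space X] [MeasurableSpace X]
  [BorelSpace X]

theorem exists_probabilityMeasure_of_positive (Λ : C(X, ℝ) →ₗ[ℝ] ℝ) (h0 : ∀ f, 0 ≤ f → 0 ≤ Λ f)
    (h1 : Λ 1 = 1) : ∃ μ : ProbabilityMeasure X, ∀ f : C(X, ℝ), ∫ x, f x ∂(μ : Measure X) = Λ f := by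
  let Λ' : CompactlySupportedContinuousMap X ℝ →ₚ[ℝ] ℝ :=
    { toFun := fun f => Λ f.toContinuousMap
      map_add' := fun f g => by rw [← map_add]; rfl
      map_smul' := fun a f => by rw [RingHom.id_apply, ← map_smul]; rfl
      monotone' := fun f g hfg => by
        have := h0 (g.toContinuousMap - f.toContinuousMap) (sub_nonneg.2 hfg)
        rwa [map_sub, sub_nonneg] at this }
  have hint : ∀ f : C(X, ℝ), ∫ x, f x ∂(RealRMK.rieszMeasure Λ') = Λ f := fun f =>
    RealRMK.integral_rieszMeasure Λ'
      { toContinuousMap := f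
        hasCompactSupport' := HasCompactSupport.of_compactSpace _ }
  have hone := hint 1
  simp only [ContinuousMap.one_apply, integral_const, smul_eq_mul, mul_one, h1] at hone
  have hp : IsProbabilityMeasure (RealRMK.rieszMeasure Λ') := by
    refine ⟨?_⟩
    rw [measureReal_def] at hone
    rw [← ENNReal.ofReal_toReal (a := RealRMK.rieszMeasure Λ' univ), hone, ENNReal.ofReal_one]
    intro h
    simp [h] at hone
  exact ⟨⟨_, hp⟩, hint⟩

/-- Krylov–Bogolyubov: time averages of an orbit at a point are asymptotically invariant. Limits
along an ultrafilter exist for all `f` at once and give a positive linear functional, which the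
Riesz representation theorem turns into a measure. -/
theorem exists_isInvariant [Nonempty X] (T : FellerSemigroup X) :
    ∃ μ : ProbabilityMeasure X, T.IsInvariant μ := by
  obtain ⟨x⟩ := ‹Nonempty X›
  let m : ℕ → C(X, ℝ) → ℝ := fun n f => ((n : ℝ) + 1)⁻¹ * ∫ s in (0 : ℝ)..(n + 1), T.orbit f s x
  have hc : ∀ f, Continuous fun s => T.orbit f s x := fun f =>
    (continuous_eval_const x).comp (T.continuous_orbit f)
  have hi : ∀ f a b, IntervalIntegrable (fun s => T.orbit f s x) volume a b := fun f a b =>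
    (hc f).intervalIntegrable a b
  have hint : ∀ f (a b : ℝ), |∫ s in a..b, T.orbit f s x| ≤ ‖f‖ * |b - a| := fun f a b =>
    intervalIntegral.norm_integral_le_of_norm_le_const fun s _ =>
      ((T.orbit f s).norm_coe_le_norm x).trans (T.norm_orbit_le f s)
  have hn : ∀ n : ℕ, (0 : ℝ) < n + 1 := fun n => by positivity
  have hbd : ∀ (n : ℕ) f, m n f ∈ Icc (-‖f‖) ‖f‖ := fun n f => by
    rw [mem_Icc, ← abs_le, abs_mul, abs_of_pos (inv_pos.2 (hn n)), inv_mul_le_iff₀ (hn n)]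
    have := hint f 0 (n + 1)
    rwa [sub_zero, abs_of_pos (hn n), mul_comm] at this
  have hex : ∀ f, ∃ a, Tendsto (fun n => m n f) (hyperfilter ℕ) (𝓝 a) := fun f => by
    obtain ⟨a, -, ha⟩ := (isCompact_Icc (a := -‖f‖) (b := ‖f‖)).ultrafilter_le_nhds
      ((hyperfilter ℕ).map fun n => m n f) (by
        rw [le_principal_iff]
        exact mem_map.2 (Eventually.of_forall fun n => hbd n f))
    exact ⟨a, ha⟩
  choose Λ hΛ using hex
  let L : C(X, ℝ) →ₗ[ℝ] ℝ :=
    { toFun := Λ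
      map_add' := fun f g => by
        refine tendsto_nhds_unique (hΛ (f + g)) (((hΛ f).add (hΛ g)).congr fun n => ?_)
        simp only [m]
        rw [← mul_add, ← intervalIntegral.integral_add (hi f _ _) (hi g _ _)]
        simp [orbit]
      map_smul' := fun a f => by
        refine tendsto_nhds_unique (hΛ (a • f)) (((hΛ f).const_mul a).congr fun n => ?_)
        simp only [m]
        rw [mul_left_comm, ← intervalIntegral.integral_const_mul]
        simp [orbit] }
  obtain ⟨μ, hμ⟩ := exists_probabilityMeasure_of_positive L
    (fun f hf => ge_of_tendsto' (hΛ f) fun n => mul_nonneg (inv_nonneg.2 (hn n).le)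
      (intervalIntegral.integral_nonneg (hn n).le fun s _ => T.op_nonneg _ _ hf x))
    (by
      refine tendsto_nhds_unique (hΛ 1) (tendsto_const_nhds.congr fun n => ?_)
      simp only [m, orbit, T.op_one, ContinuousMap.one_apply, intervalIntegral.integral_const,
        sub_zero, smul_eq_mul, mul_one]
      rw [inv_mul_cancel₀ (hn n).ne'])
  refine ⟨μ, fun t f => ?_⟩
  rw [hμ, hμ]
  change Λ _ = Λ _
  have h1 := (hΛ (T.op t f)).sub (hΛ f)
  have h2 : Tendsto (fun n => m n (T.op t f) - m n f) (hyperfilter ℕ) (𝓝 0) := by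
    have h3 : Tendsto (fun n : ℕ => 1 / ((n : ℝ) + 1) * (‖f‖ * t + ‖f‖ * t)) (hyperfilter ℕ)
        (𝓝 0) := by
      rw [← zero_mul (‖f‖ * t + ‖f‖ * t)]
      exact (tendsto_one_div_add_atTop_nhds_zero_nat.mul_const _).mono_left
        Nat.hyperfilter_le_atTop
    refine squeeze_zero_norm (fun n => ?_) h3
    have e1 : ∫ s in (0 : ℝ)..(n + 1), T.orbit (T.op t f) s x =
        ∫ s in (t : ℝ)..(n + 1 + t), T.orbit f s x := by
      have := intervalIntegral.integral_comp_add_right (a := 0) (b := n + 1)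
        (fun s => T.orbit f s x) (t : ℝ)
      rw [zero_add] at this
      rw [← this]
      refine intervalIntegral.integral_congr fun s hs => ?_
      rw [uIcc_of_le (hn n).le] at hs
      simp only [orbit]
      rw [Real.toNNReal_add hs.1 t.coe_nonneg, T.op_add, Real.toNNReal_coe]
      rfl
    -- Translating the window `[0, n+1]` by `t` changes the integral only on two pieces of length
    -- `t`, which vanish after division by `n + 1`.
    have e2 : (∫ s in (t : ℝ)..(n + 1 + t), T.orbit f s x) - ∫ s in (0 : ℝ)..(n + 1), T.orbit f s x
        = (∫ s in ((n : ℝ) + 1)..(n + 1 + t), T.orbit f s x) - ∫ s in (0 : ℝ)..t, T.orbit f s x := by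
      rw [sub_eq_sub_iff_add_eq_add, add_comm,
        intervalIntegral.integral_add_adjacent_intervals (hi _ _ _) (hi _ _ _),
        add_comm (∫ s in ((n : ℝ) + 1)..(n + 1 + t), T.orbit f s x),
        intervalIntegral.integral_add_adjacent_intervals (hi _ _ _) (hi _ _ _)]
    simp only [m]
    rw [← mul_sub, e1, e2, norm_mul, norm_inv, Real.norm_of_nonneg (hn n).le, one_div]
    gcongr
    refine (norm_sub_le _ _).trans (add_le_add ?_ ?_)
    · simpa using hint f (n + 1) (n + 1 + t)
    · simpa using hint f 0 t
  exact sub_eq_zero.1 (tendsto_nhds_unique h1 h2)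

end Invariant

theorem IsInvariant.integral_generator {X : Type*} [TopologicalSpace X] [CompactSpace X]
    [MeasurableSpace X] [BorelSpace X] {T : FellerSemigroup X} {μ : ProbabilityMeasure X}
    (hμ : T.IsInvariant μ) {f g : C(X, ℝ)} (h : T.HasGenerator f g) :
    ∫ x, g x ∂(μ : Measure X) = 0 := by
  have hint : ∀ f : C(X, ℝ), Integrable f (μ : Measure X) := fun f =>
    f.continuous.integrable_of_hasCompactSupport (HasCompactSupport.of_compactSpace _)
  have hcont : Continuous fun f : C(X, ℝ) => ∫ x, f x ∂(μ : Measure X) := by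
    refine (LipschitzWith.of_dist_le_mul (K := 1) fun f g => ?_).continuous
    rw [dist_eq_norm, ← integral_sub (hint f) (hint g), NNReal.coe_one, one_mul, dist_eq_norm]
    refine (norm_integral_le_of_norm_le_const
      (Eventually.of_forall fun x => (f - g).norm_coe_le_norm x)).trans ?_
    simp
  refine tendsto_nhds_unique ((hcont.tendsto g).comp h) (tendsto_const_nhds.congr fun t => ?_)
  simp only [Function.comp_apply, ContinuousMap.smul_apply, ContinuousMap.sub_apply, smul_eq_mul]
  rw [integral_const_mul, integral_sub (hint _) (hint _), hμ, sub_self, mul_zero]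

end FellerSemigroup

/-! ### The triple norm and its dense algebra of functions -/

section SiteLipschitz

variable {d : ℕ} {E : Type*} [MetricSpace E]

theorem enorm_le_of_ofReal_le {a : ℝ} {K : ℝ≥0∞} (h : ENNReal.ofReal a ≤ K)
    (h' : ENNReal.ofReal (-a) ≤ K) : ‖a‖ₑ ≤ K := by
  rw [Real.enorm_eq_ofReal_abs]
  rcases abs_choice a with e | e <;> rwa [e]

theorem ofReal_sub_le_siteLipschitz (f : Config d E → ℝ) {η ξ : Config d E} {x : Site d}
    (h : ∀ y, y ≠ x → η y = ξ y) :
    ENNReal.ofReal (f η - f ξ) ≤ siteLipschitz f x * edist (η x) (ξ x) := by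
  by_cases hx : η x = ξ x
  · have : η = ξ := by
      funext y
      by_cases hy : y = x
      · rw [hy, hx]
      · exact h y hy
    simp [this]
  · have hd : 0 < dist (η x) (ξ x) := dist_pos.2 hx
    calc ENNReal.ofReal (f η - f ξ)
        = ENNReal.ofReal ((f η - f ξ) / dist (η x) (ξ x)) * edist (η x) (ξ x) := by
          rw [edist_dist, ← ENNReal.ofReal_mul' hd.le, div_mul_cancel₀ _ hd.ne']
      _ ≤ _ := by
          gcongr
          exact le_iSup₂_of_le η ξ (le_iSup_of_le ⟨hx, h⟩ le_rfl)

theorem enorm_sub_le_siteLipschitz (f : Config d E → ℝ) {η ξ : Config d E} {x : Site d}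
    (h : ∀ y, y ≠ x → η y = ξ y) : ‖f η - f ξ‖ₑ ≤ siteLipschitz f x * edist (η x) (ξ x) := by
  refine enorm_le_of_ofReal_le (ofReal_sub_le_siteLipschitz f h) ?_
  rw [neg_sub, edist_comm]
  exact ofReal_sub_le_siteLipschitz f fun y hy => (h y hy).symm

theorem siteLipschitz_le {f : Config d E → ℝ} {x : Site d} {K : ℝ≥0∞}
    (h : ∀ η ξ : Config d E, (∀ y, y ≠ x → η y = ξ y) → ‖f η - f ξ‖ₑ ≤ K * edist (η x) (ξ x)) :
    siteLipschitz f x ≤ K := by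
  refine iSup₂_le fun η ξ => iSup_le fun hηξ => ?_
  have hd : 0 < dist (η x) (ξ x) := dist_pos.2 hηξ.1
  rw [ENNReal.ofReal_div_of_pos hd, ← edist_dist]
  refine ENNReal.div_le_of_le_mul (le_trans ?_ (h η ξ hηξ.2))
  rw [Real.enorm_eq_ofReal_abs]
  exact ENNReal.ofReal_le_ofReal (le_abs_self _)

/-- The total variation bound `|f η - f ξ| ≤ ∑_x δ_f(x) ρ(η(x), ξ(x))`. -/
theorem enorm_sub_le_tsum_siteLipschitz {f : Config d E → ℝ} (hf : Continuous f)
    (η ξ : Config d E) : ‖f η - f ξ‖ₑ ≤ ∑' x, siteLipschitz f x * edist (η x) (ξ x) := by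
  classical
  have hfin : ∀ s : Finset (Site d), ‖f (s.piecewise η ξ) - f ξ‖ₑ ≤
      ∑ x ∈ s, siteLipschitz f x * edist (η x) (ξ x) := by
    intro s
    induction s using Finset.induction_on with
    | empty => simp
    | insert a s ha ih =>
      rw [Finset.sum_insert ha,
        ← sub_add_sub_cancel (f ((insert a s).piecewise η ξ)) (f (s.piecewise η ξ)) (f ξ)]
      refine (enorm_add_le _ _).trans (add_le_add ?_ ih)
      have := enorm_sub_le_siteLipschitz f (η := (insert a s).piecewise η ξ)
        (ξ := s.piecewise η ξ) (x := a) fun y hy => by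
          by_cases hys : y ∈ s <;> simp [Finset.piecewise, hys, hy]
      simpa [Finset.piecewise, ha] using this
  have hlim : Tendsto (fun s : Finset (Site d) => s.piecewise η ξ) atTop (𝓝 η) := by
    rw [tendsto_pi_nhds]
    intro x
    refine tendsto_const_nhds.congr' ?_
    filter_upwards [eventually_ge_atTop {x}] with s hs
    simp [Finset.piecewise, Finset.singleton_subset_iff.1 hs]
  have h2 : Tendsto (fun s : Finset (Site d) => ‖f (s.piecewise η ξ) - f ξ‖ₑ) atTop
      (𝓝 ‖f η - f ξ‖ₑ) :=
    (((hf.tendsto η).comp hlim).sub_const (f ξ)).enorm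
  exact le_of_tendsto' h2 fun s => (hfin s).trans (ENNReal.sum_le_tsum s)

theorem enorm_sub_le_tripleNorm (hE : ∀ a b : E, dist a b ≤ 1) {f : Config d E → ℝ}
    (hf : Continuous f) (η ξ : Config d E) : ‖f η - f ξ‖ₑ ≤ tripleNorm f := by
  refine (enorm_sub_le_tsum_siteLipschitz hf η ξ).trans (ENNReal.tsum_le_tsum fun x => ?_)
  refine mul_le_of_le_one_right' ?_
  rw [edist_dist]
  exact ENNReal.ofReal_le_one.2 (hE _ _)

theorem tripleNorm_add_le (f g : Config d E → ℝ) :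
    tripleNorm (f + g) ≤ tripleNorm f + tripleNorm g := by
  rw [tripleNorm, tripleNorm, tripleNorm, ← ENNReal.tsum_add]
  refine ENNReal.tsum_le_tsum fun x => siteLipschitz_le fun η ξ h => ?_
  have e : (f + g) η - (f + g) ξ = (f η - f ξ) + (g η - g ξ) := by
    simp only [Pi.add_apply]
    ring
  rw [e, add_mul]
  exact (enorm_add_le _ _).trans
    (add_le_add (enorm_sub_le_siteLipschitz f h) (enorm_sub_le_siteLipschitz g h))

theorem tripleNorm_mul_le [CompactSpace E] (f g : C(Config d E, ℝ)) :
    tripleNorm (f * g : C(Config d E, ℝ)) ≤ ‖f‖ₑ * tripleNorm g + ‖g‖ₑ * tripleNorm f := by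
  have hle : ∀ (f : C(Config d E, ℝ)) η, ‖f η‖ₑ ≤ ‖f‖ₑ := fun f η => by
    rw [enorm_le_iff_norm_le]
    exact f.norm_coe_le_norm η
  rw [tripleNorm, tripleNorm, tripleNorm, ← ENNReal.tsum_mul_left, ← ENNReal.tsum_mul_left,
    ← ENNReal.tsum_add]
  refine ENNReal.tsum_le_tsum fun x => siteLipschitz_le fun η ξ h => ?_
  have e : (f * g) η - (f * g) ξ = f η * (g η - g ξ) + g ξ * (f η - f ξ) := by
    simp only [ContinuousMap.mul_apply]
    ring
  rw [e, add_mul, mul_assoc, mul_assoc]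
  refine (enorm_add_le _ _).trans (add_le_add ?_ ?_) <;> rw [enorm_mul]
  · exact mul_le_mul' (hle _ _) (enorm_sub_le_siteLipschitz g h)
  · exact mul_le_mul' (hle _ _) (enorm_sub_le_siteLipschitz f h)

theorem tripleNorm_const (c : ℝ) : tripleNorm (fun _ : Config d E => c) = 0 := by
  simp [tripleNorm, siteLipschitz]

theorem tripleNorm_dist_eval_le (x : Site d) (e : E) :
    tripleNorm (fun η : Config d E => dist (η x) e) ≤ 1 := by
  classical
  rw [tripleNorm, tsum_eq_single x]
  · refine siteLipschitz_le fun η ξ _ => ?_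
    rw [one_mul, edist_dist, Real.enorm_eq_ofReal_abs]
    exact ENNReal.ofReal_le_ofReal (abs_dist_sub_le _ _ _)
  · intro y hy
    refine le_antisymm (siteLipschitz_le fun η ξ h => ?_) zero_le
    simp [h x hy.symm]

/-- The continuous functions of finite triple norm are a subalgebra of `C(Ω)`. -/
def tripleNormSubalgebra (d : ℕ) (E : Type*) [MetricSpace E] [CompactSpace E] :
    Subalgebra ℝ C(Config d E, ℝ) where
  carrier := {f | tripleNorm f < ∞}
  mul_mem' {f g} hf hg := (tripleNorm_mul_le f g).trans_lt
    (ENNReal.add_lt_top.2 ⟨ENNReal.mul_lt_top enorm_lt_top hg, ENNReal.mul_lt_top enorm_lt_top hf⟩)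
  add_mem' {f g} hf hg := (tripleNorm_add_le f g).trans_lt (ENNReal.add_lt_top.2 ⟨hf, hg⟩)
  algebraMap_mem' c := (tripleNorm_const c).trans_lt ENNReal.zero_lt_top

/-- Stone–Weierstrass: by the Leibniz rule the functions of finite triple norm form an algebra, and
the functions `η ↦ ρ(η(x), e)` in it separate points. Hence laws are determined by their integrals
of such functions. -/
theorem dense_tripleNorm_lt_top [CompactSpace E] :
    Dense {f : C(Config d E, ℝ) | tripleNorm f < ∞} := by
  have h : (tripleNormSubalgebra d E).topologicalClosure = ⊤ := by
    refine ContinuousMap.subalgebra_topologicalClosure_eq_top_of_separatesPoints _ ?_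
    intro η ξ hηξ
    obtain ⟨x, hx⟩ := Function.ne_iff.1 hηξ
    let f : C(Config d E, ℝ) := ⟨fun ζ => dist (ζ x) (ξ x), by fun_prop⟩
    refine ⟨f, ⟨f, (tripleNorm_dist_eval_le x (ξ x)).trans_lt ENNReal.one_lt_top, rfl⟩, ?_⟩
    simp [f, hx]
  intro f
  have : f ∈ (tripleNormSubalgebra d E).topologicalClosure := by simp [h]
  exact this

end SiteLipschitz

section ConfigMeasure

variable {d : ℕ} {E : Type*} [MetricSpace E] [CompactSpace E] [MeasurableSpace E] [BorelSpace E]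

theorem integrable_of_continuous {μ : Measure (Config d E)} [IsFiniteMeasure μ]
    (f : C(Config d E, ℝ)) : Integrable f μ :=
  f.continuous.integrable_of_hasCompactSupport (HasCompactSupport.of_compactSpace _)

theorem continuous_integral (μ : ProbabilityMeasure (Config d E)) :
    Continuous fun f : C(Config d E, ℝ) => ∫ η, f η ∂(μ : Measure (Config d E)) := by
  refine (LipschitzWith.of_dist_le_mul (K := 1) fun f g => ?_).continuous
  rw [dist_eq_norm, ← integral_sub (integrable_of_continuous f) (integrable_of_continuous g),
    NNReal.coe_one, one_mul, dist_eq_norm]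
  refine (norm_integral_le_of_norm_le_const
    (Eventually.of_forall fun x => (f - g).norm_coe_le_norm x)).trans ?_
  simp

theorem probabilityMeasure_eq_of_tripleNorm {μ ν : ProbabilityMeasure (Config d E)}
    (h : ∀ f : C(Config d E, ℝ), tripleNorm f < ∞ →
      ∫ η, f η ∂(μ : Measure (Config d E)) = ∫ η, f η ∂(ν : Measure (Config d E))) : μ = ν := by
  have h2 : (fun f : C(Config d E, ℝ) => ∫ η, f η ∂(μ : Measure (Config d E))) =
      fun f => ∫ η, f η ∂(ν : Measure (Config d E)) :=
    (continuous_integral μ).ext_on dense_tripleNorm_lt_top (continuous_integral ν) h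
  apply Subtype.ext
  change (μ : Measure (Config d E)) = (ν : Measure (Config d E))
  refine ext_of_forall_integral_eq_of_IsFiniteMeasure fun f => ?_
  exact congrFun h2 f.toContinuousMap

end ConfigMeasure

section Shift

variable {d : ℕ} {E : Type*} [TopologicalSpace E]

theorem shift_shift (x y : Site d) (η : Config d E) :
    shift x (shift y η) = shift (x + y) η := by
  funext w
  change η (w - x - y) = η (w - (x + y))
  congr 1
  abel

theorem shift_zero (η : Config d E) : shift 0 η = η := by
  funext w
  change η (w - 0) = η w
  rw [sub_zero]

end Shift

/-! ### The jump operator and the environment process semigroup -/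

section JumpOperator

variable {d : ℕ} {E : Type*} [MetricSpace E] [CompactSpace E]

namespace JumpRates

/-- The rate of the jump `z`, as a continuous function of the environment. -/
def rateMap (α : JumpRates d E) (z : Site d) : C(Config d E, ℝ) :=
  ⟨fun η => α.rate η z, α.continuous z⟩

theorem rate_le_norm (α : JumpRates d E) (η : Config d E) (z : Site d) :
    α.rate η z ≤ ‖α.rateMap z‖ :=
  (le_abs_self _).trans ((α.rateMap z).norm_coe_le_norm η)

theorem summable_norm_mul (α : JumpRates d E) : Summable fun z : Site d => ‖z‖ * ‖α.rateMap z‖ := by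
  have h : ∑' z : Site d, ((‖z‖₊ * ‖α.rateMap z‖₊ : ℝ≥0) : ℝ≥0∞) ≠ ∞ := by
    refine (lt_of_le_of_lt (ENNReal.tsum_le_tsum fun z => ?_) α.firstMoment).ne
    rw [ENNReal.coe_mul, pow_one]
    refine mul_le_mul_right ?_ _
    change ‖α.rateMap z‖ₑ ≤ _
    rw [ContinuousMap.enorm_eq_iSup_enorm]
    exact le_rfl
  have h2 := NNReal.summable_coe.2 (ENNReal.tsum_coe_ne_top_iff_summable.1 h)
  simpa using h2

theorem one_le_norm_site {z : Site d} (hz : z ≠ 0) : 1 ≤ ‖z‖ := by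
  obtain ⟨i, hi⟩ := Function.ne_iff.1 hz
  refine le_trans ?_ (norm_le_pi_norm z i)
  rw [Int.norm_eq_abs]
  exact_mod_cast Int.one_le_abs hi

/-- Nonzero sites have norm at least `1`, so the first moment controls every term except the one at
`z = 0`, which it does not see. -/
theorem summable_norm (α : JumpRates d E) : Summable fun z : Site d => ‖α.rateMap z‖ := by
  classical
  refine Summable.of_nonneg_of_le (fun _ => norm_nonneg _) (fun z => ?_)
    (α.summable_norm_mul.add (summable_of_hasFiniteSupport
      (f := fun z : Site d => if z = 0 then ‖α.rateMap 0‖ else 0)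
      ((finite_singleton (0 : Site d)).subset fun z hz => by
        by_contra h
        simp_all)))
  by_cases hz : z = 0
  · simp [hz]
  · simp only [hz, if_false, add_zero]
    exact le_mul_of_one_le_left (norm_nonneg _) (one_le_norm_site hz)

theorem summable_rate (α : JumpRates d E) (η : Config d E) : Summable fun z => α.rate η z :=
  Summable.of_nonneg_of_le (α.nonneg η) (α.rate_le_norm η) α.summable_norm

/-- The bound `∑_z sup_η α(η, z)` for the total jump rate. -/
def bound (α : JumpRates d E) : ℝ := ∑' z, ‖α.rateMap z‖

/-- The first moment `∑_z ‖z‖ sup_η α(η, z)`. -/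
def moment (α : JumpRates d E) : ℝ := ∑' z : Site d, ‖z‖ * ‖α.rateMap z‖

theorem bound_nonneg (α : JumpRates d E) : 0 ≤ α.bound := tsum_nonneg fun _ => norm_nonneg _

theorem moment_nonneg (α : JumpRates d E) : 0 ≤ α.moment := tsum_nonneg fun _ => by positivity

theorem tsum_rate_le (α : JumpRates d E) (η : Config d E) : ∑' z, α.rate η z ≤ α.bound :=
  (α.summable_rate η).tsum_le_tsum (α.rate_le_norm η) α.summable_norm

end JumpRates

/-- Composition with a shift. -/
def shiftOp (z : Site d) : C(Config d E, ℝ) →L[ℝ] C(Config d E, ℝ) :=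
  LinearMap.mkContinuous
    { toFun := fun f => f.comp (shift z)
      map_add' := fun _ _ => rfl
      map_smul' := fun _ _ => rfl } 1 fun f => by
    rw [one_mul, ContinuousMap.norm_le _ (norm_nonneg f)]
    exact fun η => f.norm_coe_le_norm _

theorem shiftOp_apply (z : Site d) (f : C(Config d E, ℝ)) (η : Config d E) :
    shiftOp z f η = f (shift z η) := rfl

namespace JumpRates

/-- One term of the jump operator. -/
def jumpTerm (α : JumpRates d E) (z : Site d) : C(Config d E, ℝ) →L[ℝ] C(Config d E, ℝ) :=
  (ContinuousLinearMap.mul ℝ C(Config d E, ℝ) (α.rateMap z)).comp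
    (shiftOp (-z) - ContinuousLinearMap.id ℝ _)

theorem norm_jumpTerm_le (α : JumpRates d E) (z : Site d) :
    ‖α.jumpTerm z‖ ≤ ‖α.rateMap z‖ * 2 := by
  refine ContinuousLinearMap.opNorm_le_bound _ (by positivity) fun f => ?_
  change ‖α.rateMap z * (shiftOp (-z) f - f)‖ ≤ _
  rw [mul_assoc]
  refine (norm_mul_le _ _).trans (mul_le_mul_of_nonneg_left ?_ (norm_nonneg _))
  rw [two_mul]
  refine (norm_sub_le _ _).trans (add_le_add ?_ le_rfl)
  rw [ContinuousMap.norm_le _ (norm_nonneg f)]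
  exact fun η => f.norm_coe_le_norm _

theorem summable_jumpTerm (α : JumpRates d E) : Summable α.jumpTerm :=
  have h : Summable fun z => ‖α.rateMap z‖ * 2 := α.summable_norm.mul_right 2
  Summable.of_norm (E := C(Config d E, ℝ) →L[ℝ] C(Config d E, ℝ)) (f := fun z => α.jumpTerm z)
    (Summable.of_nonneg_of_le (fun z => norm_nonneg (α.jumpTerm z))
      (fun z => α.norm_jumpTerm_le z) h)

/-- The jump part `f ↦ ∑_z α(·, z) (f ∘ θ_{-z} - f)` of the environment process generator. -/
def jumpOp (α : JumpRates d E) : C(Config d E, ℝ) →L[ℝ] C(Config d E, ℝ) := ∑' z, α.jumpTerm z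

theorem hasSum_jumpOp (α : JumpRates d E) (f : C(Config d E, ℝ)) (η : Config d E) :
    HasSum (fun z => α.rate η z * (f (shift (-z) η) - f η)) (α.jumpOp f η) := by
  have h1 := α.summable_jumpTerm.hasSum.mapL (ContinuousLinearMap.apply ℝ C(Config d E, ℝ) f)
  exact h1.mapL (ContinuousMap.evalCLM ℝ η)

/-- Moving the diagonal part to the other side leaves a series with nonnegative terms for `f ≥ 0`,
the form in which positivity is read off. -/
theorem hasSum_jumpOp_add (α : JumpRates d E) (f : C(Config d E, ℝ)) (η : Config d E) :
    HasSum (fun z => α.rate η z * f (shift (-z) η))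
      (α.jumpOp f η + (∑' z, α.rate η z) * f η) := by
  have := (α.hasSum_jumpOp f η).add ((α.summable_rate η).hasSum.mul_right (f η))
  refine this.congr_fun fun z => ?_
  ring

theorem jumpOp_const (α : JumpRates d E) (c : ℝ) : α.jumpOp (ContinuousMap.const _ c) = 0 := by
  ext η
  have := α.hasSum_jumpOp (ContinuousMap.const _ c) η
  simp only [ContinuousMap.const_apply, sub_self, mul_zero] at this
  exact this.unique hasSum_zero

end JumpRates

variable [MeasurableSpace E]

theorem isEnvProcessSemigroup_iff (P : FellerProcess (Config d E)) (α : JumpRates d E)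
    (T : FellerSemigroup (Config d E)) : IsEnvProcessSemigroup P α T ↔
      ∀ f g, T.HasGenerator f g ↔ P.semigroup.HasGenerator f (g - α.jumpOp f) := by
  constructor
  · intro h f g
    refine h f g _ fun η => ?_
    rw [(α.hasSum_jumpOp f η).tsum_eq, ContinuousMap.sub_apply, sub_add_cancel]
  · intro h f g k hk
    rw [h]
    have : g - α.jumpOp f = k := by
      ext η
      rw [ContinuousMap.sub_apply, hk, (α.hasSum_jumpOp f η).tsum_eq, add_sub_cancel_right]
    rw [this]

theorem existsUnique_isEnvProcessSemigroup (P : FellerProcess (Config d E)) (α : JumpRates d E) :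
    ∃! T, IsEnvProcessSemigroup P α T := by
  simp only [isEnvProcessSemigroup_iff]
  -- Adding `α.bound` times the identity makes the jump operator positive, since `α.bound` dominates
  -- the total rate in every environment. The perturbation theorem subtracts it again.
  obtain ⟨T, hT⟩ := P.semigroup.exists_perturbation
    (J := α.jumpOp + α.bound • ContinuousLinearMap.id ℝ _) α.bound_nonneg
    (fun f hf => by
      rw [ContinuousMap.le_def]
      intro η
      change 0 ≤ α.jumpOp f η + α.bound * f η
      have h1 : 0 ≤ α.jumpOp f η + (∑' z, α.rate η z) * f η :=
        (α.hasSum_jumpOp_add f η).nonneg fun z => mul_nonneg (α.nonneg _ _) (hf _)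
      have h2 := mul_le_mul_of_nonneg_right (α.tsum_rate_le η) (hf η)
      change _ * f η ≤ _ * f η at h2
      linarith)
    (by
      have := α.jumpOp_const 1
      change α.jumpOp 1 = 0 at this
      change α.jumpOp 1 + α.bound • 1 = _
      rw [this, zero_add])
  refine ⟨T, fun f g => ?_, fun T' hT' => ?_⟩
  · rw [hT]
    change P.semigroup.HasGenerator f (g - (α.jumpOp f + α.bound • f - α.bound • f)) ↔ _
    rw [add_sub_cancel_right]
  · refine FellerSemigroup.eq_of_hasGenerator_iff fun f g => ?_
    rw [hT, hT']
    change _ ↔ P.semigroup.HasGenerator f (g - (α.jumpOp f + α.bound • f - α.bound • f))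
    rw [add_sub_cancel_right]

end JumpOperator

/-! ### Discretised jumps and common walks -/

section StepProb

variable {d : ℕ} {E : Type*} [MetricSpace E]

namespace JumpRates

/-- The transition probabilities of the kernel `1 + h ∑_z α(η, z) (θ_{-z} - 1)`. -/
def stepProb (α : JumpRates d E) (h : ℝ) (η : Config d E) (z : Site d) : ℝ≥0∞ :=
  ENNReal.ofReal (h * α.rate η z) +
    if z = 0 then ENNReal.ofReal (1 - h * ∑' y, α.rate η y) else 0

variable [CompactSpace E]

/-- The condition `h * α.bound ≤ 1` makes the holding probability nonnegative, so that `1 + h B` is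
averaging over a Markov kernel. -/
theorem tsum_stepProb_mul (α : JumpRates d E) {h : ℝ} (hh : 0 ≤ h) (hb : h * α.bound ≤ 1)
    {w : C(Config d E, ℝ)} (hw : 0 ≤ w) (η : Config d E) :
    ∑' z, α.stepProb h η z * ENNReal.ofReal (w (shift (-z) η)) =
      ENNReal.ofReal ((w + h • α.jumpOp w) η) := by
  have h1 := (α.hasSum_jumpOp_add w η).mul_left h
  have h2 : 0 ≤ 1 - h * ∑' y, α.rate η y := by
    have := mul_le_mul_of_nonneg_left (α.tsum_rate_le η) hh
    linarith
  have hw' : ∀ η, 0 ≤ w η := hw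
  have hnn : ∀ z, 0 ≤ h * (α.rate η z * w (shift (-z) η)) := fun z =>
    mul_nonneg hh (mul_nonneg (α.nonneg _ _) (hw' _))
  have e : (w + h • α.jumpOp w) η =
      h * (α.jumpOp w η + (∑' z, α.rate η z) * w η) + (1 - h * ∑' y, α.rate η y) * w η := by
    simp only [ContinuousMap.add_apply, ContinuousMap.smul_apply, smul_eq_mul]
    ring
  rw [e, ← h1.tsum_eq, ENNReal.ofReal_add (tsum_nonneg hnn) (mul_nonneg h2 (hw' _)),
    ENNReal.ofReal_tsum_of_nonneg hnn h1.summable]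
  simp only [stepProb, add_mul]
  rw [ENNReal.tsum_add]
  congr 1
  · refine tsum_congr fun z => ?_
    rw [← ENNReal.ofReal_mul (mul_nonneg hh (α.nonneg _ _)), mul_assoc]
  · rw [tsum_eq_single 0 fun z hz => by simp [hz], if_pos rfl, neg_zero, shift_zero,
      ENNReal.ofReal_mul h2]

theorem tsum_stepProb (α : JumpRates d E) {h : ℝ} (hh : 0 ≤ h) (hb : h * α.bound ≤ 1)
    (η : Config d E) : ∑' z, α.stepProb h η z = 1 := by
  have h1 : (0 : C(Config d E, ℝ)) ≤ ContinuousMap.const _ 1 := fun _ => zero_le_one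
  have := α.tsum_stepProb_mul hh hb h1 η
  rw [jumpOp_const] at this
  simpa using this

theorem measurable_stepProb [MeasurableSpace E] [BorelSpace E] (α : JumpRates d E) (h : ℝ)
    (z : Site d) : Measurable fun η => α.stepProb h η z := by
  have h1 : ∀ z, Measurable fun η => α.rate η z := fun z => (α.continuous z).measurable
  have h2 : Measurable fun η => ∑' y, α.rate η y := by
    have : (fun η => ∑' y, α.rate η y) = fun η => (∑' y, ENNReal.ofReal (α.rate η y)).toReal := by
      funext η
      rw [← ENNReal.ofReal_tsum_of_nonneg (α.nonneg η) (α.summable_rate η),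
        ENNReal.toReal_ofReal (tsum_nonneg (α.nonneg η))]
    rw [this]
    exact (Measurable.tsum fun y => (h1 y).ennreal_ofReal).ennreal_toReal
  unfold stepProb
  refine Measurable.add ((h1 z).const_mul h).ennreal_ofReal ?_
  by_cases hz : z = 0
  · simpa [hz] using ((h2.const_mul h).const_sub 1).ennreal_ofReal
  · simp [hz]

end JumpRates

end StepProb

section SubWalk

variable {d : ℕ} {E : Type*}

/-- Weights of a walk driven by two environments: `m k x y η ξ` is the weight of a jump from `x`
to `y` at time `k` in the environments `η` and `ξ`. -/
def subWalk {W : Type*} (m : ℕ → Site d → Site d → Config d E → Config d E → ℝ≥0∞)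
    (Y₁ Y₂ : ℕ → W → Config d E) : ℕ → W → Site d → ℝ≥0∞
  | 0, _, x => if x = 0 then 1 else 0
  | k + 1, ω, y => ∑' x, subWalk m Y₁ Y₂ k ω x * m k x y (Y₁ k ω) (Y₂ k ω)

theorem measurable_subWalk {W : Type*} [MeasurableSpace W] [MeasurableSpace E]
    {m : ℕ → Site d → Site d → Config d E → Config d E → ℝ≥0∞} {Y₁ Y₂ : ℕ → W → Config d E}
    (hm : ∀ k x y, Measurable fun q : Config d E × Config d E => m k x y q.1 q.2) (k : ℕ)
    (h₁ : ∀ j < k, Measurable (Y₁ j)) (h₂ : ∀ j < k, Measurable (Y₂ j)) (x : Site d) :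
    Measurable fun ω => subWalk m Y₁ Y₂ k ω x := by
  induction k generalizing x with
  | zero => exact measurable_const
  | succ k ih =>
    refine Measurable.tsum fun y => Measurable.mul ?_ ?_
    · exact ih (fun j hj => h₁ j (hj.trans k.lt_succ_self))
        (fun j hj => h₂ j (hj.trans k.lt_succ_self)) y
    · exact (hm k y x).comp ((h₁ k k.lt_succ_self).prodMk (h₂ k k.lt_succ_self))

/-- The kernel `P` is split into the part `M` that the walk follows and the remainder `P - M`, the
lost part. -/
theorem tsum_mul_kernel_eq {ι : Type*} (v : ι → ℝ≥0∞) {M P : ι → ι → ℝ≥0∞}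
    (hMP : ∀ x y, M x y ≤ P x y) (g : ι → ℝ≥0∞) :
    ∑' x, v x * ∑' y, P x y * g y =
      ∑' y, (∑' x, v x * M x y) * g y + ∑' x, v x * ∑' y, (P x y - M x y) * g y := by
  have h1 : ∑' y, (∑' x, v x * M x y) * g y = ∑' x, v x * ∑' y, M x y * g y := by
    simp only [← ENNReal.tsum_mul_right, ← ENNReal.tsum_mul_left]
    rw [ENNReal.tsum_comm]
    simp only [mul_assoc]
  rw [h1, ← ENNReal.tsum_add]
  refine tsum_congr fun x => ?_
  rw [← mul_add, ← ENNReal.tsum_add]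
  congr 1
  refine tsum_congr fun y => ?_
  rw [← add_mul, add_tsub_cancel_of_le (hMP x y)]

theorem tsum_mul_kernel_sub {ι : Type*} (v : ι → ℝ≥0∞) {M P : ι → ι → ℝ≥0∞}
    (hMP : ∀ x y, M x y ≤ P x y) (hP : ∀ x, ∑' y, P x y = 1) :
    ∑' x, v x = ∑' y, ∑' x, v x * M x y + ∑' x, v x * ∑' y, (P x y - M x y) := by
  have := tsum_mul_kernel_eq v hMP fun _ => 1
  simpa [hP] using this

theorem tsum_sub_site (g : Site d → ℝ≥0∞) (x : Site d) : ∑' y, g (y - x) = ∑' z, g z :=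
  (Equiv.subRight x).tsum_eq g

variable [MetricSpace E] [CompactSpace E]

/-- The full kernel has total mass one, so the defect of `m` is exactly the mass lost in this step.
Here `Y` may be either environment; the loss is therefore the same computed in both. -/
theorem tsum_subWalk_eq {W : Type*} (α : JumpRates d E) {h : ℝ} (hh : 0 ≤ h)
    (hb : h * α.bound ≤ 1) {m : ℕ → Site d → Site d → Config d E → Config d E → ℝ≥0∞}
    {Y₁ Y₂ Y : ℕ → W → Config d E} {k : ℕ} {ω : W}
    (hm : ∀ x y, m k x y (Y₁ k ω) (Y₂ k ω) ≤ α.stepProb h (shift (-x) (Y k ω)) (y - x)) :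
    ∑' x, subWalk m Y₁ Y₂ k ω x = ∑' x, subWalk m Y₁ Y₂ (k + 1) ω x +
      ∑' x, subWalk m Y₁ Y₂ k ω x * ∑' y, (α.stepProb h (shift (-x) (Y k ω)) (y - x) -
        m k x y (Y₁ k ω) (Y₂ k ω)) :=
  tsum_mul_kernel_sub _ hm fun x => by
    rw [tsum_sub_site (fun z => α.stepProb h (shift (-x) (Y k ω)) z), α.tsum_stepProb hh hb]

theorem tsum_subWalk_le_one {W : Type*} (α : JumpRates d E) {h : ℝ} (hh : 0 ≤ h)
    (hb : h * α.bound ≤ 1) {m : ℕ → Site d → Site d → Config d E → Config d E → ℝ≥0∞}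
    {Y₁ Y₂ : ℕ → W → Config d E} {ω : W}
    (hm : ∀ k x y η ξ, m k x y η ξ ≤ α.stepProb h (shift (-x) η) (y - x)) (k : ℕ) :
    ∑' x, subWalk m Y₁ Y₂ k ω x ≤ 1 := by
  induction k with
  | zero => simp [subWalk]
  | succ k ih =>
    refine le_trans ?_ ih
    rw [tsum_subWalk_eq α hh hb (Y := Y₁) (k := k) fun x y => hm k x y _ _]
    exact le_self_add

/-- One step of the walk, tested against a solution of `G = h F + r (1 + h B) w`. -/
theorem tsum_subWalk_mul_eq {W : Type*} (α : JumpRates d E) {h : ℝ} (hh : 0 ≤ h)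
    (hb : h * α.bound ≤ 1) {r : ℝ} (hr : 0 ≤ r) {F G w : C(Config d E, ℝ)} (hF : 0 ≤ F)
    (hw : 0 ≤ w) (hG : G = h • F + r • (w + h • α.jumpOp w))
    {m : ℕ → Site d → Site d → Config d E → Config d E → ℝ≥0∞}
    {Y₁ Y₂ Y : ℕ → W → Config d E} {k : ℕ} {ω : W}
    (hm : ∀ x y, m k x y (Y₁ k ω) (Y₂ k ω) ≤ α.stepProb h (shift (-x) (Y k ω)) (y - x)) :
    ∑' x, subWalk m Y₁ Y₂ k ω x * ENNReal.ofReal (G (shift (-x) (Y k ω))) =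
      ENNReal.ofReal h *
        ∑' x, subWalk m Y₁ Y₂ k ω x * ENNReal.ofReal (F (shift (-x) (Y k ω))) +
      ENNReal.ofReal r *
        (∑' y, subWalk m Y₁ Y₂ (k + 1) ω y * ENNReal.ofReal (w (shift (-y) (Y k ω))) +
        ∑' x, subWalk m Y₁ Y₂ k ω x * ∑' y, (α.stepProb h (shift (-x) (Y k ω)) (y - x) -
          m k x y (Y₁ k ω) (Y₂ k ω)) * ENNReal.ofReal (w (shift (-y) (Y k ω)))) := by
  have hG' : ∀ x, ENNReal.ofReal (G (shift (-x) (Y k ω))) =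
      ENNReal.ofReal h * ENNReal.ofReal (F (shift (-x) (Y k ω))) + ENNReal.ofReal r *
        ∑' y, α.stepProb h (shift (-x) (Y k ω)) (y - x) *
          ENNReal.ofReal (w (shift (-y) (Y k ω))) := by
    intro x
    have hstep := α.tsum_stepProb_mul hh hb hw (shift (-x) (Y k ω))
    have h0 : 0 ≤ (w + h • α.jumpOp w) (shift (-x) (Y k ω)) := by
      have h2 := (α.hasSum_jumpOp_add w (shift (-x) (Y k ω))).nonneg fun z =>
        mul_nonneg (α.nonneg _ _) (hw _)
      have h3 := mul_le_mul_of_nonneg_left (α.tsum_rate_le (shift (-x) (Y k ω))) hh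
      have h4 : 0 ≤ w (shift (-x) (Y k ω)) := hw _
      have e : (w + h • α.jumpOp w) (shift (-x) (Y k ω)) =
          h * (α.jumpOp w (shift (-x) (Y k ω)) +
            (∑' z, α.rate (shift (-x) (Y k ω)) z) * w (shift (-x) (Y k ω))) +
          (1 - h * ∑' y, α.rate (shift (-x) (Y k ω)) y) * w (shift (-x) (Y k ω)) := by
        simp only [ContinuousMap.add_apply, ContinuousMap.smul_apply, smul_eq_mul]
        ring
      rw [e]
      exact add_nonneg (mul_nonneg hh h2) (mul_nonneg (by linarith) h4)
    have e1 : G (shift (-x) (Y k ω)) = h * F (shift (-x) (Y k ω)) +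
        r * (w + h • α.jumpOp w) (shift (-x) (Y k ω)) := by rw [hG]; rfl
    have hF' : ∀ η, 0 ≤ F η := hF
    rw [e1, ENNReal.ofReal_add (mul_nonneg hh (hF' _)) (mul_nonneg hr h0), ENNReal.ofReal_mul hh,
      ENNReal.ofReal_mul hr, ← hstep]
    congr 2
    rw [← tsum_sub_site _ x]
    refine tsum_congr fun y => ?_
    rw [shift_shift]
    congr 5
    abel
  have hk := tsum_mul_kernel_eq (subWalk m Y₁ Y₂ k ω) hm
    fun y => ENNReal.ofReal (w (shift (-y) (Y k ω)))
  have hk' : ∑' y, subWalk m Y₁ Y₂ (k + 1) ω y * ENNReal.ofReal (w (shift (-y) (Y k ω))) =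
    ∑' y, (∑' x, subWalk m Y₁ Y₂ k ω x * m k x y (Y₁ k ω) (Y₂ k ω)) *
      ENNReal.ofReal (w (shift (-y) (Y k ω))) := rfl
  rw [hk', ← hk, ← ENNReal.tsum_mul_left, ← ENNReal.tsum_mul_left, ← ENNReal.tsum_add]
  refine tsum_congr fun x => ?_
  rw [hG' x]
  ring

end SubWalk

/-! ### The coupling inequality in discrete time -/

section CouplingInequality

variable {d : ℕ} {E : Type*} [MetricSpace E] [MeasurableSpace E]

/-- Two processes in discrete time, both Markov with transition operator `A` with respect to a
common filtration. -/
structure IsMarkovPair {W : Type*} [mW : MeasurableSpace W] (μ : Measure W)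
    (A : C(Config d E, ℝ) →L[ℝ] C(Config d E, ℝ)) (𝓕 : ℕ → MeasurableSpace W)
    (Y₁ Y₂ : ℕ → W → Config d E) : Prop where
  mono : Monotone 𝓕
  le : ∀ k, 𝓕 k ≤ mW
  measurable₁ : ∀ k, Measurable[𝓕 k] (Y₁ k)
  measurable₂ : ∀ k, Measurable[𝓕 k] (Y₂ k)
  markov₁ : ∀ (k : ℕ) (V : W → ℝ≥0∞) (f : C(Config d E, ℝ)), Measurable[𝓕 k] V → 0 ≤ f →
    ∫⁻ ω, V ω * ENNReal.ofReal (f (Y₁ (k + 1) ω)) ∂μ =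
      ∫⁻ ω, V ω * ENNReal.ofReal (A f (Y₁ k ω)) ∂μ
  markov₂ : ∀ (k : ℕ) (V : W → ℝ≥0∞) (f : C(Config d E, ℝ)), Measurable[𝓕 k] V → 0 ≤ f →
    ∫⁻ ω, V ω * ENNReal.ofReal (f (Y₂ (k + 1) ω)) ∂μ =
      ∫⁻ ω, V ω * ENNReal.ofReal (A f (Y₂ k ω)) ∂μ

variable {W : Type*} [mW : MeasurableSpace W] {μ : Measure W}
  {A : C(Config d E, ℝ) →L[ℝ] C(Config d E, ℝ)} {𝓕 : ℕ → MeasurableSpace W}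
  {Y₁ Y₂ Y : ℕ → W → Config d E}
  {m : ℕ → Site d → Site d → Config d E → Config d E → ℝ≥0∞}

/-- The jump to time `k + 1` uses the environments at time `k` only, so the weights are known one
step ahead. This lets them serve as test functions in the Markov property from `k` to `k + 1`. -/
theorem IsMarkovPair.measurable_subWalk_succ (hY : IsMarkovPair μ A 𝓕 Y₁ Y₂)
    (hm : ∀ k x y, Measurable fun q : Config d E × Config d E => m k x y q.1 q.2)
    (k : ℕ) (x : Site d) : Measurable[𝓕 k] fun ω => subWalk m Y₁ Y₂ (k + 1) ω x :=
  @measurable_subWalk d E W (𝓕 k) _ m Y₁ Y₂ hm (k + 1)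
    (fun j hj => (hY.measurable₁ j).mono (hY.mono (Nat.lt_succ_iff.1 hj)) le_rfl)
    (fun j hj => (hY.measurable₂ j).mono (hY.mono (Nat.lt_succ_iff.1 hj)) le_rfl) x

theorem IsMarkovPair.measurable_subWalk' (hY : IsMarkovPair μ A 𝓕 Y₁ Y₂)
    (hm : ∀ k x y, Measurable fun q : Config d E × Config d E => m k x y q.1 q.2)
    (k : ℕ) (x : Site d) : Measurable fun ω => subWalk m Y₁ Y₂ k ω x :=
  measurable_subWalk hm k (fun j _ => (hY.measurable₁ j).mono (hY.le j) le_rfl)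
    (fun j _ => (hY.measurable₂ j).mono (hY.le j) le_rfl) x

variable [CompactSpace E] [BorelSpace E]

theorem measurable_ofReal_shift {Y : W → Config d E} (hY : Measurable Y) (f : C(Config d E, ℝ))
    (x : Site d) : Measurable fun ω => ENNReal.ofReal (f (shift x (Y ω))) :=
  ((f.continuous.comp (shift x).continuous).measurable.comp hY).ennreal_ofReal

/-- One step of the equation for `G` along the walk. On the surviving part the Markov property
replaces `A G` at time `k` by `G` at time `k + 1`, the weights being known at time `k`; on the lost
part `A G` is left as it is. `Y` stands for either component. -/
theorem IsMarkovPair.lintegral_step (hY : IsMarkovPair μ A 𝓕 Y₁ Y₂)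
    (hm : ∀ k x y, Measurable fun q : Config d E × Config d E => m k x y q.1 q.2)
    (hAs : ∀ x f, A (shiftOp x f) = shiftOp x (A f)) (hA : ∀ f, 0 ≤ f → 0 ≤ A f)
    (α : JumpRates d E) {h : ℝ} (hh : 0 ≤ h) (hb : h * α.bound ≤ 1) {r : ℝ} (hr : 0 ≤ r)
    {F G : C(Config d E, ℝ)} (hF : 0 ≤ F) (hG0 : 0 ≤ G)
    (hG : G = h • F + r • (A G + h • α.jumpOp (A G)))
    (hYm : ∀ k, Measurable (Y k))
    (hYM : ∀ (k : ℕ) (V : W → ℝ≥0∞) (f : C(Config d E, ℝ)), Measurable[𝓕 k] V → 0 ≤ f →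
      ∫⁻ ω, V ω * ENNReal.ofReal (f (Y (k + 1) ω)) ∂μ =
        ∫⁻ ω, V ω * ENNReal.ofReal (A f (Y k ω)) ∂μ)
    {k : ℕ}
    (hmp : ∀ x y ω, m k x y (Y₁ k ω) (Y₂ k ω) ≤ α.stepProb h (shift (-x) (Y k ω)) (y - x)) :
    ∫⁻ ω, ∑' x, subWalk m Y₁ Y₂ k ω x * ENNReal.ofReal (G (shift (-x) (Y k ω))) ∂μ =
      ENNReal.ofReal h *
        ∫⁻ ω, ∑' x, subWalk m Y₁ Y₂ k ω x * ENNReal.ofReal (F (shift (-x) (Y k ω))) ∂μ +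
      ENNReal.ofReal r *
        (∫⁻ ω, ∑' y, subWalk m Y₁ Y₂ (k + 1) ω y *
          ENNReal.ofReal (G (shift (-y) (Y (k + 1) ω))) ∂μ +
        ∫⁻ ω, ∑' x, subWalk m Y₁ Y₂ k ω x * ∑' y, (α.stepProb h (shift (-x) (Y k ω)) (y - x) -
          m k x y (Y₁ k ω) (Y₂ k ω)) * ENNReal.ofReal (A G (shift (-y) (Y k ω))) ∂μ) := by
  have hv := hY.measurable_subWalk' hm
  have hG0' : ∀ η, 0 ≤ G η := hG0
  have hterm : ∀ (f : C(Config d E, ℝ)) (j k : ℕ) (x : Site d), Measurable fun ω =>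
      subWalk m Y₁ Y₂ k ω x * ENNReal.ofReal (f (shift (-x) (Y j ω))) := fun f j k x =>
    (hv k x).mul (measurable_ofReal_shift (hYm j) f _)
  have e1 : ∫⁻ ω, ∑' y, subWalk m Y₁ Y₂ (k + 1) ω y *
        ENNReal.ofReal (G (shift (-y) (Y (k + 1) ω))) ∂μ =
      ∫⁻ ω, ∑' y, subWalk m Y₁ Y₂ (k + 1) ω y *
        ENNReal.ofReal (A G (shift (-y) (Y k ω))) ∂μ := by
    rw [lintegral_tsum fun y => (hterm G (k + 1) (k + 1) y).aemeasurable,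
      lintegral_tsum fun y => (hterm (A G) k (k + 1) y).aemeasurable]
    refine tsum_congr fun y => ?_
    have := hYM k _ (shiftOp (-y) G) (hY.measurable_subWalk_succ hm k y) fun η => hG0' (shift (-y) η)
    rw [hAs] at this
    exact this
  rw [e1]
  have hmF : Measurable fun ω => ∑' x, subWalk m Y₁ Y₂ k ω x *
      ENNReal.ofReal (F (shift (-x) (Y k ω))) :=
    Measurable.tsum fun x => hterm F k k x
  have hmA : Measurable fun ω => ∑' y, subWalk m Y₁ Y₂ (k + 1) ω y *
      ENNReal.ofReal (A G (shift (-y) (Y k ω))) :=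
    Measurable.tsum fun x => hterm (A G) k (k + 1) x
  rw [← lintegral_const_mul _ hmF, ← lintegral_add_left hmA, ← lintegral_const_mul' _ _ (by simp),
    ← lintegral_add_left (hmF.const_mul _)]
  exact lintegral_congr fun ω =>
    tsum_subWalk_mul_eq α hh hb hr hF (hA _ hG0) hG fun x y => hmp x y ω

/-- The expected mass of the walk. -/
def subWalkMass (μ : Measure W) (m : ℕ → Site d → Site d → Config d E → Config d E → ℝ≥0∞)
    (Y₁ Y₂ : ℕ → W → Config d E) (k : ℕ) : ℝ≥0∞ :=
  ∫⁻ ω, ∑' x, subWalk m Y₁ Y₂ k ω x ∂μ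

/-- The expected discrepancy of `F` as seen from the walk in the two environments. -/
def subWalkGap (μ : Measure W) (m : ℕ → Site d → Site d → Config d E → Config d E → ℝ≥0∞)
    (Y₁ Y₂ : ℕ → W → Config d E) (F : Config d E → ℝ) (k : ℕ) : ℝ≥0∞ :=
  ∫⁻ ω, ∑' x, subWalk m Y₁ Y₂ k ω x *
    ‖F (shift (-x) (Y₁ k ω)) - F (shift (-x) (Y₂ k ω))‖ₑ ∂μ

theorem ofReal_le_add_enorm_sub (a b : ℝ) :
    ENNReal.ofReal a ≤ ENNReal.ofReal b + ‖a - b‖ₑ := by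
  rw [Real.enorm_eq_ofReal_abs]
  refine le_trans (ENNReal.ofReal_le_ofReal ?_) ENNReal.ofReal_add_le
  have := le_abs_self (a - b)
  linarith

/-- The coupling inequality for solutions of `G = h F + r (1 + h B) A G`. -/
theorem IsMarkovPair.lintegral_le [IsProbabilityMeasure μ] (hY : IsMarkovPair μ A 𝓕 Y₁ Y₂)
    (hm : ∀ k x y, Measurable fun q : Config d E × Config d E => m k x y q.1 q.2)
    (hAs : ∀ x f, A (shiftOp x f) = shiftOp x (A f)) (hA : ∀ f, 0 ≤ f → 0 ≤ A f)
    (hA1 : A 1 = 1)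
    (α : JumpRates d E) {h : ℝ} (hh : 0 ≤ h) (hb : h * α.bound ≤ 1) {r : ℝ} (hr : 0 ≤ r)
    (hr1 : r ≤ 1) {F G : C(Config d E, ℝ)} (hF : 0 ≤ F) (hG0 : 0 ≤ G)
    (hG : G = h • F + r • (A G + h • α.jumpOp (A G)))
    (hm₁ : ∀ k x y η ξ, m k x y η ξ ≤ α.stepProb h (shift (-x) η) (y - x))
    (hm₂ : ∀ k x y η ξ, m k x y η ξ ≤ α.stepProb h (shift (-x) ξ) (y - x))
    {D : ℝ} (hD : ∀ η ξ, G η ≤ G ξ + D) (n : ℕ) :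
    ∫⁻ ω, ENNReal.ofReal (G (Y₁ 0 ω)) ∂μ ≤ ∫⁻ ω, ENNReal.ofReal (G (Y₂ 0 ω)) ∂μ +
      ∑ k ∈ Finset.range n, ENNReal.ofReal r ^ k *
        (ENNReal.ofReal h * subWalkGap μ m Y₁ Y₂ F k) +
      (1 - subWalkMass μ m Y₁ Y₂ n) * ENNReal.ofReal D +
      ENNReal.ofReal r ^ n * ENNReal.ofReal D := by
  have hv := hY.measurable_subWalk' hm
  have hY₁m : ∀ k, Measurable (Y₁ k) := fun k => (hY.measurable₁ k).mono (hY.le k) le_rfl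
  have hY₂m : ∀ k, Measurable (Y₂ k) := fun k => (hY.measurable₂ k).mono (hY.le k) le_rfl
  have hstep₁ := fun k => hY.lintegral_step hm hAs hA α hh hb hr hF hG0 hG hY₁m hY.markov₁ (k := k)
    fun x y ω => hm₁ k x y _ _
  have hstep₂ := fun k => hY.lintegral_step hm hAs hA α hh hb hr hF hG0 hG hY₂m hY.markov₂ (k := k)
    fun x y ω => hm₂ k x y _ _
  have hp : ∀ z, Measurable fun η => α.stepProb h η z := fun z => α.measurable_stepProb h z
  set V := subWalkMass μ m Y₁ Y₂ with hV
  set a := subWalkGap μ m Y₁ Y₂ F with ha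
  set I₁ : ℕ → ℝ≥0∞ := fun k =>
    ∫⁻ ω, ∑' x, subWalk m Y₁ Y₂ k ω x * ENNReal.ofReal (G (shift (-x) (Y₁ k ω))) ∂μ with hI₁
  set I₂ : ℕ → ℝ≥0∞ := fun k =>
    ∫⁻ ω, ∑' x, subWalk m Y₁ Y₂ k ω x * ENNReal.ofReal (G (shift (-x) (Y₂ k ω))) ∂μ with hI₂
  let loss : ℕ → ℝ≥0∞ := fun k => ∫⁻ ω, ∑' x, subWalk m Y₁ Y₂ k ω x *
    ∑' y, (α.stepProb h (shift (-x) (Y₁ k ω)) (y - x) - m k x y (Y₁ k ω) (Y₂ k ω)) ∂μ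
  have hmass : ∀ k, V k = V (k + 1) + loss k := fun k => by
    rw [hV, subWalkMass, subWalkMass, ← lintegral_add_left (Measurable.tsum fun x => hv _ x)]
    exact lintegral_congr fun ω => tsum_subWalk_eq α hh hb fun x y => hm₁ k x y _ _
  have hmul : ∀ (f : C(Config d E, ℝ)) (k : ℕ), Measurable fun ω =>
      ∑' x, subWalk m Y₁ Y₂ k ω x * ENNReal.ofReal (f (shift (-x) (Y₂ k ω))) := fun f k =>
    Measurable.tsum fun x => (hv k x).mul (measurable_ofReal_shift (hY₂m k) f _)
  have hFle : ∀ k,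
      ∫⁻ ω, ∑' x, subWalk m Y₁ Y₂ k ω x * ENNReal.ofReal (F (shift (-x) (Y₁ k ω))) ∂μ ≤
      ∫⁻ ω, ∑' x, subWalk m Y₁ Y₂ k ω x * ENNReal.ofReal (F (shift (-x) (Y₂ k ω))) ∂μ + a k := by
    intro k
    rw [ha, subWalkGap, ← lintegral_add_left (hmul F k)]
    refine lintegral_mono fun ω => ?_
    rw [← ENNReal.tsum_add]
    refine ENNReal.tsum_le_tsum fun x => ?_
    rw [← mul_add]
    gcongr
    exact ofReal_le_add_enorm_sub _ _
  have hGle : ∀ k, I₁ k ≤ I₂ k + V k * ENNReal.ofReal D := by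
    intro k
    rw [hV, subWalkMass, ← lintegral_mul_const _ (Measurable.tsum fun x => hv k x),
      hI₂, ← lintegral_add_left (hmul G k)]
    refine lintegral_mono fun ω => ?_
    rw [← ENNReal.tsum_mul_right, ← ENNReal.tsum_add]
    refine ENNReal.tsum_le_tsum fun x => ?_
    rw [← mul_add]
    gcongr
    exact (ENNReal.ofReal_le_ofReal (hD _ _)).trans ENNReal.ofReal_add_le
  -- `b` is the minimum of `G`. Since `A` is positive and fixes constants, `A G` inherits the range
  -- between `b` and `b + D`.
  obtain ⟨b, hb0, hbl, hbu⟩ : ∃ b : ℝ≥0∞, b ≠ ∞ ∧ (∀ η, b ≤ ENNReal.ofReal (A G η)) ∧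
      ∀ η, ENNReal.ofReal (A G η) ≤ b + ENNReal.ofReal D := by
    rcases isEmpty_or_nonempty (Config d E) with hemp | hne
    · exact ⟨0, by simp, fun η => (hemp.false η).elim, fun η => (hemp.false η).elim⟩
    obtain ⟨η₀, -, hη₀⟩ := isCompact_univ.exists_isMinOn univ_nonempty G.continuous.continuousOn
    have hmono : ∀ f g : C(Config d E, ℝ), f ≤ g → A f ≤ A g := fun f g hfg => by
      have := hA (g - f) (sub_nonneg.2 hfg)
      rwa [map_sub, sub_nonneg] at this
    have hconst : ∀ c : ℝ, A (c • 1) = c • 1 := fun c => by rw [map_smul, hA1]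
    have h1 : ∀ η, G η₀ ≤ A G η := fun η => by
      have := hmono (G η₀ • 1) G (fun ξ => by
        have h : G η₀ * 1 ≤ G ξ := by rw [mul_one]; exact hη₀ (mem_univ ξ)
        exact h) η
      rw [hconst] at this
      have h : G η₀ * 1 ≤ A G η := this
      linarith
    have h2 : ∀ η, A G η ≤ G η₀ + D := fun η => by
      have := hmono G ((G η₀ + D) • 1) (fun ξ => by
        have h : G ξ ≤ (G η₀ + D) * 1 := by rw [mul_one]; exact hD _ _
        exact h) η
      rw [hconst] at this
      have h : A G η ≤ (G η₀ + D) * 1 := this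
      linarith
    exact ⟨ENNReal.ofReal (G η₀), by simp, fun η => ENNReal.ofReal_le_ofReal (h1 η), fun η =>
      (ENNReal.ofReal_le_ofReal (h2 η)).trans ENNReal.ofReal_add_le⟩
  -- The lost masses in the two environments are equal, each being the difference of successive
  -- total masses (finiteness permits the cancellation). So `b` times the loss cancels, and only `D`
  -- times the loss remains.
  have hlossle : ∀ k,
      ∫⁻ ω, ∑' x, subWalk m Y₁ Y₂ k ω x * ∑' y, (α.stepProb h (shift (-x) (Y₁ k ω)) (y - x) -
          m k x y (Y₁ k ω) (Y₂ k ω)) * ENNReal.ofReal (A G (shift (-y) (Y₁ k ω))) ∂μ ≤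
      ∫⁻ ω, ∑' x, subWalk m Y₁ Y₂ k ω x * ∑' y, (α.stepProb h (shift (-x) (Y₂ k ω)) (y - x) -
          m k x y (Y₁ k ω) (Y₂ k ω)) * ENNReal.ofReal (A G (shift (-y) (Y₂ k ω))) ∂μ +
        loss k * ENNReal.ofReal D := by
    intro k
    have hml : Measurable fun ω => ∑' x, subWalk m Y₁ Y₂ k ω x *
        ∑' y, (α.stepProb h (shift (-x) (Y₁ k ω)) (y - x) - m k x y (Y₁ k ω) (Y₂ k ω)) := by
      refine Measurable.tsum fun x => (hv k x).mul (Measurable.tsum fun y => Measurable.sub ?_ ?_)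
      · exact (hp _).comp ((shift (-x)).continuous.measurable.comp (hY₁m k))
      · exact (hm k x y).comp ((hY₁m k).prodMk (hY₂m k))
    rw [← lintegral_mul_const _ hml, ← lintegral_add_right _ (hml.mul_const _)]
    refine lintegral_mono fun ω => ?_
    have hb1 := tsum_subWalk_eq α hh hb (Y₁ := Y₁) (Y₂ := Y₂) (Y := Y₁) (k := k) (ω := ω)
      fun x y => hm₁ k x y _ _
    have hb2 := tsum_subWalk_eq α hh hb (Y₁ := Y₁) (Y₂ := Y₂) (Y := Y₂) (k := k) (ω := ω)
      fun x y => hm₂ k x y _ _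
    have hfin : ∑' x, subWalk m Y₁ Y₂ (k + 1) ω x ≠ ∞ :=
      ((tsum_subWalk_le_one α hh hb hm₁ (k + 1)).trans_lt ENNReal.one_lt_top).ne
    have heq := (ENNReal.add_right_inj hfin).1 (hb1.symm.trans hb2)
    calc ∑' x, subWalk m Y₁ Y₂ k ω x * ∑' y, (α.stepProb h (shift (-x) (Y₁ k ω)) (y - x) -
          m k x y (Y₁ k ω) (Y₂ k ω)) * ENNReal.ofReal (A G (shift (-y) (Y₁ k ω)))
        ≤ ∑' x, subWalk m Y₁ Y₂ k ω x * ∑' y, (α.stepProb h (shift (-x) (Y₁ k ω)) (y - x) -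
          m k x y (Y₁ k ω) (Y₂ k ω)) * (b + ENNReal.ofReal D) := by
          gcongr
          exact hbu _
      _ = (∑' x, subWalk m Y₁ Y₂ k ω x * ∑' y, (α.stepProb h (shift (-x) (Y₂ k ω)) (y - x) -
          m k x y (Y₁ k ω) (Y₂ k ω))) * b +
          (∑' x, subWalk m Y₁ Y₂ k ω x * ∑' y, (α.stepProb h (shift (-x) (Y₁ k ω)) (y - x) -
          m k x y (Y₁ k ω) (Y₂ k ω))) * ENNReal.ofReal D := by
          rw [← heq, ← mul_add]
          simp only [ENNReal.tsum_mul_right, ← mul_assoc]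
      _ ≤ _ := by
          gcongr
          simp only [← ENNReal.tsum_mul_right, mul_assoc]
          gcongr
          exact hbl _
  have hr1' : ENNReal.ofReal r ≤ 1 := ENNReal.ofReal_le_one.2 hr1
  -- Iteration of the one-step identity. The discount `r` is kept on the gaps, where it later sums
  -- the approximation error, but is dropped on the losses, where `r ≤ 1` is enough.
  have key : ∀ n k, I₁ k ≤ I₂ k + ∑ j ∈ Finset.range n, ENNReal.ofReal r ^ j *
      (ENNReal.ofReal h * a (k + j)) + (∑ j ∈ Finset.range n, loss (k + j)) * ENNReal.ofReal D +
      ENNReal.ofReal r ^ n * (V (k + n) * ENNReal.ofReal D) := by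
    intro n
    induction n with
    | zero => intro k; simpa using hGle k
    | succ n ih =>
      intro k
      have h1 := ih (k + 1)
      simp only [add_assoc, add_comm 1] at h1
      rw [hI₁, hI₂]
      simp only []
      rw [hstep₁ k, hstep₂ k, Finset.sum_range_succ', Finset.sum_range_succ' (fun j => loss (k + j)),
        pow_zero, one_mul, add_zero]
      calc _ ≤ ENNReal.ofReal h * (∫⁻ ω, ∑' x, subWalk m Y₁ Y₂ k ω x *
              ENNReal.ofReal (F (shift (-x) (Y₂ k ω))) ∂μ + a k) +
            ENNReal.ofReal r * ((I₂ (k + 1) + (∑ j ∈ Finset.range n, ENNReal.ofReal r ^ j *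
              (ENNReal.ofReal h * a (k + (j + 1))) +
              ((∑ j ∈ Finset.range n, loss (k + (j + 1))) * ENNReal.ofReal D +
              ENNReal.ofReal r ^ n * (V (k + (n + 1)) * ENNReal.ofReal D)))) +
              (∫⁻ ω, ∑' x, subWalk m Y₁ Y₂ k ω x * ∑' y, (α.stepProb h (shift (-x) (Y₂ k ω))
                (y - x) - m k x y (Y₁ k ω) (Y₂ k ω)) *
                ENNReal.ofReal (A G (shift (-y) (Y₂ k ω))) ∂μ + loss k * ENNReal.ofReal D)) := by
            gcongr
            · exact hFle k
            · exact hlossle k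
        _ = ENNReal.ofReal h * (∫⁻ ω, ∑' x, subWalk m Y₁ Y₂ k ω x *
              ENNReal.ofReal (F (shift (-x) (Y₂ k ω))) ∂μ) + ENNReal.ofReal r * (I₂ (k + 1) +
              (∫⁻ ω, ∑' x, subWalk m Y₁ Y₂ k ω x * ∑' y, (α.stepProb h (shift (-x) (Y₂ k ω))
                (y - x) - m k x y (Y₁ k ω) (Y₂ k ω)) *
                ENNReal.ofReal (A G (shift (-y) (Y₂ k ω))) ∂μ)) +
            (∑ j ∈ Finset.range n, ENNReal.ofReal r ^ (j + 1) *
              (ENNReal.ofReal h * a (k + (j + 1))) + ENNReal.ofReal h * a k) +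
            ENNReal.ofReal r * ((∑ j ∈ Finset.range n, loss (k + (j + 1)) + loss k) *
              ENNReal.ofReal D) +
            ENNReal.ofReal r ^ (n + 1) * (V (k + (n + 1)) * ENNReal.ofReal D) := by
            simp only [pow_succ', mul_assoc, ← Finset.mul_sum]
            ring
        _ ≤ _ := add_le_add (add_le_add le_rfl (mul_le_of_le_one_left' hr1')) le_rfl
  have hsum : ∀ n, V n + ∑ j ∈ Finset.range n, loss j = 1 := by
    intro n
    induction n with
    | zero => simp [hV, subWalkMass, subWalk]
    | succ n ih =>
      rw [Finset.sum_range_succ, ← ih, hmass n]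
      ring
  have hV1 : ∀ n, V n ≤ 1 := fun n => by
    rw [← hsum n]
    exact le_self_add
  have hloss : ∑ j ∈ Finset.range n, loss j = 1 - V n := by
    rw [← hsum n, ENNReal.add_sub_cancel_left ((hV1 n).trans_lt ENNReal.one_lt_top).ne]
  have hI0 : ∀ Y : ℕ → W → Config d E, ∫⁻ ω, ∑' x, subWalk m Y₁ Y₂ 0 ω x *
      ENNReal.ofReal (G (shift (-x) (Y 0 ω))) ∂μ = ∫⁻ ω, ENNReal.ofReal (G (Y 0 ω)) ∂μ := by
    intro Y
    refine lintegral_congr fun ω => ?_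
    rw [tsum_eq_single 0 fun x hx => by simp [subWalk, hx]]
    simp [subWalk, shift_zero]
  have hfinal := key n 0
  rw [hI₁, hI₂] at hfinal
  simp only [hI0, zero_add, hloss] at hfinal
  refine hfinal.trans ?_
  gcongr
  exact mul_le_of_le_one_left' (hV1 n)

end CouplingInequality

/-! ### Consequences of the coupling assumptions -/

section Environment

/-- The measures with densities `f` and `g` agree on the smaller σ-algebra, hence integrate all its
nonnegative functions alike. No integrability of `V` is needed. -/
theorem lintegral_mul_eq_of_condExp {W : Type*} {m₀ mW : MeasurableSpace W} {μ : Measure W}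
    [IsFiniteMeasure μ] (hm : m₀ ≤ mW) {f g : W → ℝ} (hf : Measurable f) (hg : Measurable g)
    (hf0 : ∀ ω, 0 ≤ f ω) (hg0 : ∀ ω, 0 ≤ g ω) (hfi : Integrable f μ) (hgi : Integrable g μ)
    (h : μ[f | m₀] =ᵐ[μ] g) {V : W → ℝ≥0∞} (hV : Measurable[m₀] V) :
    ∫⁻ ω, V ω * ENNReal.ofReal (f ω) ∂μ = ∫⁻ ω, V ω * ENNReal.ofReal (g ω) ∂μ := by
  have htrim : (μ.withDensity fun ω => ENNReal.ofReal (f ω)).trim hm =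
      (μ.withDensity fun ω => ENNReal.ofReal (g ω)).trim hm := by
    refine @Measure.ext _ m₀ _ _ fun s hs => ?_
    rw [trim_measurableSet_eq hm hs, trim_measurableSet_eq hm hs,
      withDensity_apply _ (hm s hs), withDensity_apply _ (hm s hs),
      ← ofReal_integral_eq_lintegral_ofReal hfi.integrableOn (Eventually.of_forall hf0),
      ← ofReal_integral_eq_lintegral_ofReal hgi.integrableOn (Eventually.of_forall hg0),
      ← setIntegral_condExp hm hfi hs]
    congr 1
    exact integral_congr_ae (ae_restrict_of_ae h)
  have e : ∀ f : W → ℝ, Measurable f → ∫⁻ ω, V ω * ENNReal.ofReal (f ω) ∂μ =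
      ∫⁻ ω, V ω ∂((μ.withDensity fun ω => ENNReal.ofReal (f ω)).trim hm) := fun f hf => by
    rw [lintegral_trim hm hV,
      lintegral_withDensity_eq_lintegral_mul μ hf.ennreal_ofReal (hV.mono hm le_rfl)]
    simp only [Pi.mul_apply, mul_comm]
  rw [e f hf, e g hg, htrim]

variable {d : ℕ} {E : Type*} [MetricSpace E] [CompactSpace E] [MeasurableSpace E] [BorelSpace E]

theorem measurable_comp_eval {W : Type*} [MeasurableSpace W]
    {Y : W → CadlagPath (Config d E)} (hY : Measurable Y) (f : C(Config d E, ℝ)) (t : ℝ≥0) :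
    Measurable fun ω => f ((Y ω).1 t) :=
  f.continuous.measurable.comp ((CadlagPath.measurable_eval t).comp hY)

theorem measurable_eval_apply (f : C(Config d E, ℝ)) (t : ℝ≥0) :
    Measurable fun ω : CadlagPath (Config d E) => f (ω.1 t) :=
  f.continuous.measurable.comp (CadlagPath.measurable_eval t)

theorem integrable_comp_eval {W : Type*} [MeasurableSpace W] {μ : Measure W} [IsFiniteMeasure μ]
    {Y : W → CadlagPath (Config d E)} (hY : Measurable Y) (f : C(Config d E, ℝ)) (t : ℝ≥0) :
    Integrable (fun ω => f ((Y ω).1 t)) μ :=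
  Integrable.of_bound (measurable_comp_eval hY f t).aestronglyMeasurable ‖f‖
    (Eventually.of_forall fun _ => f.norm_coe_le_norm _)

theorem FellerProcess.integral_eval (P : FellerProcess (Config d E)) (η : Config d E) (t : ℝ≥0)
    (f : C(Config d E, ℝ)) : ∫ ω, f (ω.1 t) ∂(P.law η) = P.semigroup.op t f η := by
  have := P.isProbabilityMeasure η
  have h := P.markov η 0 t f
  rw [zero_add] at h
  rw [← integral_condExp ((pathFiltration (Config d E)).le 0), integral_congr_ae h]
  have h2 : (fun ω : CadlagPath (Config d E) => P.semigroup.op t f (ω.1 0)) =ᵐ[P.law η]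
      fun _ => P.semigroup.op t f η := by
    filter_upwards [P.start η] with ω hω
    rw [hω]
  rw [integral_congr_ae h2]
  simp

theorem measurable_cadlagPath_map {X Y : Type*} [TopologicalSpace X] [TopologicalSpace Y]
    [MeasurableSpace X] [MeasurableSpace Y] [OpensMeasurableSpace X] [BorelSpace Y] (g : C(X, Y)) :
    Measurable (CadlagPath.map g) :=
  (measurable_pi_lambda _ fun t =>
    g.continuous.measurable.comp (CadlagPath.measurable_eval t)).subtype_mk

theorem FellerProcess.TranslationInvariant.op_shiftOp {P : FellerProcess (Config d E)}
    (hP : P.TranslationInvariant) (t : ℝ≥0) (x : Site d) (f : C(Config d E, ℝ)) :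
    P.semigroup.op t (shiftOp x f) = shiftOp x (P.semigroup.op t f) := by
  ext η
  rw [shiftOp_apply, ← P.integral_eval, ← P.integral_eval, ← hP x η,
    integral_map (measurable_cadlagPath_map _).aemeasurable
      (measurable_eval_apply f t).aestronglyMeasurable]
  rfl

variable {P : FellerProcess (Config d E)}

theorem EnvCoupling.integral_fst (Q : EnvCoupling P) (η ξ : Config d E) (t : ℝ≥0)
    (f : C(Config d E, ℝ)) : ∫ ω, f (ω.1.1 t) ∂(Q.law η ξ) = P.semigroup.op t f η := by
  rw [← P.integral_eval, ← Q.map_fst η ξ, integral_map measurable_fst.aemeasurable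
      (measurable_eval_apply f t).aestronglyMeasurable]

theorem EnvCoupling.integral_snd (Q : EnvCoupling P) (η ξ : Config d E) (t : ℝ≥0)
    (f : C(Config d E, ℝ)) : ∫ ω, f (ω.2.1 t) ∂(Q.law η ξ) = P.semigroup.op t f ξ := by
  rw [← P.integral_eval, ← Q.map_snd η ξ, integral_map measurable_snd.aemeasurable
      (measurable_eval_apply f t).aestronglyMeasurable]

theorem EnvCoupling.lintegral_fst (Q : EnvCoupling P) (η ξ : Config d E) (t : ℝ≥0)
    {f : C(Config d E, ℝ)} (hf : 0 ≤ f) :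
    ∫⁻ ω, ENNReal.ofReal (f (ω.1.1 t)) ∂(Q.law η ξ) =
      ENNReal.ofReal (P.semigroup.op t f η) := by
  have := Q.isProbabilityMeasure η ξ
  rw [← Q.integral_fst η ξ, ofReal_integral_eq_lintegral_ofReal
    (integrable_comp_eval measurable_fst f t) (Eventually.of_forall fun ω => hf _)]

theorem EnvCoupling.lintegral_snd (Q : EnvCoupling P) (η ξ : Config d E) (t : ℝ≥0)
    {f : C(Config d E, ℝ)} (hf : 0 ≤ f) :
    ∫⁻ ω, ENNReal.ofReal (f (ω.2.1 t)) ∂(Q.law η ξ) =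
      ENNReal.ofReal (P.semigroup.op t f ξ) := by
  have := Q.isProbabilityMeasure η ξ
  rw [← Q.integral_snd η ξ, ofReal_integral_eq_lintegral_ofReal
    (integrable_comp_eval measurable_snd f t) (Eventually.of_forall fun ω => hf _)]

/-- The deterministic stopping time `s` already gives all that is used of the strong marginal Markov
property. -/
theorem EnvCoupling.StrongMarginalMarkov.condExp {Q : EnvCoupling P}
    (hQM : Q.StrongMarginalMarkov) (η ξ : Config d E) (s t : ℝ≥0) (f : C(Config d E, ℝ)) :
    ((Q.law η ξ)[fun ω => f (ω.1.1 (s + t)) | pairFiltration (Config d E) s] =ᵐ[Q.law η ξ]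
      fun ω => P.semigroup.op t f (ω.1.1 s)) ∧
    ((Q.law η ξ)[fun ω => f (ω.2.1 (s + t)) | pairFiltration (Config d E) s] =ᵐ[Q.law η ξ]
      fun ω => P.semigroup.op t f (ω.2.1 s)) := by
  have h := hQM η ξ (fun _ => (s : WithTop ℝ≥0)) (isStoppingTime_const _ s) (s + t) f
  have hset : {_ω : CadlagPath (Config d E) × CadlagPath (Config d E) |
      (s : WithTop ℝ≥0) ≤ ((s + t : ℝ≥0) : WithTop ℝ≥0)} = univ := by
    ext
    simp only [mem_ofPred_eq, mem_univ, iff_true]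
    exact_mod_cast le_self_add
  rw [IsStoppingTime.measurableSpace_const] at h
  simp only [hset, indicator_univ, WithTop.untopD_coe, add_tsub_cancel_left] at h
  exact h

/-- The environments of a coupling, observed at the times `u + k h`. -/
theorem EnvCoupling.StrongMarginalMarkov.isMarkovPair {Q : EnvCoupling P}
    (hQM : Q.StrongMarginalMarkov) (η ξ : Config d E) (u h : ℝ≥0) :
    IsMarkovPair (Q.law η ξ) (P.semigroup.op h)
      (fun k => pairFiltration (Config d E) (u + k * h))
      (fun k ω => ω.1.1 (u + k * h)) (fun k ω => ω.2.1 (u + k * h)) := by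
  have hpair : ∀ t : ℝ≥0, Measurable[pairFiltration (Config d E) t]
      fun ω : CadlagPath (Config d E) × CadlagPath (Config d E) => (ω.1.1 t, ω.2.1 t) := fun t =>
    Measurable.of_comap_le (le_iSup (fun s : {s : ℝ≥0 // s ≤ t} => MeasurableSpace.comap
      (fun ω : CadlagPath (Config d E) × CadlagPath (Config d E) => (ω.1.1 s.1, ω.2.1 s.1)) _)
      ⟨t, le_rfl⟩)
  have := Q.isProbabilityMeasure η ξ
  have htime : ∀ k : ℕ, u + ((k + 1 : ℕ) : ℝ≥0) * h = u + k * h + h := fun k => by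
    push_cast
    ring
  refine ⟨fun i j hij => (pairFiltration (Config d E)).mono ?_,
    fun k => (pairFiltration (Config d E)).le _, fun k => measurable_fst.comp (hpair _),
    fun k => measurable_snd.comp (hpair _), fun k V f hV hf => ?_, fun k V f hV hf => ?_⟩
  · gcongr
  · simp only [htime]
    exact lintegral_mul_eq_of_condExp ((pairFiltration (Config d E)).le _)
      (measurable_comp_eval measurable_fst f _) (measurable_comp_eval measurable_fst _ _)
      (fun ω => hf _) (fun ω => P.semigroup.op_nonneg _ _ hf _)
      (integrable_comp_eval measurable_fst f _) (integrable_comp_eval measurable_fst _ _)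
      (hQM.condExp η ξ _ h f).1 hV
  · simp only [htime]
    exact lintegral_mul_eq_of_condExp ((pairFiltration (Config d E)).le _)
      (measurable_comp_eval measurable_snd f _) (measurable_comp_eval measurable_snd _ _)
      (fun ω => hf _) (fun ω => P.semigroup.op_nonneg _ _ hf _)
      (integrable_comp_eval measurable_snd f _) (integrable_comp_eval measurable_snd _ _)
      (hQM.condExp η ξ _ h f).2 hV

theorem measurable_eval_site (t : ℝ≥0) (x : Site d) :
    Measurable fun ω : CadlagPath (Config d E) => ω.1 t x :=
  (measurable_pi_apply x).comp (CadlagPath.measurable_eval t)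

theorem measurable_dist_eval (t : ℝ≥0) (x : Site d) :
    Measurable fun ω : CadlagPath (Config d E) × CadlagPath (Config d E) =>
      dist (ω.1.1 t x) (ω.2.1 t x) :=
  ((measurable_eval_site t x).comp measurable_fst).dist
    ((measurable_eval_site t x).comp measurable_snd)

theorem measurable_edist_eval (t : ℝ≥0) (x : Site d) :
    Measurable fun ω : CadlagPath (Config d E) × CadlagPath (Config d E) =>
      edist (ω.1.1 t x) (ω.2.1 t x) :=
  ((measurable_eval_site t x).comp measurable_fst).edist
    ((measurable_eval_site t x).comp measurable_snd)

theorem EnvCoupling.integrable_dist (Q : EnvCoupling P) (hE : ∀ a b : E, dist a b ≤ 1)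
    (η ξ : Config d E) (t : ℝ≥0) (x : Site d) :
    Integrable (fun ω => dist (ω.1.1 t x) (ω.2.1 t x)) (Q.law η ξ) := by
  have := Q.isProbabilityMeasure η ξ
  refine Integrable.of_bound (measurable_dist_eval t x).aestronglyMeasurable 1
    (Eventually.of_forall fun ω => ?_)
  rw [Real.norm_of_nonneg dist_nonneg]
  exact hE _ _

theorem EnvCoupling.integral_dist_le_one (Q : EnvCoupling P) (hE : ∀ a b : E, dist a b ≤ 1)
    (η ξ : Config d E) (t : ℝ≥0) (x : Site d) :
    ∫ ω, dist (ω.1.1 t x) (ω.2.1 t x) ∂(Q.law η ξ) ≤ 1 := by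
  have := Q.isProbabilityMeasure η ξ
  refine (integral_mono (Q.integrable_dist hE η ξ t x) (integrable_const 1)
    fun ω => hE _ _).trans ?_
  simp

theorem EnvCoupling.integral_dist_le_supDist (Q : EnvCoupling P) (hE : ∀ a b : E, dist a b ≤ 1)
    (η ξ : Config d E) (t : ℝ≥0) :
    ∫ ω, dist (ω.1.1 t 0) (ω.2.1 t 0) ∂(Q.law η ξ) ≤ Q.supDist t :=
  le_ciSup (f := fun p : Config d E × Config d E =>
    ∫ ω, dist (ω.1.1 t 0) (ω.2.1 t 0) ∂(Q.law p.1 p.2))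
    ⟨1, by rintro _ ⟨p, rfl⟩; exact Q.integral_dist_le_one hE p.1 p.2 t 0⟩ (η, ξ)

theorem EnvCoupling.supDist_nonneg (Q : EnvCoupling P) (t : ℝ≥0) : 0 ≤ Q.supDist t :=
  Real.iSup_nonneg fun _ => integral_nonneg fun _ => dist_nonneg

theorem EnvCoupling.supDist_le_one (Q : EnvCoupling P) (hE : ∀ a b : E, dist a b ≤ 1) (t : ℝ≥0) :
    Q.supDist t ≤ 1 :=
  Real.iSup_le (fun p => Q.integral_dist_le_one hE p.1 p.2 t 0) zero_le_one

/-- Translation invariance carries the site `x` to the origin while changing the initial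
configurations, over which `g` takes the supremum. -/
theorem EnvCoupling.TranslationInvariant.lintegral_edist_le {Q : EnvCoupling P}
    (hQ : Q.TranslationInvariant) (hE : ∀ a b : E, dist a b ≤ 1) (η ξ : Config d E) (t : ℝ≥0)
    (x : Site d) :
    ∫⁻ ω, edist (ω.1.1 t x) (ω.2.1 t x) ∂(Q.law η ξ) ≤ ENNReal.ofReal (Q.supDist t) := by
  have hmap : Measurable (Prod.map (CadlagPath.map (shift (d := d) (E := E) (-x)))
      (CadlagPath.map (shift (d := d) (E := E) (-x)))) :=
    (measurable_cadlagPath_map _).prodMap (measurable_cadlagPath_map _)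
  have e : ∫⁻ ω, edist (ω.1.1 t x) (ω.2.1 t x) ∂(Q.law η ξ) =
      ∫⁻ ω, edist (ω.1.1 t 0) (ω.2.1 t 0) ∂(Q.law (shift (-x) η) (shift (-x) ξ)) := by
    rw [← hQ, lintegral_map (measurable_edist_eval t 0) hmap]
    refine lintegral_congr fun ω => ?_
    change _ = edist (ω.1.1 t (0 - -x)) (ω.2.1 t (0 - -x))
    rw [sub_neg_eq_add, zero_add]
  rw [e]
  simp only [edist_dist]
  rw [← ofReal_integral_eq_lintegral_ofReal (Q.integrable_dist hE _ _ t 0)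
    (Eventually.of_forall fun _ => dist_nonneg)]
  exact ENNReal.ofReal_le_ofReal (Q.integral_dist_le_supDist hE _ _ t)

end Environment

/-! ### Oscillation of the resolvent -/

section Oscillation

variable {d : ℕ} {E : Type*} [MetricSpace E] [CompactSpace E] [MeasurableSpace E] [BorelSpace E]

/-- Transition weights dominated by the transition probabilities in both environments. -/
structure IsJointSubkernel (α : JumpRates d E) (h : ℝ)
    (m : ℕ → Site d → Site d → Config d E → Config d E → ℝ≥0∞) : Prop where
  measurable : ∀ k x y, Measurable fun q : Config d E × Config d E => m k x y q.1 q.2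
  le₁ : ∀ k x y η ξ, m k x y η ξ ≤ α.stepProb h (shift (-x) η) (y - x)
  le₂ : ∀ k x y η ξ, m k x y η ξ ≤ α.stepProb h (shift (-x) ξ) (y - x)

theorem subWalkGap_le {W : Type*} [MeasurableSpace W] {μ : Measure W} [IsProbabilityMeasure μ]
    {α : JumpRates d E} {h : ℝ} (hh : 0 ≤ h) (hb : h * α.bound ≤ 1)
    {m : ℕ → Site d → Site d → Config d E → Config d E → ℝ≥0∞} (hm : IsJointSubkernel α h m)
    {Y₁ Y₂ : ℕ → W → Config d E} {F f : Config d E → ℝ} {δ : ℝ}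
    (hF : ∀ η, |F η - f η| ≤ δ) (k : ℕ) :
    subWalkGap μ m Y₁ Y₂ F k ≤ subWalkGap μ m Y₁ Y₂ f k + ENNReal.ofReal (2 * δ) := by
  have hpt : ∀ ω, ∑' x, subWalk m Y₁ Y₂ k ω x *
      ‖F (shift (-x) (Y₁ k ω)) - F (shift (-x) (Y₂ k ω))‖ₑ ≤
      ∑' x, subWalk m Y₁ Y₂ k ω x * ‖f (shift (-x) (Y₁ k ω)) - f (shift (-x) (Y₂ k ω))‖ₑ +
        ENNReal.ofReal (2 * δ) := by
    intro ω
    calc _ ≤ ∑' x, (subWalk m Y₁ Y₂ k ω x *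
          ‖f (shift (-x) (Y₁ k ω)) - f (shift (-x) (Y₂ k ω))‖ₑ +
          subWalk m Y₁ Y₂ k ω x * ENNReal.ofReal (2 * δ)) := by
          refine ENNReal.tsum_le_tsum fun x => ?_
          rw [← mul_add]
          gcongr
          have e : F (shift (-x) (Y₁ k ω)) - F (shift (-x) (Y₂ k ω)) =
              (f (shift (-x) (Y₁ k ω)) - f (shift (-x) (Y₂ k ω))) +
              ((F (shift (-x) (Y₁ k ω)) - f (shift (-x) (Y₁ k ω))) -
              (F (shift (-x) (Y₂ k ω)) - f (shift (-x) (Y₂ k ω)))) := by ring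
          rw [e]
          refine (enorm_add_le _ _).trans (add_le_add le_rfl ?_)
          rw [Real.enorm_eq_ofReal_abs]
          refine ENNReal.ofReal_le_ofReal ((abs_sub _ _).trans ?_)
          have h1 := hF (shift (-x) (Y₁ k ω))
          have h2 := hF (shift (-x) (Y₂ k ω))
          linarith
      _ ≤ _ := by
          rw [ENNReal.tsum_add, ENNReal.tsum_mul_right]
          gcongr
          exact mul_le_of_le_one_left' (tsum_subWalk_le_one α hh hb hm.le₁ k)
  refine (lintegral_mono hpt).trans ?_
  rw [lintegral_add_right _ measurable_const]
  simp [subWalkGap]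

/-- The resolvent equation in discrete time: the function `F` defined by `G = h F + (1 - ε h) (1 + h
B) S_h G` converges uniformly to `f`, as the first-order terms in `h` cancel. -/
theorem tendsto_resolvent_remainder (S : FellerSemigroup (Config d E))
    (B : C(Config d E, ℝ) →L[ℝ] C(Config d E, ℝ)) {G f : C(Config d E, ℝ)} {ε : ℝ}
    (hG : S.HasGenerator G (ε • G - f - B G)) :
    Tendsto (fun h : ℝ≥0 => (h : ℝ)⁻¹ • (G - (1 - ε * h) • (S.op h G + (h : ℝ) • B (S.op h G))))
      (𝓝[>] 0) (𝓝 f) := by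
  have hS : Tendsto (fun h : ℝ≥0 => S.op h G) (𝓝[>] 0) (𝓝 G) :=
    (S.op_continuous G).mono_left nhdsWithin_le_nhds
  have hB : Tendsto (fun h : ℝ≥0 => B (S.op h G)) (𝓝[>] 0) (𝓝 (B G)) :=
    (B.continuous.tendsto G).comp hS
  have h0 : Tendsto (fun h : ℝ≥0 => ε * (h : ℝ)) (𝓝[>] 0) (𝓝 0) := by
    have : Continuous fun h : ℝ≥0 => ε * (h : ℝ) := by fun_prop
    simpa using (this.tendsto 0).mono_left nhdsWithin_le_nhds
  have hlim := (((Tendsto.neg hG).add (hS.const_smul ε)).sub hB).add (h0.smul hB)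
  have e : -(ε • G - f - B G) + ε • G - B G + (0 : ℝ) • B G = f := by
    rw [zero_smul]
    abel
  rw [e] at hlim
  refine hlim.congr' ?_
  filter_upwards [self_mem_nhdsWithin] with h hh
  have hh0 : (h : ℝ) ≠ 0 := (NNReal.coe_pos.2 hh).ne'
  ext η
  simp only [ContinuousMap.add_apply, ContinuousMap.sub_apply, ContinuousMap.smul_apply,
    ContinuousMap.neg_apply, smul_eq_mul]
  field_simp
  ring

variable {P : FellerProcess (Config d E)}

/-- A joint subkernel that loses at most mass `1 - p` and has total gap at most `A` bounds the
oscillation of the resolvent of the environment process by `A / p`. -/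
theorem resolvent_sub_le [Nonempty E] (hP : P.TranslationInvariant) {Q : EnvCoupling P}
    (hQM : Q.StrongMarginalMarkov) (α : JumpRates d E) {f : C(Config d E, ℝ)} {A p : ℝ}
    (hA : 0 ≤ A) (hp : 0 < p) (hp1 : p ≤ 1)
    (H : ∀ᶠ h : ℝ≥0 in 𝓝[>] 0, ∃ u ≤ h,
      ∃ m : ℕ → Site d → Site d → Config d E → Config d E → ℝ≥0∞, IsJointSubkernel α h m ∧
      ∀ η ξ n, ∑ k ∈ Finset.range n, ENNReal.ofReal h * subWalkGap (Q.law η ξ) m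
          (fun k ω => ω.1.1 (u + k * h)) (fun k ω => ω.2.1 (u + k * h)) f k ≤ ENNReal.ofReal A ∧
        ENNReal.ofReal p ≤ subWalkMass (Q.law η ξ) m
          (fun k ω => ω.1.1 (u + k * h)) (fun k ω => ω.2.1 (u + k * h)) n)
    {G : C(Config d E, ℝ)} {ε : ℝ} (hε : 0 < ε)
    (hG : P.semigroup.HasGenerator G (ε • G - f - α.jumpOp G)) (η ξ : Config d E) :
    G η - G ξ ≤ A / p := by
  set S := P.semigroup with hS
  -- The estimates run in `[0, ∞]`. Adding a constant to `G` and `ε` times it to `f` preserves the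
  -- resolvent equation and oscillations; `c` makes `G'` nonnegative and `f' ≥ 1`, so that any `F`
  -- within distance `1` of `f'` is nonnegative.
  obtain ⟨c, hcG, hcf⟩ : ∃ c : ℝ, ‖G‖ ≤ c ∧ ‖f‖ + 1 ≤ ε * c := by
    refine ⟨‖G‖ + (‖f‖ + 1) / ε, by
      have : 0 ≤ (‖f‖ + 1) / ε := by positivity
      linarith, ?_⟩
    rw [mul_add, mul_div_cancel₀ _ hε.ne']
    have : 0 ≤ ε * ‖G‖ := by positivity
    linarith
  set K : C(Config d E, ℝ) := ContinuousMap.const _ c with hK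
  set G' := G + K with hG'
  set f' := f + ε • K with hf'
  have hG'gen : S.HasGenerator G' (ε • G' - f' - α.jumpOp G') := by
    have h := hG.add (S.hasGenerator_const c)
    rw [add_zero] at h
    convert! h using 1
    rw [hG', map_add, hK, α.jumpOp_const, hf', smul_add]
    abel
  have hG'0 : 0 ≤ G' := fun ζ => by
    have h1 : -‖G‖ ≤ G ζ := neg_le_of_abs_le (G.norm_coe_le_norm ζ)
    have : 0 ≤ G ζ + c := by linarith
    exact this
  have hf'1 : ∀ ζ, 1 ≤ f' ζ := fun ζ => by
    have h1 : -‖f‖ ≤ f ζ := neg_le_of_abs_le (f.norm_coe_le_norm ζ)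
    have : 1 ≤ f ζ + ε * c := by linarith
    exact this
  -- The coupling is started from a maximiser and a minimiser, so the left side of the inequality
  -- becomes `D` itself and the estimate closes on `D`.
  obtain ⟨η₁, -, hη₁⟩ := isCompact_univ.exists_isMaxOn univ_nonempty G'.continuous.continuousOn
  obtain ⟨ξ₁, -, hξ₁⟩ := isCompact_univ.exists_isMinOn univ_nonempty G'.continuous.continuousOn
  set D := G' η₁ - G' ξ₁ with hD
  have hD0 : 0 ≤ D := sub_nonneg.2 (hη₁ (mem_univ ξ₁))
  have hDle : ∀ ζ ζ', G' ζ ≤ G' ζ' + D := fun ζ ζ' => by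
    have h1 : G' ζ ≤ G' η₁ := hη₁ (mem_univ ζ)
    have h2 : G' ξ₁ ≤ G' ζ' := hξ₁ (mem_univ ζ')
    linarith
  -- The error `2 δ` comes from starting the observation at time `u` instead of `0`, and `2 δ / ε`
  -- from replacing `F` by `f'`.
  have key : ∀ δ : ℝ, 0 < δ → δ ≤ 1 → D ≤ A + (1 - p) * D + (2 * δ + 2 * δ / ε) := by
    intro δ hδ hδ1
    have hev1 := (tendsto_resolvent_remainder S α.jumpOp hG'gen).eventually
      (Metric.closedBall_mem_nhds f' hδ)
    have hev2 : ∀ᶠ h : ℝ≥0 in 𝓝[>] 0, ∀ u ≤ h, ‖S.op u G' - G'‖ ≤ δ := by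
      have h1 : ∀ᶠ u : ℝ≥0 in 𝓝 0, ‖S.op u G' - G'‖ ≤ δ := by
        have := (S.op_continuous G').eventually (Metric.closedBall_mem_nhds G' hδ)
        simpa [dist_eq_norm] using this
      obtain ⟨a, ha, h1⟩ := (nhds_bot_basis (α := ℝ≥0)).eventually_iff.1 h1
      refine nhdsWithin_le_nhds ?_
      filter_upwards [Iio_mem_nhds ha] with h hh u hu
      exact h1 (hu.trans_lt hh)
    have hev3 : ∀ᶠ h : ℝ≥0 in 𝓝[>] 0, (h : ℝ) * α.bound < 1 ∧ ε * (h : ℝ) < 1 := by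
      refine nhdsWithin_le_nhds ?_
      have h1 : Continuous fun h : ℝ≥0 => (h : ℝ) * α.bound := by fun_prop
      have h2 : Continuous fun h : ℝ≥0 => ε * (h : ℝ) := by fun_prop
      exact (h1.tendsto 0 |>.eventually (Iio_mem_nhds (by simp))).and
        (h2.tendsto 0 |>.eventually (Iio_mem_nhds (by simp)))
    obtain ⟨h, ⟨hF, hu, ⟨hb, hr⟩, hh, u, huh, m, hm, hbd⟩⟩ :=
      (hev1.and (hev2.and (hev3.and ((eventually_mem_nhdsWithin).and H)))).exists
    have hh0 : (0 : ℝ) < h := NNReal.coe_pos.2 hh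
    set r : ℝ := 1 - ε * h with hrdef
    set F : C(Config d E, ℝ) := (h : ℝ)⁻¹ • (G' - r • (S.op h G' + (h : ℝ) • α.jumpOp (S.op h G')))
      with hFdef
    have hFf : ∀ ζ, |F ζ - f' ζ| ≤ δ := fun ζ => by
      have h1 : dist F f' ≤ δ := hF
      rw [dist_eq_norm] at h1
      exact ((F - f').norm_coe_le_norm ζ).trans h1
    have hF0 : 0 ≤ F := fun ζ => by
      have h1 := (abs_le.1 (hFf ζ)).1
      have h2 := hf'1 ζ
      have : 0 ≤ F ζ := by linarith
      exact this
    have hGF : G' = (h : ℝ) • F + r • (S.op h G' + (h : ℝ) • α.jumpOp (S.op h G')) := by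
      rw [hFdef, smul_smul, mul_inv_cancel₀ hh0.ne', one_smul, sub_add_cancel]
    have hr0 : 0 ≤ r := by rw [hrdef]; linarith
    have hr1 : r < 1 := by
      rw [hrdef]
      have : 0 < ε * h := by positivity
      linarith
    have := Q.isProbabilityMeasure η₁ ξ₁
    have hpair := hQM.isMarkovPair η₁ ξ₁ u h
    have hmain : ∀ n : ℕ, S.op u G' η₁ ≤ S.op u G' ξ₁ + A + 2 * δ / ε + (1 - p) * D + r ^ n * D := by
      intro n
      obtain ⟨hgap, hmass⟩ := hbd η₁ ξ₁ n
      have h1 := hpair.lintegral_le hm.measurable (hP.op_shiftOp h) (S.op_nonneg h) (S.op_one h) α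
        hh0.le hb.le hr0 hr1.le hF0 hG'0 hGF hm.le₁ hm.le₂ hDle n
      simp only [Nat.cast_zero, zero_mul, add_zero] at h1
      rw [Q.lintegral_fst η₁ ξ₁ u hG'0, Q.lintegral_snd η₁ ξ₁ u hG'0] at h1
      have hgapF : ∑ k ∈ Finset.range n, ENNReal.ofReal r ^ k * (ENNReal.ofReal h *
          subWalkGap (Q.law η₁ ξ₁) m (fun k ω => ω.1.1 (u + k * h))
            (fun k ω => ω.2.1 (u + k * h)) F k) ≤
          ENNReal.ofReal A + ENNReal.ofReal (2 * δ / ε) := by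
        have hgf : ∀ k, subWalkGap (Q.law η₁ ξ₁) m (fun k ω => ω.1.1 (u + k * h))
            (fun k ω => ω.2.1 (u + k * h)) f' k = subWalkGap (Q.law η₁ ξ₁) m
            (fun k ω => ω.1.1 (u + k * h)) (fun k ω => ω.2.1 (u + k * h)) f k := fun k => by
          simp only [subWalkGap]
          congr 1
          funext ω
          refine tsum_congr fun x => ?_
          congr 2
          change (f _ + ε * c) - (f _ + ε * c) = _
          ring
        calc _ ≤ ∑ k ∈ Finset.range n, (ENNReal.ofReal h * subWalkGap (Q.law η₁ ξ₁) m
              (fun k ω => ω.1.1 (u + k * h)) (fun k ω => ω.2.1 (u + k * h)) f k +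
              ENNReal.ofReal r ^ k * (ENNReal.ofReal h * ENNReal.ofReal (2 * δ))) := by
              refine Finset.sum_le_sum fun k _ => ?_
              have h2 := subWalkGap_le (μ := Q.law η₁ ξ₁) (Y₁ := fun k ω => ω.1.1 (u + k * h))
                (Y₂ := fun k ω => ω.2.1 (u + k * h)) hh0.le hb.le hm hFf k
              rw [hgf] at h2
              refine (mul_le_mul_right (mul_le_mul_right h2 _) _).trans ?_
              rw [mul_add, mul_add]
              exact add_le_add (mul_le_of_le_one_left'
                (pow_le_one' (ENNReal.ofReal_le_one.2 hr1.le) k)) le_rfl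
          _ ≤ _ := by
              rw [Finset.sum_add_distrib, ← Finset.sum_mul]
              refine add_le_add hgap ?_
              rw [← ENNReal.ofReal_mul hh0.le]
              simp only [← ENNReal.ofReal_pow hr0]
              rw [← ENNReal.ofReal_sum_of_nonneg (fun k _ => pow_nonneg hr0 k),
                ← ENNReal.ofReal_mul (Finset.sum_nonneg fun k _ => pow_nonneg hr0 k)]
              refine ENNReal.ofReal_le_ofReal ?_
              -- The geometric series with ratio `1 - ε h` compensates the step size: `h ∑ r^k ≤ 1 /
              -- ε`.
              have hgeom : (∑ k ∈ Finset.range n, r ^ k) * (ε * h) ≤ 1 := by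
                have := geom_sum_mul r n
                have e : r - 1 = -(ε * h) := by rw [hrdef]; ring
                rw [e] at this
                have hpow := pow_nonneg hr0 n
                linarith
              rw [le_div_iff₀ hε]
              calc (∑ k ∈ Finset.range n, r ^ k) * (h * (2 * δ)) * ε
                  = ((∑ k ∈ Finset.range n, r ^ k) * (ε * h)) * (2 * δ) := by ring
                _ ≤ 1 * (2 * δ) := by gcongr
                _ = 2 * δ := one_mul _
      have hmass' : 1 - subWalkMass (Q.law η₁ ξ₁) m (fun k ω => ω.1.1 (u + k * h))
            (fun k ω => ω.2.1 (u + k * h)) n ≤ ENNReal.ofReal (1 - p) := by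
        rw [ENNReal.ofReal_sub _ hp.le, ENNReal.ofReal_one]
        gcongr
      have h3 : ENNReal.ofReal (S.op u G' η₁) ≤ ENNReal.ofReal (S.op u G' ξ₁ + A + 2 * δ / ε +
          (1 - p) * D + r ^ n * D) := by
        have hSu : 0 ≤ S.op u G' ξ₁ := S.op_nonneg u G' hG'0 ξ₁
        have h1p : 0 ≤ 1 - p := by linarith
        have h4 : 0 ≤ 2 * δ / ε := by positivity
        have h5 : 0 ≤ (1 - p) * D := by positivity
        rw [ENNReal.ofReal_add (by positivity) (by positivity),
          ENNReal.ofReal_add (by positivity) h5, ENNReal.ofReal_add (by positivity) h4,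
          ENNReal.ofReal_add hSu hA, ENNReal.ofReal_mul h1p, ENNReal.ofReal_mul (by positivity),
          ENNReal.ofReal_pow hr0]
        refine h1.trans ?_
        rw [add_assoc (ENNReal.ofReal (S.op u G' ξ₁)) (ENNReal.ofReal A)]
        exact add_le_add (add_le_add (add_le_add le_rfl hgapF) (mul_le_mul_left hmass' _)) le_rfl
      exact (ENNReal.ofReal_le_ofReal_iff (by
        have hSu : 0 ≤ S.op u G' ξ₁ := S.op_nonneg u G' hG'0 ξ₁
        have h1p : 0 ≤ 1 - p := by linarith
        positivity)).1 h3
    -- Since `r < 1` for fixed `ε` and `h`, the contribution of the walks still alive after `n`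
    -- steps vanishes.
    have hlim : Tendsto (fun n : ℕ => S.op u G' ξ₁ + A + 2 * δ / ε + (1 - p) * D + r ^ n * D) atTop
        (𝓝 (S.op u G' ξ₁ + A + 2 * δ / ε + (1 - p) * D + 0 * D)) :=
      tendsto_const_nhds.add ((tendsto_pow_atTop_nhds_zero_of_lt_one hr0 hr1).mul_const D)
    have h6 := ge_of_tendsto' hlim hmain
    have h7 := hu u huh
    have h8 : |S.op u G' η₁ - G' η₁| ≤ δ := ((S.op u G' - G').norm_coe_le_norm η₁).trans h7
    have h9 : |S.op u G' ξ₁ - G' ξ₁| ≤ δ := ((S.op u G' - G').norm_coe_le_norm ξ₁).trans h7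
    have h10 := (abs_le.1 h8).1
    have h11 := (abs_le.1 h9).2
    rw [hD] at h6 ⊢
    linarith
  have hDA : D ≤ A / p := by
    rw [le_div_iff₀ hp]
    have hlim : Tendsto (fun δ : ℝ => A + (1 - p) * D + (2 * δ + 2 * δ / ε)) (𝓝[>] 0)
        (𝓝 (A + (1 - p) * D + (2 * 0 + 2 * 0 / ε))) := by
      have : Continuous fun δ : ℝ => A + (1 - p) * D + (2 * δ + 2 * δ / ε) := by fun_prop
      exact (this.tendsto 0).mono_left nhdsWithin_le_nhds
    have hev : ∀ᶠ δ : ℝ in 𝓝[>] 0, D ≤ A + (1 - p) * D + (2 * δ + 2 * δ / ε) := by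
      filter_upwards [self_mem_nhdsWithin, nhdsWithin_le_nhds (Iio_mem_nhds one_pos)] with δ h1 h2
      exact key δ h1 (le_of_lt h2)
    have := ge_of_tendsto hlim hev
    simp only [mul_zero, zero_div, add_zero] at this
    linarith
  have h12 : G η + c ≤ G ξ + c + D := hDle η ξ
  linarith

end Oscillation

/-! ### Riemann sums with a chosen offset -/

section RiemannSum

/-- A Riemann sum with a well chosen offset is bounded by the integral. -/
theorem exists_riemann_sum_le {φ : ℝ≥0 → ℝ≥0∞}
    (hφ : AEMeasurable (fun t : ℝ => φ t.toNNReal) (volume.restrict (Ioi 0))) {h : ℝ≥0}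
    (hh : 0 < h) : ∃ u ≤ h, ENNReal.ofReal h * ∑' k : ℕ, φ (u + k * h) ≤
      ∫⁻ t in Ioi (0 : ℝ), φ t.toNNReal := by
  have hh' : (0 : ℝ) < h := NNReal.coe_pos.2 hh
  set F : ℝ → ℝ≥0∞ := fun t => φ t.toNNReal with hF
  have hunion : ⋃ k : ℕ, Ioc ((k : ℝ) * h) ((k + 1) * h) = Ioi 0 := by
    ext t
    simp only [mem_iUnion, mem_Ioc, mem_Ioi]
    constructor
    · rintro ⟨k, h1, -⟩
      exact lt_of_le_of_lt (by positivity) h1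
    · intro ht
      have hc : 0 < ⌈t / h⌉₊ := Nat.ceil_pos.2 (by positivity)
      obtain ⟨k, hk⟩ := Nat.exists_eq_succ_of_ne_zero hc.ne'
      refine ⟨k, ?_, ?_⟩
      · have : k < ⌈t / h⌉₊ := by omega
        rw [Nat.lt_ceil] at this
        exact (lt_div_iff₀ hh').1 this
      · have := Nat.le_ceil (t / h)
        rw [hk] at this
        push_cast at this
        exact (div_le_iff₀ hh').1 this
  have hdisj : Pairwise (Function.onFun Disjoint fun k : ℕ => Ioc ((k : ℝ) * h) ((k + 1) * h)) := by
    have hmono : Monotone fun k : ℕ => (k : ℝ) * h := fun a b hab => by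
      have : (a : ℝ) ≤ b := by exact_mod_cast hab
      exact mul_le_mul_of_nonneg_right this hh'.le
    have := hmono.pairwise_disjoint_on_Ioc_succ
    simpa using this
  have hpre : ∀ k : ℕ, (fun u : ℝ => u + k * h) ⁻¹' Ioc ((k : ℝ) * h) ((k + 1) * h) = Ioc 0 (h : ℝ) := by
    intro k
    ext u
    simp only [mem_preimage, mem_Ioc]
    constructor <;> rintro ⟨h1, h2⟩ <;> constructor <;> linarith
  have hmp : ∀ k : ℕ, MeasurePreserving (fun u : ℝ => u + k * h) (volume.restrict (Ioc 0 (h : ℝ)))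
      (volume.restrict (Ioc ((k : ℝ) * h) ((k + 1) * h))) := fun k => by
    have := (measurePreserving_add_right volume ((k : ℝ) * h)).restrict_preimage
      (measurableSet_Ioc (a := (k : ℝ) * h) (b := (k + 1) * h))
    rwa [hpre] at this
  have haem : ∀ k : ℕ, AEMeasurable F (volume.restrict (Ioc ((k : ℝ) * h) ((k + 1) * h))) := fun k =>
    hφ.mono_set (hunion ▸ subset_iUnion (fun k : ℕ => Ioc ((k : ℝ) * h) ((k + 1) * h)) k)
  have hcomp : ∀ k : ℕ, AEMeasurable (fun u : ℝ => F (u + k * h))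
      (volume.restrict (Ioc 0 (h : ℝ))) := fun k =>
    AEMeasurable.comp_quasiMeasurePreserving (g := F) (haem k) (hmp k).quasiMeasurePreserving
  have hint : ∫⁻ u in Ioc 0 (h : ℝ), ∑' k : ℕ, F (u + k * h) = ∫⁻ t in Ioi (0 : ℝ), F t := by
    rw [lintegral_tsum fun k => (hcomp k), ← hunion,
      lintegral_iUnion (fun _ => measurableSet_Ioc) hdisj]
    refine tsum_congr fun k => ?_
    have := lintegral_map' (f := F) (g := fun u : ℝ => u + k * h)
      (μ := volume.restrict (Ioc 0 (h : ℝ))) (by rw [(hmp k).map_eq]; exact haem k)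
      (hmp k).aemeasurable
    rw [(hmp k).map_eq] at this
    exact this.symm
  have hvol : volume (Ioc 0 (h : ℝ)) = ENNReal.ofReal h := by simp
  have haeS : AEMeasurable (fun u => ∑' k : ℕ, F (u + k * h)) (volume.restrict (Ioc 0 (h : ℝ))) :=
    AEMeasurable.tsum fun k => (hcomp k)
  -- Integrating the Riemann sum over the offset in `(0, h]` gives the full integral, so some offset
  -- does no worse than the mean. This needs no regularity of `φ` beyond measurability.
  obtain ⟨u, hu, hle⟩ := exists_le_setLAverage (μ := volume) (s := Ioc 0 (h : ℝ))
    (by rw [hvol]; simpa using hh.ne') (by simp) haeS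
  refine ⟨u.toNNReal, Real.toNNReal_le_iff_le_coe.2 hu.2, ?_⟩
  rw [setLAverage_eq, hint, hvol, ENNReal.le_div_iff_mul_le (by left; simpa using hh.ne')
    (by left; simp), mul_comm] at hle
  refine le_trans (le_of_eq ?_) hle
  congr 1
  refine tsum_congr fun k => ?_
  rw [hF]
  simp only []
  congr 1
  rw [Real.toNNReal_add hu.1.le (by positivity), Real.toNNReal_mul (by positivity)]
  simp

end RiemannSum

/-! ### Expected gaps, and rates independent of the environment -/

section Gap

variable {d : ℕ} {E : Type*} [MetricSpace E] [CompactSpace E] [MeasurableSpace E] [BorelSpace E]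
  {P : FellerProcess (Config d E)} {Q : EnvCoupling P}

theorem EnvCoupling.TranslationInvariant.lintegral_enorm_sub_le (hQ : Q.TranslationInvariant)
    (hE : ∀ a b : E, dist a b ≤ 1) (η ξ : Config d E) (t : ℝ≥0) (x : Site d) (f : C(Config d E, ℝ)) :
    ∫⁻ ω, ‖f (shift (-x) (ω.1.1 t)) - f (shift (-x) (ω.2.1 t))‖ₑ ∂(Q.law η ξ) ≤
      tripleNorm f * ENNReal.ofReal (Q.supDist t) := by
  calc _ ≤ ∫⁻ ω, ∑' y, siteLipschitz f y * edist (ω.1.1 t (y + x)) (ω.2.1 t (y + x))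
        ∂(Q.law η ξ) := by
        refine lintegral_mono fun ω => (enorm_sub_le_tsum_siteLipschitz f.continuous _ _).trans
          (le_of_eq (tsum_congr fun y => ?_))
        change _ * edist (ω.1.1 t (y - -x)) (ω.2.1 t (y - -x)) = _
        rw [sub_neg_eq_add]
    _ = ∑' y, siteLipschitz f y * ∫⁻ ω, edist (ω.1.1 t (y + x)) (ω.2.1 t (y + x))
        ∂(Q.law η ξ) := by
        rw [lintegral_tsum fun y => ((measurable_edist_eval t _).const_mul _).aemeasurable]
        exact tsum_congr fun y => lintegral_const_mul _ (measurable_edist_eval t _)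
    _ ≤ _ := by
        rw [tripleNorm, ← ENNReal.tsum_mul_right]
        gcongr
        exact hQ.lintegral_edist_le hE η ξ t _

/-- The walk depends on the same paths as the gap of `f`. Bounding its weights by a deterministic
profile `w` removes this dependence, at the price of the factor `∑ w`. -/
theorem EnvCoupling.TranslationInvariant.subWalkGap_le (hQ : Q.TranslationInvariant)
    (hE : ∀ a b : E, dist a b ≤ 1) (η ξ : Config d E) (t : ℕ → ℝ≥0) (f : C(Config d E, ℝ))
    {m : ℕ → Site d → Site d → Config d E → Config d E → ℝ≥0∞} {k : ℕ} {w : Site d → ℝ≥0∞}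
    (hw : ∀ ω x, subWalk m (fun k (ω : CadlagPath (Config d E) × CadlagPath (Config d E)) =>
      ω.1.1 (t k)) (fun k ω => ω.2.1 (t k)) k ω x ≤ w x) :
    subWalkGap (Q.law η ξ) m (fun k ω => ω.1.1 (t k)) (fun k ω => ω.2.1 (t k)) f k ≤
      (∑' x, w x) * (tripleNorm f * ENNReal.ofReal (Q.supDist (t k))) := by
  have hmeas : ∀ x, Measurable fun ω : CadlagPath (Config d E) × CadlagPath (Config d E) =>
      ‖f (shift (-x) (ω.1.1 (t k))) - f (shift (-x) (ω.2.1 (t k)))‖ₑ := fun x =>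
    ((measurable_comp_eval measurable_fst (shiftOp (-x) f) (t k)).sub
      (measurable_comp_eval measurable_snd (shiftOp (-x) f) (t k))).enorm
  calc _ ≤ ∫⁻ ω, ∑' x, w x *
        ‖f (shift (-x) (ω.1.1 (t k))) - f (shift (-x) (ω.2.1 (t k)))‖ₑ ∂(Q.law η ξ) := by
        refine lintegral_mono fun ω => ENNReal.tsum_le_tsum fun x => ?_
        gcongr
        exact hw ω x
    _ = ∑' x, w x * ∫⁻ ω,
        ‖f (shift (-x) (ω.1.1 (t k))) - f (shift (-x) (ω.2.1 (t k)))‖ₑ ∂(Q.law η ξ) := by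
        rw [lintegral_tsum fun x => ((hmeas x).const_mul _).aemeasurable]
        exact tsum_congr fun x => lintegral_const_mul _ (hmeas x)
    _ ≤ _ := by
        rw [← ENNReal.tsum_mul_right]
        gcongr
        exact hQ.lintegral_enorm_sub_le hE η ξ _ _ f

/-- An uncountable supremum need not be measurable; measurability is extracted from the
integrability of `t^d g(t)` by dividing by `t^d`. -/
theorem EnvCoupling.aemeasurable_supDist
    (hQd : IntegrableOn (fun t : ℝ => t ^ d * Q.supDist t.toNNReal) (Ioi 0)) :
    AEMeasurable (fun t : ℝ => Q.supDist t.toNNReal) (volume.restrict (Ioi 0)) := by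
  have h : AEMeasurable (fun t : ℝ => (t ^ d)⁻¹ * (t ^ d * Q.supDist t.toNNReal))
      (volume.restrict (Ioi 0)) :=
    (Measurable.aemeasurable (by fun_prop)).mul hQd.aemeasurable
  refine h.congr ((ae_restrict_iff' measurableSet_Ioi).2 (Eventually.of_forall fun t ht => ?_))
  have : t ^ d ≠ 0 := (pow_pos (mem_Ioi.1 ht) d).ne'
  field_simp

/-- Up to time `1` the bound `g ≤ 1` is used, after that `t^d ≥ 1`. -/
theorem EnvCoupling.integrableOn_supDist (hE : ∀ a b : E, dist a b ≤ 1)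
    (hQd : IntegrableOn (fun t : ℝ => t ^ d * Q.supDist t.toNNReal) (Ioi 0)) :
    IntegrableOn (fun t : ℝ => Q.supDist t.toNNReal) (Ioi 0) := by
  have hm := (EnvCoupling.aemeasurable_supDist hQd).aestronglyMeasurable
  rw [← Ioc_union_Ioi_eq_Ioi zero_le_one]
  refine IntegrableOn.union ?_ ?_
  · refine IntegrableOn.of_bound (by simp) (hm.mono_set Ioc_subset_Ioi_self) 1
      (Eventually.of_forall fun t => ?_)
    rw [Real.norm_of_nonneg (Q.supDist_nonneg _)]
    exact Q.supDist_le_one hE _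
  · have hsub : Ioi (1 : ℝ) ⊆ Ioi 0 := Ioi_subset_Ioi zero_le_one
    refine (hQd.mono_set hsub).mono' (hm.mono_set hsub)
      ((ae_restrict_iff' measurableSet_Ioi).2 (Eventually.of_forall fun t ht => ?_))
    rw [Real.norm_of_nonneg (Q.supDist_nonneg _)]
    exact le_mul_of_one_le_left (Q.supDist_nonneg _) (one_le_pow₀ (le_of_lt ht))

/-- The oscillation of the resolvent when the rates do not depend on the environment. -/
theorem resolvent_sub_le_of_envIndependent [Nonempty E] (hE : ∀ a b : E, dist a b ≤ 1)
    (hP : P.TranslationInvariant) (hQ : Q.TranslationInvariant) (hQM : Q.StrongMarginalMarkov)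
    (hQd : IntegrableOn (fun t : ℝ => t ^ d * Q.supDist t.toNNReal) (Ioi 0))
    {α : JumpRates d E} (hα : α.EnvIndependent) {f G : C(Config d E, ℝ)} (hf : tripleNorm f < ∞)
    {ε : ℝ} (hε : 0 < ε) (hG : P.semigroup.HasGenerator G (ε • G - f - α.jumpOp G))
    (η ξ : Config d E) :
    G η - G ξ ≤ (∫ t in Ioi (0 : ℝ), Q.supDist t.toNNReal) * (tripleNorm f).toReal := by
  have hI0 : 0 ≤ ∫ t in Ioi (0 : ℝ), Q.supDist t.toNNReal :=
    integral_nonneg fun t => Q.supDist_nonneg _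
  have hint := EnvCoupling.integrableOn_supDist hE hQd
  have h := resolvent_sub_le hP hQM α (f := f)
    (A := (∫ t in Ioi (0 : ℝ), Q.supDist t.toNNReal) * (tripleNorm f).toReal) (p := 1)
    (by positivity) one_pos le_rfl ?_ hε hG η ξ
  · rwa [div_one] at h
  have hstep : ∀ (h : ℝ) z (η ξ : Config d E), α.stepProb h η z = α.stepProb h ξ z := by
    intro h z η ξ
    simp only [JumpRates.stepProb, hα η ξ]
  have hbound : ∀ᶠ h : ℝ≥0 in 𝓝[>] 0, (h : ℝ) * α.bound < 1 := by
    refine nhdsWithin_le_nhds ?_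
    have h1 : Continuous fun h : ℝ≥0 => (h : ℝ) * α.bound := by fun_prop
    exact (h1.tendsto 0).eventually (Iio_mem_nhds (by simp))
  filter_upwards [hbound, self_mem_nhdsWithin] with h hb hh
  have hh0 : (0 : ℝ) ≤ h := h.2
  obtain ⟨u, hu, hsum⟩ := exists_riemann_sum_le (φ := fun t => ENNReal.ofReal (Q.supDist t))
    (EnvCoupling.aemeasurable_supDist hQd).ennreal_ofReal hh
  rw [← ofReal_integral_eq_lintegral_ofReal hint
    (Eventually.of_forall fun t => Q.supDist_nonneg _)] at hsum
  -- The two transition kernels are equal, so the walk keeps every jump and loses no mass.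
  set m : ℕ → Site d → Site d → Config d E → Config d E → ℝ≥0∞ :=
    fun _ x y η _ => α.stepProb h (shift (-x) η) (y - x) with hm
  have hmk : IsJointSubkernel α h m :=
    ⟨fun k x y => (α.measurable_stepProb h _).comp
      ((shift (-x)).continuous.measurable.comp measurable_fst), fun _ _ _ _ _ => le_rfl,
      fun k x y η ξ => (hstep _ _ _ _).le⟩
  refine ⟨u, hu, m, hmk, fun η ξ n => ⟨?_, ?_⟩⟩
  · obtain ⟨ω₀⟩ : Nonempty (CadlagPath (Config d E) × CadlagPath (Config d E)) :=
      have := Q.isProbabilityMeasure η ξ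
      (Q.law η ξ).nonempty_of_neZero
    -- The weights do not depend on the environment, so they serve as their own deterministic
    -- profile, of total mass at most `1`; this is why the constant is exactly `∫ g`.
    have hconst : ∀ k ω x, subWalk m (fun k (ω : CadlagPath (Config d E) ×
        CadlagPath (Config d E)) => ω.1.1 (u + k * h)) (fun k ω => ω.2.1 (u + k * h)) k ω x =
        subWalk m (fun k (ω : CadlagPath (Config d E) ×
        CadlagPath (Config d E)) => ω.1.1 (u + k * h)) (fun k ω => ω.2.1 (u + k * h)) k ω₀ x := by
      intro k ω
      induction k with
      | zero => exact fun x => rfl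
      | succ k ih => exact fun x => tsum_congr fun y => by rw [ih, hm]; congr 1; exact hstep _ _ _ _
    have hgap : ∀ k, subWalkGap (Q.law η ξ) m (fun k ω => ω.1.1 (u + k * h))
        (fun k ω => ω.2.1 (u + k * h)) f k ≤
        tripleNorm f * ENNReal.ofReal (Q.supDist (u + k * h)) := fun k =>
      (hQ.subWalkGap_le hE η ξ (fun k => u + k * h) f fun ω x => (hconst k ω x).le).trans
        (mul_le_of_le_one_left' (tsum_subWalk_le_one α hh0 hb.le hmk.le₁ k))
    calc _ ≤ ∑ k ∈ Finset.range n, ENNReal.ofReal h *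
          (tripleNorm f * ENNReal.ofReal (Q.supDist (u + k * h))) := by
          gcongr with k
          exact hgap k
      _ = (ENNReal.ofReal h * ∑ k ∈ Finset.range n, ENNReal.ofReal (Q.supDist (u + k * h))) *
          tripleNorm f := by
          rw [Finset.mul_sum, Finset.sum_mul]
          refine Finset.sum_congr rfl fun k _ => ?_
          ring
      _ ≤ _ := by
          rw [ENNReal.ofReal_mul hI0, ENNReal.ofReal_toReal hf.ne]
          gcongr
          exact le_trans (mul_le_mul_right (ENNReal.sum_le_tsum _) _) hsum
  · have := Q.isProbabilityMeasure η ξ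
    have h1 : ∀ n ω, ∑' x, subWalk m (fun k (ω : CadlagPath (Config d E) ×
        CadlagPath (Config d E)) => ω.1.1 (u + k * h)) (fun k ω => ω.2.1 (u + k * h)) n ω x = 1 := by
      intro n ω
      induction n with
      | zero => simp [subWalk]
      | succ n ih =>
        have := tsum_subWalk_eq α hh0 hb.le (k := n) (ω := ω)
          (Y₁ := fun k (ω : CadlagPath (Config d E) × CadlagPath (Config d E)) => ω.1.1 (u + k * h))
          (Y₂ := fun k ω => ω.2.1 (u + k * h)) (Y := fun k ω => ω.1.1 (u + k * h))
          fun x y => hmk.le₁ n x y _ _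
        rw [ih] at this
        simpa [hm] using this.symm
    simp [subWalkMass, h1]

end Gap

/-! ### Escape from a growing ball: elementary inequalities -/

section Escape

/-- The squared relative excess of `n` over `R`. -/
def escape (R n : ℝ) : ℝ := (max 0 (n - R) / R) ^ 2

theorem escape_nonneg (R n : ℝ) : 0 ≤ escape R n := sq_nonneg _

theorem escape_of_le {R n : ℝ} (h : n ≤ R) : escape R n = 0 := by
  simp [escape, max_eq_left (sub_nonpos.2 h)]

theorem escape_mono {R n n' : ℝ} (hR : 0 ≤ R) (h : n ≤ n') : escape R n ≤ escape R n' := by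
  have h0 : 0 ≤ max 0 (n - R) := le_max_left _ _
  unfold escape
  gcongr

theorem one_le_escape {R n : ℝ} (hR : 0 < R) (h : 2 * R ≤ n) : 1 ≤ escape R n := by
  refine one_le_pow₀ ((one_le_div hR).2 (le_max_of_le_right ?_))
  linarith

theorem escape_le_one {R n : ℝ} (hR : 0 < R) (h : n ≤ 2 * R) : escape R n ≤ 1 := by
  refine pow_le_one₀ (div_nonneg (le_max_left _ _) hR.le) ((div_le_one hR).2 (max_le hR.le ?_))
  linarith

/-- Enlarging the radius by `δ` lowers the potential by at least its derivative in `n` times `δ`.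
This pays for the mean displacement of the walk in one step. -/
theorem escape_add_le {R δ δ' n : ℝ} (hR : 0 < R) (hδ : 0 ≤ δ) (hδ' : δ' ≤ δ) :
    escape (R + δ) n + 2 * max 0 (n - (R + δ)) / (R + δ) ^ 2 * δ' ≤ escape R n := by
  rcases le_total n (R + δ) with h | h
  · rw [escape_of_le h, max_eq_left (sub_nonpos.2 h)]
    simpa using escape_nonneg R n
  · have h1 : max 0 (n - (R + δ)) = n - (R + δ) := max_eq_right (sub_nonneg.2 h)
    have h2 : max 0 (n - R) = n - R := max_eq_right (by linarith)
    unfold escape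
    rw [h1, h2, div_pow, div_pow]
    calc _ = ((n - (R + δ)) ^ 2 + 2 * (n - (R + δ)) * δ') / (R + δ) ^ 2 := by ring
      _ ≤ (n - R) ^ 2 / (R + δ) ^ 2 := by
          gcongr
          nlinarith [sub_nonneg.2 h]
      _ ≤ (n - R) ^ 2 / R ^ 2 := by
          gcongr
          linarith

/-- Second-order expansion for `b ≤ R` and the trivial bound `1` for `b ≥ R`, combined into one
remainder. The truncation at `1` makes its weighted sum over jumps finite under a first moment
alone. -/
theorem min_escape_add_le {R n b : ℝ} (hR : 0 < R) (hb : 0 ≤ b) :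
    min 1 (escape R (n + b)) ≤
      escape R n + 2 * max 0 (n - R) / R ^ 2 * b + 4 * b ^ 2 / (b + R) ^ 2 := by
  have hs : 0 ≤ max 0 (n - R) := le_max_left _ _
  rcases le_total R b with h | h
  · have h1 : 1 ≤ 4 * b ^ 2 / (b + R) ^ 2 := by
      rw [le_div_iff₀ (by positivity)]
      nlinarith
    have h2 := escape_nonneg R n
    have h3 : 0 ≤ 2 * max 0 (n - R) / R ^ 2 * b := by positivity
    exact (min_le_left _ _).trans (by linarith)
  · have h1 : b ^ 2 / R ^ 2 ≤ 4 * b ^ 2 / (b + R) ^ 2 := by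
      rw [div_le_div_iff₀ (by positivity) (by positivity)]
      have : (b + R) ^ 2 ≤ 4 * R ^ 2 := by nlinarith
      nlinarith [sq_nonneg b]
    have h2 : max 0 (n + b - R) ≤ max 0 (n - R) + b := by
      refine max_le (by linarith) ?_
      have := le_max_right 0 (n - R)
      linarith
    refine (min_le_right _ _).trans ?_
    calc escape R (n + b) ≤ ((max 0 (n - R) + b) / R) ^ 2 := by
          have : 0 ≤ max 0 (n + b - R) := le_max_left _ _
          unfold escape
          gcongr
      _ = escape R n + 2 * max 0 (n - R) / R ^ 2 * b + b ^ 2 / R ^ 2 := by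
          unfold escape
          ring
      _ ≤ _ := by linarith

/-- The remainder of the expansion is dominated by a difference in `R`, so its sum over a growing
sequence of radii telescopes. -/
theorem div_sq_mul_le_sub {R δ b : ℝ} (hR : 0 < R) (hδ : 0 ≤ δ) (hb : 0 ≤ b) :
    4 * b ^ 2 / (b + (R + δ)) ^ 2 * δ ≤ 4 * b ^ 2 / (b + R) - 4 * b ^ 2 / (b + (R + δ)) := by
  have e : 4 * b ^ 2 / (b + R) - 4 * b ^ 2 / (b + (R + δ)) =
      4 * b ^ 2 * δ / ((b + R) * (b + (R + δ))) := by
    field_simp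
    ring
  rw [e, div_mul_eq_mul_div]
  gcongr
  nlinarith

theorem tsum_norm_le_le (d : ℕ) {R : ℝ} (hR : 0 ≤ R) :
    ∑' x : Site d, (if ‖x‖ ≤ R then 1 else 0 : ℝ≥0∞) ≤ ENNReal.ofReal ((2 * R + 1) ^ d) := by
  classical
  set s : Finset (Site d) := Fintype.piFinset fun _ => Finset.Icc (-⌊R⌋) ⌊R⌋ with hs
  have hmem : ∀ x : Site d, ‖x‖ ≤ R → x ∈ s := fun x hx => by
    rw [hs, Fintype.mem_piFinset]
    intro i
    have h1 := (norm_le_pi_norm x i).trans hx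
    rw [Int.norm_eq_abs] at h1
    have h2 : |x i| ≤ ⌊R⌋ := Int.le_floor.2 (by exact_mod_cast h1)
    rw [Finset.mem_Icc]
    exact abs_le.1 h2
  rw [tsum_eq_sum (s := s) fun x hx => if_neg fun h => hx (hmem x h)]
  calc _ ≤ ∑ x ∈ s, (1 : ℝ≥0∞) := Finset.sum_le_sum fun x _ => by split_ifs <;> simp
    _ = ENNReal.ofReal (s.card : ℝ) := by simp
    _ ≤ _ := by
        refine ENNReal.ofReal_le_ofReal ?_
        rw [hs, Fintype.card_piFinset_const, Int.card_Icc]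
        push_cast
        have h0 : 0 ≤ ⌊R⌋ := Int.floor_nonneg.2 hR
        have h1 : (((⌊R⌋ + 1 - -⌊R⌋).toNat : ℕ) : ℝ) = ((⌊R⌋ + 1 - -⌊R⌋ : ℤ) : ℝ) := by
          exact_mod_cast congrArg (Int.cast (R := ℝ)) (Int.toNat_of_nonneg (by omega))
        rw [h1]
        push_cast
        have h2 := Int.floor_le R
        have h3 : (0 : ℝ) ≤ ⌊R⌋ := by exact_mod_cast h0
        gcongr <;> linarith

end Escape

/-! ### The escape potential and the separation of transition probabilities -/

section Kernel

variable {d : ℕ} {E : Type*} [MetricSpace E] [CompactSpace E]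

namespace JumpRates

/-- An upper bound for the probability that, by a single large jump, the walk leaves a ball whose
radius grows from `R` at speed `a`. -/
def largeJump (α : JumpRates d E) (a R : ℝ) : ℝ :=
  (∑' z : Site d, ‖α.rateMap z‖ * (4 * ‖z‖ ^ 2 / (‖z‖ + R))) / a

theorem largeJump_term_le {R : ℝ} (hR : 0 < R) (z : Site d) : 4 * ‖z‖ ^ 2 / (‖z‖ + R) ≤ 4 * ‖z‖ := by
  rw [div_le_iff₀ (by positivity)]
  nlinarith [norm_nonneg z]

theorem summable_largeJump (α : JumpRates d E) {R : ℝ} (hR : 0 < R) :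
    Summable fun z : Site d => ‖α.rateMap z‖ * (4 * ‖z‖ ^ 2 / (‖z‖ + R)) := by
  refine Summable.of_nonneg_of_le (fun z => by positivity) (fun z => ?_)
    (α.summable_norm_mul.mul_left 4)
  have := mul_le_mul_of_nonneg_left (largeJump_term_le hR z) (norm_nonneg (α.rateMap z))
  linarith

theorem largeJump_nonneg (α : JumpRates d E) {a R : ℝ} (ha : 0 < a) (hR : 0 < R) :
    0 ≤ α.largeJump a R :=
  div_nonneg (tsum_nonneg fun z => by positivity) ha.le

theorem largeJump_le (α : JumpRates d E) {a R : ℝ} (ha : 0 < a) (hR : 0 < R) :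
    α.largeJump a R ≤ 4 * α.moment / a := by
  unfold largeJump moment
  gcongr
  rw [← tsum_mul_left]
  refine (α.summable_largeJump hR).tsum_le_tsum (fun z => ?_) (α.summable_norm_mul.mul_left 4)
  have := mul_le_mul_of_nonneg_left (largeJump_term_le hR z) (norm_nonneg (α.rateMap z))
  linarith

theorem tsum_stepProb_mul_le (α : JumpRates d E) {h : ℝ} (hh : 0 ≤ h) (η : Config d E)
    {F : Site d → ℝ} (hF0 : F 0 = 0) (hF : ∀ z, 0 ≤ F z)
    (hs : Summable fun z => ‖α.rateMap z‖ * F z) :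
    ∑' z, α.stepProb h η z * ENNReal.ofReal (F z) ≤
      ENNReal.ofReal (h * ∑' z, ‖α.rateMap z‖ * F z) := by
  rw [← tsum_mul_left, ENNReal.ofReal_tsum_of_nonneg
    (fun z => mul_nonneg hh (mul_nonneg (norm_nonneg _) (hF z))) (hs.mul_left h)]
  refine ENNReal.tsum_le_tsum fun z => ?_
  by_cases hz : z = 0
  · simp [hz, hF0]
  · rw [stepProb, if_neg hz, add_zero,
      ← ENNReal.ofReal_mul (mul_nonneg hh (α.nonneg _ _)), mul_assoc]
    refine ENNReal.ofReal_le_ofReal ?_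
    have := α.rate_le_norm η z
    have := hF z
    gcongr

/-- The sum of `escape` and `largeJump` is a supermartingale while the radius grows at speed `a ≥
α.moment`: the linear part of a jump is absorbed by the growth of the radius, the remainder by the
decrease of `largeJump`. -/
theorem tsum_stepProb_mul_min_escape_le (α : JumpRates d E) {h : ℝ} (hh : 0 < h)
    (hb : h * α.bound ≤ 1) {a t : ℝ} (ha : 0 < a) (hMa : α.moment ≤ a) (ht : 0 < t)
    (η : Config d E) (x : Site d) :
    ∑' y, α.stepProb h η (y - x) * min 1 (ENNReal.ofReal (escape (a * (t + h)) ‖y‖)) +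
        ENNReal.ofReal (α.largeJump a (a * (t + h))) ≤
      ENNReal.ofReal (escape (a * t) ‖x‖) + ENNReal.ofReal (α.largeJump a (a * t)) := by
  have hR : 0 < a * t := by positivity
  have hR' : 0 < a * (t + h) := by positivity
  set R' := a * (t + h) with hR'def
  have hRR' : R' = a * t + a * h := by rw [hR'def]; ring
  set q : ℝ := 2 * max 0 (‖x‖ - R') / R' ^ 2 with hq
  have hq0 : 0 ≤ q := div_nonneg (mul_nonneg zero_le_two (le_max_left _ _)) (sq_nonneg _)
  set κ : ℝ → Site d → ℝ := fun R z => 4 * ‖z‖ ^ 2 / (‖z‖ + R) with hκ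
  have hκ' : ∀ z, h * (4 * ‖z‖ ^ 2 / (‖z‖ + R') ^ 2) ≤ (κ (a * t) z - κ R' z) / a := fun z => by
    rw [le_div_iff₀ ha, hκ, hRR']
    have := div_sq_mul_le_sub hR (by positivity : 0 ≤ a * h) (norm_nonneg z)
    linarith
  -- Both parts of the increment caused by a jump `z`: slope `q` times `‖z‖`, and the remainder
  -- already written as a decrement of `largeJump` terms.
  set F : Site d → ℝ := fun z => q * ‖z‖ + (κ (a * t) z - κ R' z) / a / h with hF
  have hF0 : F 0 = 0 := by simp [hF, hκ]
  have hFnn : ∀ z, 0 ≤ F z := fun z => by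
    have : 0 ≤ (κ (a * t) z - κ R' z) / a := le_trans (by positivity) (hκ' z)
    rw [hF]
    positivity
  have hsum := ((α.summable_norm_mul.hasSum.mul_left q).add
    ((((α.summable_largeJump hR).hasSum.sub (α.summable_largeJump hR').hasSum).div_const a).div_const
      h)).congr_fun (g := fun z => ‖α.rateMap z‖ * F z) fun z => by
        rw [hF, hκ]; ring
  have hpt : ∀ z, min 1 (ENNReal.ofReal (escape R' ‖x + z‖)) ≤
      ENNReal.ofReal (escape R' ‖x‖) + ENNReal.ofReal (F z) := fun z => by
    rw [← ENNReal.ofReal_one, ← ENNReal.ofReal_min, ← ENNReal.ofReal_add (escape_nonneg _ _) (hFnn z)]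
    refine ENNReal.ofReal_le_ofReal ?_
    have h1 := min_escape_add_le (n := ‖x‖) hR' (norm_nonneg z)
    have h2 := min_le_min_left (1 : ℝ) (escape_mono hR'.le (norm_add_le x z))
    have h3 : 4 * ‖z‖ ^ 2 / (‖z‖ + R') ^ 2 ≤ (κ (a * t) z - κ R' z) / a / h := by
      rw [le_div_iff₀ hh, mul_comm]
      exact hκ' z
    rw [hF]
    linarith
  have hstep : ∑' y, α.stepProb h η (y - x) * min 1 (ENNReal.ofReal (escape R' ‖y‖)) ≤
      ENNReal.ofReal (escape R' ‖x‖) + ENNReal.ofReal (h * ∑' z, ‖α.rateMap z‖ * F z) := by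
    calc _ = ∑' z, α.stepProb h η z * min 1 (ENNReal.ofReal (escape R' ‖x + z‖)) := by
          rw [← tsum_sub_site (fun z => α.stepProb h η z *
            min 1 (ENNReal.ofReal (escape R' ‖x + z‖))) x]
          simp only [add_sub_cancel]
      _ ≤ ∑' z, (α.stepProb h η z * ENNReal.ofReal (escape R' ‖x‖) +
          α.stepProb h η z * ENNReal.ofReal (F z)) := by
          refine ENNReal.tsum_le_tsum fun z => ?_
          rw [← mul_add]
          gcongr
          exact hpt z
      _ ≤ _ := by
          rw [ENNReal.tsum_add, ENNReal.tsum_mul_right, α.tsum_stepProb hh.le hb, one_mul]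
          gcongr
          exact α.tsum_stepProb_mul_le hh.le η hF0 hFnn hsum.summable
  have hL : h * ∑' z, ‖α.rateMap z‖ * F z =
      q * (h * α.moment) + (α.largeJump a (a * t) - α.largeJump a R') := by
    rw [hsum.tsum_eq]
    unfold moment largeJump
    rw [mul_add, mul_div_cancel₀ _ hh.ne', sub_div, mul_left_comm]
  have hesc := escape_add_le (n := ‖x‖) hR (by positivity : 0 ≤ a * h)
    (by nlinarith : h * α.moment ≤ a * h)
  rw [← hRR', ← hq] at hesc
  refine (add_le_add hstep le_rfl).trans ?_
  rw [← ENNReal.ofReal_add (escape_nonneg _ _)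
    (mul_nonneg hh.le (tsum_nonneg fun z => mul_nonneg (norm_nonneg _) (hFnn z))),
    ← ENNReal.ofReal_add (add_nonneg (escape_nonneg _ _)
    (mul_nonneg hh.le (tsum_nonneg fun z => mul_nonneg (norm_nonneg _) (hFnn z))))
    (α.largeJump_nonneg ha hR'), ← ENNReal.ofReal_add (escape_nonneg _ _)
    (α.largeJump_nonneg ha hR)]
  refine ENNReal.ofReal_le_ofReal ?_
  rw [hL]
  linarith

/-- The mass by which the transition probabilities in two environments differ. -/
def stepSep (α : JumpRates d E) (h : ℝ) (η ξ : Config d E) : ℝ≥0∞ :=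
  ∑' z, (α.stepProb h η z - α.stepProb h ξ z)

theorem one_le_tsum_min_add_stepSep (α : JumpRates d E) {h : ℝ} (hh : 0 ≤ h)
    (hb : h * α.bound ≤ 1) (η ξ : Config d E) :
    1 ≤ ∑' z, min (α.stepProb h η z) (α.stepProb h ξ z) + α.stepSep h η ξ := by
  rw [← α.tsum_stepProb hh hb η, stepSep, ← ENNReal.tsum_add]
  refine ENNReal.tsum_le_tsum fun z => ?_
  rcases le_total (α.stepProb h η z) (α.stepProb h ξ z) with h1 | h1
  · rw [min_eq_left h1]
    exact le_self_add
  · rw [min_eq_right h1, add_tsub_cancel_of_le h1]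

/-- One copy of the sum comes from the jump probabilities and one from the holding probability at `z
= 0`, hence the factor `2`. -/
theorem stepSep_le (α : JumpRates d E) {h : ℝ} (hh : 0 ≤ h) (η ξ : Config d E) :
    α.stepSep h η ξ ≤ 2 * ENNReal.ofReal h * ∑' z, ‖α.rateMap z η - α.rateMap z ξ‖ₑ := by
  have hmul : ∀ a b : ℝ, ENNReal.ofReal (h * a) ≤
      ENNReal.ofReal (h * b) + ENNReal.ofReal h * ‖a - b‖ₑ := fun a b => by
    rw [ENNReal.ofReal_mul hh, ENNReal.ofReal_mul hh, ← mul_add]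
    gcongr
    exact ofReal_le_add_enorm_sub a b
  have htsum : ‖(∑' y, α.rate η y) - ∑' y, α.rate ξ y‖ₑ ≤
      ∑' z, ‖α.rateMap z η - α.rateMap z ξ‖ₑ := by
    rw [← (α.summable_rate η).tsum_sub (α.summable_rate ξ)]
    exact enorm_tsum_le_tsum_enorm
  have hpt : ∀ z, α.stepProb h η z - α.stepProb h ξ z ≤
      ENNReal.ofReal h * ‖α.rateMap z η - α.rateMap z ξ‖ₑ +
      if z = 0 then ENNReal.ofReal h * ‖(∑' y, α.rate η y) - ∑' y, α.rate ξ y‖ₑ else 0 := by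
    intro z
    rw [tsub_le_iff_left]
    unfold stepProb
    have h1 := hmul (α.rate η z) (α.rate ξ z)
    by_cases hz : z = 0
    · simp only [hz, if_true] at h1 ⊢
      have h2 : ENNReal.ofReal (1 - h * ∑' y, α.rate η y) ≤
          ENNReal.ofReal (1 - h * ∑' y, α.rate ξ y) +
          ENNReal.ofReal h * ‖(∑' y, α.rate η y) - ∑' y, α.rate ξ y‖ₑ := by
        refine (ofReal_le_add_enorm_sub _ (1 - h * ∑' y, α.rate ξ y)).trans ?_
        gcongr
        rw [← Real.enorm_of_nonneg hh, ← enorm_mul, ← enorm_neg]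
        exact le_of_eq (congrArg _ (by ring))
      refine (add_le_add h1 h2).trans (le_of_eq ?_)
      change _ = _ + _ + (ENNReal.ofReal h * ‖α.rate η 0 - α.rate ξ 0‖ₑ + _)
      ring
    · simp only [hz, if_false, add_zero]
      exact h1
  calc _ ≤ _ := ENNReal.tsum_le_tsum hpt
    _ = ENNReal.ofReal h * ∑' z, ‖α.rateMap z η - α.rateMap z ξ‖ₑ +
        ENNReal.ofReal h * ‖(∑' y, α.rate η y) - ∑' y, α.rate ξ y‖ₑ := by
        rw [ENNReal.tsum_add, ENNReal.tsum_mul_left, tsum_ite_eq]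
    _ ≤ ENNReal.ofReal h * ∑' z, ‖α.rateMap z η - α.rateMap z ξ‖ₑ +
        ENNReal.ofReal h * ∑' z, ‖α.rateMap z η - α.rateMap z ξ‖ₑ := by gcongr
    _ = _ := by ring

end JumpRates

end Kernel

/-! ### Survival of a killed walk through a potential -/

section Potential

/-- If one step of a kernel loses at most `sep` plus the decrease of the potential `Θ`, then so do
`n` steps. -/
theorem tsum_add_tsum_mul_potential_le {ι : Type*} {v : ℕ → ι → ℝ≥0∞} {M : ℕ → ι → ι → ℝ≥0∞}
    (hv : ∀ k y, v (k + 1) y = ∑' x, v k x * M k x y) {Θ sep : ℕ → ι → ℝ≥0∞}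
    (hstep : ∀ k x, 1 + ∑' y, M k x y * Θ (k + 1) y ≤ ∑' y, M k x y + sep k x + Θ k x)
    (hfin : ∀ k, ∑' x, v k x ≠ ∞) (n : ℕ) :
    ∑' x, v 0 x + ∑' x, v n x * Θ n x ≤
      ∑' x, v n x + ∑ k ∈ Finset.range n, ∑' x, v k x * sep k x + ∑' x, v 0 x * Θ 0 x := by
  induction n with
  | zero => simp
  | succ n ih =>
    have hM : ∀ F : ι → ℝ≥0∞, ∑' y, v (n + 1) y * F y = ∑' x, v n x * ∑' y, M n x y * F y := by
      intro F
      simp only [hv, ← ENNReal.tsum_mul_right, ← ENNReal.tsum_mul_left]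
      rw [ENNReal.tsum_comm]
      simp only [mul_assoc]
    have h1 : ∑' x, v n x + ∑' x, v (n + 1) x * Θ (n + 1) x ≤
        ∑' x, v (n + 1) x + ∑' x, v n x * sep n x + ∑' x, v n x * Θ n x := by
      have e := hM fun _ => 1
      simp only [mul_one] at e
      rw [hM, e, ← ENNReal.tsum_add, ← ENNReal.tsum_add, ← ENNReal.tsum_add]
      refine ENNReal.tsum_le_tsum fun x => ?_
      rw [← mul_add, ← mul_add, ← mul_one_add]
      exact mul_le_mul_right (hstep n x) _
    rw [Finset.sum_range_succ]
    -- Extended nonnegative reals do not allow subtraction, so the finite mass at time `n` is added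
    -- to both sides and cancelled.
    refine (ENNReal.add_le_add_iff_right (hfin n)).1 ?_
    calc ∑' x, v 0 x + ∑' x, v (n + 1) x * Θ (n + 1) x + ∑' x, v n x
        = ∑' x, v 0 x + (∑' x, v n x + ∑' x, v (n + 1) x * Θ (n + 1) x) := by ring
      _ ≤ ∑' x, v 0 x + (∑' x, v (n + 1) x + ∑' x, v n x * sep n x + ∑' x, v n x * Θ n x) := by
        gcongr
      _ = (∑' x, v 0 x + ∑' x, v n x * Θ n x) + (∑' x, v (n + 1) x + ∑' x, v n x * sep n x) := by
        ring
      _ ≤ (∑' x, v n x + ∑ k ∈ Finset.range n, ∑' x, v k x * sep k x + ∑' x, v 0 x * Θ 0 x) +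
          (∑' x, v (n + 1) x + ∑' x, v n x * sep n x) := by gcongr
      _ = _ := by ring

end Potential

/-! ### The walk confined to a growing ball -/

section Confined

variable {d : ℕ} {E : Type*} [MetricSpace E]

namespace JumpRates

/-- The walk stays put for `k₀` steps; afterwards it makes the jumps that are common to both
environments, as long as they do not leave a ball that grows at speed `2 a`. -/
def confinedKernel [CompactSpace E] (α : JumpRates d E) (h a : ℝ) (t : ℕ → ℝ≥0) (k₀ : ℕ) :
    ℕ → Site d → Site d → Config d E → Config d E → ℝ≥0∞ := fun k x y η ξ =>
  if k < k₀ then if y = x then ENNReal.ofReal (1 - h * α.bound) else 0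
  else if ‖y‖ ≤ 2 * (a * t (k + 1)) then
    min (α.stepProb h (shift (-x) η) (y - x)) (α.stepProb h (shift (-x) ξ) (y - x)) else 0

variable [CompactSpace E] (α : JumpRates d E) {h a : ℝ} {t : ℕ → ℝ≥0} {k₀ : ℕ}

theorem isJointSubkernel_confinedKernel [MeasurableSpace E] [BorelSpace E] (hh : 0 ≤ h) :
    IsJointSubkernel α h (α.confinedKernel h a t k₀) where
  measurable k x y := by
    have h1 : Measurable fun q : Config d E × Config d E =>
        α.stepProb h (shift (-x) q.1) (y - x) :=
      (α.measurable_stepProb h (y - x)).comp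
        ((shift (-x)).continuous.measurable.comp measurable_fst)
    have h2 : Measurable fun q : Config d E × Config d E =>
        α.stepProb h (shift (-x) q.2) (y - x) :=
      (α.measurable_stepProb h (y - x)).comp
        ((shift (-x)).continuous.measurable.comp measurable_snd)
    unfold confinedKernel
    split_ifs
    · exact measurable_const
    · exact measurable_const
    · exact h1.min h2
    · exact measurable_const
  le₁ k x y η ξ := by
    unfold confinedKernel
    split_ifs with hk hy
    · rw [hy, sub_self, stepProb, if_pos rfl]
      refine le_add_of_le_right (ENNReal.ofReal_le_ofReal ?_)
      have := mul_le_mul_of_nonneg_left (α.tsum_rate_le (shift (-x) η)) hh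
      linarith
    · exact zero_le
    · exact min_le_left _ _
    · exact zero_le
  le₂ k x y η ξ := by
    unfold confinedKernel
    split_ifs with hk hy
    · rw [hy, sub_self, stepProb, if_pos rfl]
      refine le_add_of_le_right (ENNReal.ofReal_le_ofReal ?_)
      have := mul_le_mul_of_nonneg_left (α.tsum_rate_le (shift (-x) ξ)) hh
      linarith
    · exact zero_le
    · exact min_le_right _ _
    · exact zero_le

variable {W : Type*} {Y₁ Y₂ : ℕ → W → Config d E}

theorem subWalk_confinedKernel_of_le {k : ℕ} (hk : k ≤ k₀) (ω : W) (x : Site d) :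
    subWalk (α.confinedKernel h a t k₀) Y₁ Y₂ k ω x =
      if x = 0 then ENNReal.ofReal (1 - h * α.bound) ^ k else 0 := by
  induction k generalizing x with
  | zero => simp [subWalk]
  | succ k ih =>
    rw [subWalk, tsum_eq_single 0 fun y hy => by rw [ih (by omega), if_neg hy, zero_mul]]
    rw [ih (by omega), if_pos rfl, confinedKernel, if_pos (by omega), mul_ite, mul_zero, pow_succ]

theorem tsum_subWalk_confinedKernel_le [MeasurableSpace E] [BorelSpace E] (hh : 0 ≤ h)
    (hb : h * α.bound ≤ 1) (j : ℕ) (ω : W) :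
    ∑' x, subWalk (α.confinedKernel h a t k₀) Y₁ Y₂ (k₀ + j) ω x ≤
      ENNReal.ofReal (1 - h * α.bound) ^ k₀ := by
  induction j with
  | zero => simp [α.subWalk_confinedKernel_of_le]
  | succ j ih =>
    refine le_trans ?_ ih
    rw [tsum_subWalk_eq α hh hb (Y := Y₁) (k := k₀ + j) fun x y =>
      (α.isJointSubkernel_confinedKernel hh).le₁ _ x y _ _]
    exact le_self_add

/-- A single weight is bounded by the total mass after holding. This crude bound is independent of
the paths, so discrepancies of the environment can later be integrated site by site; it costs the
volume of the ball. -/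
theorem subWalk_confinedKernel_le [MeasurableSpace E] [BorelSpace E] (hh : 0 ≤ h)
    (hb : h * α.bound ≤ 1) (ha : 0 ≤ a) (j : ℕ) (ω : W) (x : Site d) :
    subWalk (α.confinedKernel h a t k₀) Y₁ Y₂ (k₀ + j) ω x ≤
      ENNReal.ofReal (1 - h * α.bound) ^ k₀ * if ‖x‖ ≤ 2 * (a * t (k₀ + j)) then 1 else 0 := by
  split_ifs with hx
  · rw [mul_one]
    exact (ENNReal.le_tsum x).trans (α.tsum_subWalk_confinedKernel_le hh hb j ω)
  · rw [mul_zero, nonpos_iff_eq_zero]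
    cases j with
    | zero =>
      rw [add_zero, α.subWalk_confinedKernel_of_le le_rfl, if_neg]
      rintro rfl
      rw [norm_zero] at hx
      exact hx (by positivity)
    | succ j =>
      rw [← add_assoc] at hx ⊢
      rw [subWalk, ENNReal.tsum_eq_zero]
      intro y
      rw [confinedKernel, if_neg (by omega), if_neg hx, mul_zero]

/-- The potential that controls the escape of the confined walk. -/
def confinedPotential (a : ℝ) (t : ℝ) (x : Site d) : ℝ≥0∞ :=
  ENNReal.ofReal (escape (a * t) ‖x‖) + ENNReal.ofReal (α.largeJump a (a * t))

/-- Mass is lost in two ways: the transition probabilities of the environments differ, or the common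
jump leaves the ball. The second loss is charged to the potential, which is at least `1` outside the
ball of twice the radius `a t`. -/
theorem one_add_tsum_confinedKernel_le (hh : 0 < h) (hb : h * α.bound ≤ 1) (ha : 0 < a)
    (hMa : α.moment ≤ a) {k : ℕ} (hk : k₀ ≤ k) (ht0 : 0 < t k) (ht : (t (k + 1) : ℝ) = t k + h)
    (x : Site d) (η ξ : Config d E) :
    1 + ∑' y, α.confinedKernel h a t k₀ k x y η ξ * α.confinedPotential a (t (k + 1)) y ≤
      ∑' y, α.confinedKernel h a t k₀ k x y η ξ + α.stepSep h (shift (-x) η) (shift (-x) ξ) +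
        α.confinedPotential a (t k) x := by
  have ht0' : (0 : ℝ) < t k := NNReal.coe_pos.2 ht0
  have hR' : 0 < a * t (k + 1) := by rw [ht]; positivity
  set p₁ : Site d → ℝ≥0∞ := fun y => α.stepProb h (shift (-x) η) (y - x)
  set p₂ : Site d → ℝ≥0∞ := fun y => α.stepProb h (shift (-x) ξ) (y - x)
  set m : Site d → ℝ≥0∞ := fun y => α.confinedKernel h a t k₀ k x y η ξ with hm
  have hmy : ∀ y, m y = if ‖y‖ ≤ 2 * (a * t (k + 1)) then min (p₁ y) (p₂ y) else 0 := fun y => by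
    simp only [hm, confinedKernel, if_neg (not_lt.2 hk)]
    rfl
  set Ψ : Site d → ℝ≥0∞ := fun y => ENNReal.ofReal (escape (a * t (k + 1)) ‖y‖)
  have hsep : 1 ≤ ∑' y, min (p₁ y) (p₂ y) + α.stepSep h (shift (-x) η) (shift (-x) ξ) := by
    have := α.one_le_tsum_min_add_stepSep hh.le hb (shift (-x) η) (shift (-x) ξ)
    rwa [← tsum_sub_site _ x] at this
  -- Inside the ball `Ψ ≤ 1`, so the truncation is inactive. Outside, `m` vanishes and the truncated
  -- potential equals `1`, which pays for the killed jump.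
  have hkill : ∑' y, min (p₁ y) (p₂ y) + ∑' y, m y * Ψ y ≤
      ∑' y, m y + ∑' y, p₁ y * min 1 (Ψ y) := by
    rw [← ENNReal.tsum_add, ← ENNReal.tsum_add]
    refine ENNReal.tsum_le_tsum fun y => ?_
    rw [hmy]
    by_cases hy : ‖y‖ ≤ 2 * (a * t (k + 1))
    · rw [if_pos hy, min_eq_right (a := (1 : ℝ≥0∞)) (ENNReal.ofReal_le_one.2 (escape_le_one hR' hy))]
      exact add_le_add le_rfl (mul_le_mul_left (min_le_left (p₁ y) (p₂ y)) _)
    · rw [if_neg hy, min_eq_left (a := (1 : ℝ≥0∞))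
        (ENNReal.one_le_ofReal.2 (one_le_escape hR' (not_le.1 hy).le))]
      simp
  have hm1 : ∑' y, m y ≤ 1 := by
    rw [← α.tsum_stepProb hh.le hb (shift (-x) η),
      ← tsum_sub_site (fun z => α.stepProb h (shift (-x) η) z) x]
    refine ENNReal.tsum_le_tsum fun y => ?_
    rw [hmy]
    split_ifs
    · exact min_le_left (p₁ y) (p₂ y)
    · exact zero_le
  have hpot := α.tsum_stepProb_mul_min_escape_le hh hb ha hMa ht0' (shift (-x) η) x
  rw [← ht] at hpot
  set L := ENNReal.ofReal (α.largeJump a (a * t (k + 1)))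
  calc 1 + ∑' y, m y * α.confinedPotential a (t (k + 1)) y
      = 1 + (∑' y, m y * Ψ y + (∑' y, m y) * L) := by
        rw [← ENNReal.tsum_mul_right, ← ENNReal.tsum_add]
        congr 1
        exact tsum_congr fun y => mul_add _ _ _
    _ ≤ (∑' y, min (p₁ y) (p₂ y) + α.stepSep h (shift (-x) η) (shift (-x) ξ)) +
        (∑' y, m y * Ψ y + 1 * L) := by gcongr
    _ = (∑' y, min (p₁ y) (p₂ y) + ∑' y, m y * Ψ y) +
        (α.stepSep h (shift (-x) η) (shift (-x) ξ) + L) := by ring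
    _ ≤ (∑' y, m y + ∑' y, p₁ y * min 1 (Ψ y)) +
        (α.stepSep h (shift (-x) η) (shift (-x) ξ) + L) := by gcongr
    _ = ∑' y, m y + α.stepSep h (shift (-x) η) (shift (-x) ξ) +
        (∑' y, p₁ y * min 1 (Ψ y) + L) := by ring
    _ ≤ _ := by
        unfold confinedPotential
        gcongr

/-- The mass of the confined walk, for a fixed pair of paths of the environment. -/
theorem le_tsum_subWalk_confinedKernel [MeasurableSpace E] [BorelSpace E] (hh : 0 < h)
    (hb : h * α.bound ≤ 1) (ha : 0 < a) (hMa : α.moment ≤ a) (ht0 : ∀ k, k₀ ≤ k → 0 < t k)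
    (ht : ∀ k, (t (k + 1) : ℝ) = t k + h) (n : ℕ) (ω : W) :
    ENNReal.ofReal (1 - h * α.bound) ^ k₀ ≤
      ∑' x, subWalk (α.confinedKernel h a t k₀) Y₁ Y₂ (k₀ + n) ω x +
      ∑ j ∈ Finset.range n, ∑' x, (ENNReal.ofReal (1 - h * α.bound) ^ k₀ *
        if ‖x‖ ≤ 2 * (a * t (k₀ + j)) then 1 else 0) *
          α.stepSep h (shift (-x) (Y₁ (k₀ + j) ω)) (shift (-x) (Y₂ (k₀ + j) ω)) +
      ENNReal.ofReal (1 - h * α.bound) ^ k₀ * ENNReal.ofReal (4 * α.moment / a) := by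
  set m := α.confinedKernel h a t k₀ with hm
  set β := ENNReal.ofReal (1 - h * α.bound) ^ k₀
  have hβ1 : ∀ j, ∑' x, subWalk m Y₁ Y₂ (k₀ + j) ω x ≠ ∞ := fun j =>
    ((α.tsum_subWalk_confinedKernel_le hh.le hb j ω).trans_lt
      (ENNReal.pow_lt_top ENNReal.ofReal_lt_top)).ne
  have hkey := tsum_add_tsum_mul_potential_le
    (v := fun j x => subWalk m Y₁ Y₂ (k₀ + j) ω x)
    (M := fun j x y => m (k₀ + j) x y (Y₁ (k₀ + j) ω) (Y₂ (k₀ + j) ω))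
    (fun j y => rfl)
    (Θ := fun j x => α.confinedPotential a (t (k₀ + j)) x)
    (sep := fun j x => α.stepSep h (shift (-x) (Y₁ (k₀ + j) ω)) (shift (-x) (Y₂ (k₀ + j) ω)))
    (fun j x => α.one_add_tsum_confinedKernel_le hh hb ha hMa (by omega) (ht0 _ (by omega)) (ht _)
      x _ _) hβ1 n
  have h0 : ∑' x, subWalk m Y₁ Y₂ (k₀ + 0) ω x = β := by
    simp [hm, α.subWalk_confinedKernel_of_le, β]
  have hR : 0 < a * t k₀ := mul_pos ha (NNReal.coe_pos.2 (ht0 k₀ le_rfl))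
  -- After holding, the walk is at the origin, where `escape` is zero; only `largeJump` contributes.
  have h1 : ∑' x, subWalk m Y₁ Y₂ (k₀ + 0) ω x * α.confinedPotential a (t (k₀ + 0)) x ≤
      β * ENNReal.ofReal (4 * α.moment / a) := by
    simp only [hm, add_zero, α.subWalk_confinedKernel_of_le le_rfl]
    rw [tsum_eq_single 0 fun x hx => by rw [if_neg hx, zero_mul], if_pos rfl, confinedPotential,
      norm_zero, escape_of_le hR.le, ENNReal.ofReal_zero, zero_add]
    gcongr
    exact α.largeJump_le ha hR
  rw [h0] at hkey
  refine le_self_add.trans (hkey.trans ?_)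
  gcongr with j _ x
  exact α.subWalk_confinedKernel_le hh.le hb ha.le j ω x

end JumpRates

end Confined

/-! ### Oscillation of the resolvent for general rates -/

section General

variable {d : ℕ} {E : Type*} [MetricSpace E] [CompactSpace E] [MeasurableSpace E] [BorelSpace E]
  {P : FellerProcess (Config d E)} {Q : EnvCoupling P}

theorem EnvCoupling.TranslationInvariant.lintegral_tsum_rateMap_le (hQ : Q.TranslationInvariant)
    (hE : ∀ a b : E, dist a b ≤ 1) (α : JumpRates d E) (η ξ : Config d E) (t : ℝ≥0) (x : Site d) :
    ∫⁻ ω, ∑' z, ‖α.rateMap z (shift (-x) (ω.1.1 t)) - α.rateMap z (shift (-x) (ω.2.1 t))‖ₑ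
      ∂(Q.law η ξ) ≤
      (∑' z, tripleNorm fun η => α.rate η z) * ENNReal.ofReal (Q.supDist t) := by
  have hmeas : ∀ z, Measurable fun ω : CadlagPath (Config d E) × CadlagPath (Config d E) =>
      ‖α.rateMap z (shift (-x) (ω.1.1 t)) - α.rateMap z (shift (-x) (ω.2.1 t))‖ₑ := fun z =>
    ((measurable_comp_eval measurable_fst (shiftOp (-x) (α.rateMap z)) t).sub
      (measurable_comp_eval measurable_snd (shiftOp (-x) (α.rateMap z)) t)).enorm
  rw [lintegral_tsum fun z => (hmeas z).aemeasurable, ← ENNReal.tsum_mul_right]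
  exact ENNReal.tsum_le_tsum fun z => hQ.lintegral_enorm_sub_le hE η ξ t x (α.rateMap z)

theorem tsum_norm_le_mul_le {a t : ℝ} (ha : 0 ≤ a) (ht : 1 ≤ t) :
    ∑' x : Site d, (if ‖x‖ ≤ 2 * (a * t) then 1 else 0 : ℝ≥0∞) ≤
      ENNReal.ofReal ((4 * a + 1) ^ d) * ENNReal.ofReal (t ^ d) := by
  refine (tsum_norm_le_le d (by positivity)).trans ?_
  rw [← ENNReal.ofReal_mul (by positivity), ← mul_pow]
  refine ENNReal.ofReal_le_ofReal ?_
  gcongr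
  linarith

/-- The expected mass of the confined walk. -/
theorem EnvCoupling.TranslationInvariant.le_subWalkMass_confinedKernel
    (hQ : Q.TranslationInvariant) (hE : ∀ a b : E, dist a b ≤ 1) (α : JumpRates d E) {h u : ℝ≥0}
    {a : ℝ} (hh : 0 < h) (hb : h * α.bound ≤ 1) (ha : 0 < a) (hMa : α.moment ≤ a) {k₀ : ℕ}
    (ht : ∀ k, k₀ ≤ k → 1 ≤ u + k * h) (η ξ : Config d E) (n : ℕ) :
    ENNReal.ofReal (1 - h * α.bound) ^ k₀ ≤
      subWalkMass (Q.law η ξ) (α.confinedKernel h a (fun k => u + k * h) k₀)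
        (fun k ω => ω.1.1 (u + k * h)) (fun k ω => ω.2.1 (u + k * h)) (k₀ + n) +
      ENNReal.ofReal (1 - h * α.bound) ^ k₀ *
        (2 * (∑' z, tripleNorm fun η => α.rate η z) * ENNReal.ofReal ((4 * a + 1) ^ d) *
          ∑ j ∈ Finset.range n, ENNReal.ofReal h *
            ENNReal.ofReal ((u + (k₀ + j : ℕ) * h : ℝ≥0) ^ d * Q.supDist (u + (k₀ + j : ℕ) * h))) +
      ENNReal.ofReal (1 - h * α.bound) ^ k₀ * ENNReal.ofReal (4 * α.moment / a) := by
  have := Q.isProbabilityMeasure η ξ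
  have hh' : (0 : ℝ) < h := NNReal.coe_pos.2 hh
  set β := ENNReal.ofReal (1 - h * α.bound) ^ k₀
  set t : ℕ → ℝ≥0 := fun k => u + k * h with ht_def
  set Y₁ : ℕ → CadlagPath (Config d E) × CadlagPath (Config d E) → Config d E :=
    fun k ω => ω.1.1 (t k)
  set Y₂ : ℕ → CadlagPath (Config d E) × CadlagPath (Config d E) → Config d E :=
    fun k ω => ω.2.1 (t k)
  set m := α.confinedKernel h a t k₀ with hm
  set D : ℕ → Site d → CadlagPath (Config d E) × CadlagPath (Config d E) → ℝ≥0∞ := fun k x ω =>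
    ∑' z, ‖α.rateMap z (shift (-x) (Y₁ k ω)) - α.rateMap z (shift (-x) (Y₂ k ω))‖ₑ
  set B := ∑' z, tripleNorm fun η => α.rate η z
  set w : ℕ → Site d → ℝ≥0∞ := fun k x => if ‖x‖ ≤ 2 * (a * t k) then 1 else 0
  have hY₁ : ∀ k, Measurable (Y₁ k) := fun k => (CadlagPath.measurable_eval _).comp measurable_fst
  have hY₂ : ∀ k, Measurable (Y₂ k) := fun k => (CadlagPath.measurable_eval _).comp measurable_snd
  have hD : ∀ k x, Measurable (D k x) := fun k x => Measurable.tsum fun z =>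
    ((measurable_comp_eval measurable_fst (shiftOp (-x) (α.rateMap z)) (t k)).sub
      (measurable_comp_eval measurable_snd (shiftOp (-x) (α.rateMap z)) (t k))).enorm
  have hpt : ∀ ω, β ≤ ∑' x, subWalk m Y₁ Y₂ (k₀ + n) ω x +
      (∑ j ∈ Finset.range n, ∑' x, (β * w (k₀ + j) x * (2 * ENNReal.ofReal h)) * D (k₀ + j) x ω +
      β * ENNReal.ofReal (4 * α.moment / a)) := fun ω => by
    refine (α.le_tsum_subWalk_confinedKernel (Y₁ := Y₁) (Y₂ := Y₂) (t := t) hh' hb ha hMa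
      (fun k hk => zero_lt_one.trans_le (ht k hk)) (fun k => ?_) n ω).trans ?_
    · simp only [ht_def]
      push_cast
      ring
    · rw [add_assoc]
      refine add_le_add le_rfl (add_le_add (Finset.sum_le_sum fun j _ =>
        ENNReal.tsum_le_tsum fun x => ?_) le_rfl)
      rw [mul_assoc (β * w (k₀ + j) x)]
      exact mul_le_mul_right (α.stepSep_le hh'.le _ _) _
  have hsub : Measurable fun ω => ∑' x, subWalk m Y₁ Y₂ (k₀ + n) ω x :=
    Measurable.tsum fun x => measurable_subWalk
      (α.isJointSubkernel_confinedKernel hh'.le).measurable _ (fun j _ => hY₁ j) (fun j _ => hY₂ j) x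
  have hint := lintegral_mono (μ := Q.law η ξ) hpt
  rw [lintegral_const, measure_univ, mul_one, lintegral_add_left hsub,
    lintegral_add_right _ measurable_const, lintegral_const, measure_univ, mul_one,
    lintegral_finsetSum _ fun j _ => Measurable.tsum fun x => (hD _ x).const_mul _,
    ← add_assoc] at hint
  refine hint.trans (add_le_add (add_le_add le_rfl ?_) le_rfl)
  rw [Finset.mul_sum, Finset.mul_sum]
  refine Finset.sum_le_sum fun j _ => ?_
  have ht1 : (1 : ℝ) ≤ t (k₀ + j) := by exact_mod_cast ht (k₀ + j) (by omega)
  rw [lintegral_tsum fun x => ((hD _ x).const_mul _).aemeasurable]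
  calc ∑' x, ∫⁻ ω, β * w (k₀ + j) x * (2 * ENNReal.ofReal h) * D (k₀ + j) x ω ∂(Q.law η ξ)
      ≤ ∑' x, β * w (k₀ + j) x * (2 * ENNReal.ofReal h) *
          (B * ENNReal.ofReal (Q.supDist (t (k₀ + j)))) := by
        refine ENNReal.tsum_le_tsum fun x => ?_
        rw [lintegral_const_mul _ (hD _ x)]
        gcongr
        exact hQ.lintegral_tsum_rateMap_le hE α η ξ (t (k₀ + j)) x
    _ = (∑' x, w (k₀ + j) x) * (β * (2 * ENNReal.ofReal h) *
          (B * ENNReal.ofReal (Q.supDist (t (k₀ + j))))) := by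
        rw [← ENNReal.tsum_mul_right (f := w (k₀ + j))]
        exact tsum_congr fun x => by ring
    _ ≤ (ENNReal.ofReal ((4 * a + 1) ^ d) * ENNReal.ofReal ((t (k₀ + j) : ℝ) ^ d)) *
          (β * (2 * ENNReal.ofReal h) * (B * ENNReal.ofReal (Q.supDist (t (k₀ + j))))) := by
        gcongr
        exact tsum_norm_le_mul_le ha.le ht1
    _ = _ := by
        rw [ENNReal.ofReal_mul (by positivity : (0 : ℝ) ≤ ((u + (k₀ + j : ℕ) * h : ℝ≥0) : ℝ) ^ d)]
        ring

/-- During holding the walk occupies one site and `g ≤ 1` is enough; afterwards the volume of the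
ball contributes the factor `t^d`. -/
theorem EnvCoupling.TranslationInvariant.subWalkGap_confinedKernel_le
    (hQ : Q.TranslationInvariant) (hE : ∀ a b : E, dist a b ≤ 1) (α : JumpRates d E) {h u : ℝ≥0}
    {a : ℝ} (hb : h * α.bound ≤ 1) (ha : 0 < a) {k₀ : ℕ}
    (ht : ∀ k, k₀ ≤ k → 1 ≤ u + k * h) (η ξ : Config d E) (f : C(Config d E, ℝ)) (k : ℕ) :
    subWalkGap (Q.law η ξ) (α.confinedKernel h a (fun k => u + k * h) k₀)
        (fun k ω => ω.1.1 (u + k * h)) (fun k ω => ω.2.1 (u + k * h)) f k ≤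
      if k < k₀ then tripleNorm f else tripleNorm f * (ENNReal.ofReal ((4 * a + 1) ^ d) *
        ENNReal.ofReal ((u + k * h : ℝ≥0) ^ d * Q.supDist (u + k * h))) := by
  have hh' : (0 : ℝ) ≤ h := h.2
  have hle1 : ENNReal.ofReal (1 - h * α.bound) ≤ 1 := by
    rw [ENNReal.ofReal_le_one]
    have := mul_nonneg hh' α.bound_nonneg
    linarith
  split_ifs with hk
  · refine (hQ.subWalkGap_le hE η ξ (fun k => u + k * h) f (w := fun x => if x = 0 then 1 else 0)
      fun ω x => ?_).trans ?_
    · rw [α.subWalk_confinedKernel_of_le hk.le]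
      split_ifs
      · exact pow_le_one' hle1 k
      · exact le_rfl
    · rw [tsum_ite_eq, one_mul]
      exact mul_le_of_le_one_right' (ENNReal.ofReal_le_one.2 (Q.supDist_le_one hE _))
  · obtain ⟨j, rfl⟩ := Nat.exists_eq_add_of_le (not_lt.1 hk)
    have ht1 : (1 : ℝ) ≤ (u + (k₀ + j : ℕ) * h : ℝ≥0) := by exact_mod_cast ht (k₀ + j) (by omega)
    refine (hQ.subWalkGap_le hE η ξ (fun k => u + k * h) f
      (w := fun x => if ‖x‖ ≤ 2 * (a * (u + (k₀ + j : ℕ) * h : ℝ≥0)) then 1 else 0)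
      fun ω x => ?_).trans ?_
    · exact (α.subWalk_confinedKernel_le hh' hb ha.le j ω x).trans
        (mul_le_of_le_one_left' (pow_le_one' hle1 k₀))
    · refine (mul_le_mul_left (tsum_norm_le_mul_le ha.le ht1) _).trans (le_of_eq ?_)
      rw [ENNReal.ofReal_mul (by positivity : (0 : ℝ) ≤ ((u + (k₀ + j : ℕ) * h : ℝ≥0) : ℝ) ^ d)]
      ring

/-- Dominated convergence for the tail of `∫ t^d g(t) dt`. Requiring `N ≥ 1` later allows the volume
of the ball to be bounded by a multiple of `t^d`. -/
theorem EnvCoupling.exists_tail_le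
    (hQd : IntegrableOn (fun t : ℝ => t ^ d * Q.supDist t.toNNReal) (Ioi 0)) {δ : ℝ} (hδ : 0 < δ) :
    ∃ N : ℕ, 1 ≤ N ∧
      AEMeasurable (fun t : ℝ => if (N : ℝ≥0) ≤ t.toNNReal then
        ENNReal.ofReal ((t.toNNReal : ℝ) ^ d * Q.supDist t.toNNReal) else 0)
        (volume.restrict (Ioi 0)) ∧
      ∫⁻ t in Ioi (0 : ℝ), (if (N : ℝ≥0) ≤ t.toNNReal then
        ENNReal.ofReal ((t.toNNReal : ℝ) ^ d * Q.supDist t.toNNReal) else 0) ≤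
        ENNReal.ofReal δ := by
  have h0 : AEMeasurable (fun t : ℝ => ENNReal.ofReal ((t.toNNReal : ℝ) ^ d * Q.supDist t.toNNReal))
      (volume.restrict (Ioi 0)) := by
    refine hQd.aemeasurable.ennreal_ofReal.congr
      ((ae_restrict_iff' measurableSet_Ioi).2 (Eventually.of_forall fun t ht => ?_))
    simp only [Real.coe_toNNReal t (le_of_lt ht)]
  have hm : ∀ N : ℕ, AEMeasurable (fun t : ℝ => if (N : ℝ≥0) ≤ t.toNNReal then
      ENNReal.ofReal ((t.toNNReal : ℝ) ^ d * Q.supDist t.toNNReal) else 0)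
      (volume.restrict (Ioi 0)) := fun N => by
    have hs : MeasurableSet {t : ℝ | (N : ℝ≥0) ≤ t.toNNReal} :=
      measurableSet_le measurable_const measurable_real_toNNReal
    exact (h0.indicator hs).congr (Eventually.of_forall fun t => rfl)
  have hlim := tendsto_lintegral_of_dominated_convergence' (μ := volume.restrict (Ioi (0 : ℝ)))
    (F := fun (N : ℕ) (t : ℝ) => if (N : ℝ≥0) ≤ t.toNNReal then
      ENNReal.ofReal ((t.toNNReal : ℝ) ^ d * Q.supDist t.toNNReal) else 0) (f := fun _ => 0)
    (fun t => ENNReal.ofReal ((t.toNNReal : ℝ) ^ d * Q.supDist t.toNNReal)) hm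
    (fun N => Eventually.of_forall fun t => by
      simp only []
      split_ifs
      · exact le_rfl
      · exact zero_le)
    (by
      have := hQd.lintegral_lt_top
      refine ne_of_lt (lt_of_le_of_lt (le_of_eq ?_) this)
      refine lintegral_congr_ae ((ae_restrict_iff' measurableSet_Ioi).2
        (Eventually.of_forall fun t ht => ?_))
      simp only [Real.coe_toNNReal t (le_of_lt ht)])
    (Eventually.of_forall fun t => by
      refine tendsto_const_nhds.congr' ?_
      obtain ⟨N, hN⟩ := exists_nat_gt t.toNNReal
      filter_upwards [eventually_ge_atTop N] with n hn
      rw [if_neg]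
      rw [not_le]
      exact hN.trans_le (by exact_mod_cast hn))
  rw [lintegral_zero] at hlim
  obtain ⟨N, hN, hN1⟩ := ((hlim.eventually (Iio_mem_nhds (ENNReal.ofReal_pos.2 hδ))).and
    (eventually_ge_atTop 1)).exists
  exact ⟨N, hN1, hm N, le_of_lt hN⟩

theorem exp_le_one_sub {x : ℝ} (hx : 0 ≤ x) (hx2 : x ≤ 1 / 2) : Real.exp (-(2 * x)) ≤ 1 - x := by
  have hpos : 0 < 1 - x := by linarith
  rw [← Real.le_log_iff_exp_le hpos]
  refine le_trans ?_ (Real.one_sub_inv_le_log_of_pos hpos)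
  have : (1 - x)⁻¹ ≤ 1 + 2 * x := by
    rw [inv_le_iff_one_le_mul₀ hpos]
    nlinarith
  linarith

/-- The oscillation of the resolvent of the environment process: `p` is a lower bound for the
probability that two walkers in coupled environments jump together forever. -/
theorem exists_resolvent_sub_le [Nonempty E] (hE : ∀ a b : E, dist a b ≤ 1)
    (hP : P.TranslationInvariant) (hQ : Q.TranslationInvariant) (hQM : Q.StrongMarginalMarkov)
    (hQd : IntegrableOn (fun t : ℝ => t ^ d * Q.supDist t.toNNReal) (Ioi 0)) (α : JumpRates d E) :
    ∃ C p : ℝ, 0 < C ∧ 0 < p ∧ p < 1 ∧ ∀ (f G : C(Config d E, ℝ)) (ε : ℝ), tripleNorm f < ∞ →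
      0 < ε → P.semigroup.HasGenerator G (ε • G - f - α.jumpOp G) → ∀ η ξ,
        G η - G ξ ≤ C / p * (tripleNorm f).toReal := by
  have hM0 := α.moment_nonneg
  -- The speed is chosen so that escape from the ball costs at most a quarter of the mass left after
  -- holding.
  set a : ℝ := 16 * (α.moment + 1) with ha_def
  have ha : 0 < a := by positivity
  have hMa : α.moment ≤ a := by linarith
  have hMa4 : 4 * α.moment / a ≤ 1 / 4 := by
    rw [div_le_div_iff₀ ha (by norm_num)]
    linarith
  set B : ℝ := (∑' z, tripleNorm fun η => α.rate η z).toReal with hB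
  have hB0 : 0 ≤ B := ENNReal.toReal_nonneg
  have hBe : ∑' z, tripleNorm (fun η => α.rate η z) = ENNReal.ofReal B :=
    (ENNReal.ofReal_toReal α.sensitivity.ne).symm
  set c : ℝ := (4 * a + 1) ^ d with hc
  have hc1 : 1 ≤ c := one_le_pow₀ (by linarith)
  -- The tail bound is chosen so that differing rates cost at most another quarter, and so that gaps
  -- after time `N` add at most `1` to the constant.
  set δ : ℝ := 1 / (4 * (2 * B + 1) * c) with hδ_def
  have hδ : 0 < δ := by positivity
  have hBcδ : 2 * B * c * δ ≤ 1 / 4 := by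
    rw [hδ_def, mul_one_div, div_le_div_iff₀ (by positivity) (by norm_num)]
    nlinarith
  have hcδ : c * δ ≤ 1 := by
    rw [hδ_def, mul_one_div, div_le_one (by positivity)]
    nlinarith
  obtain ⟨N, hN1, hNm, hNle⟩ := EnvCoupling.exists_tail_le hQd hδ
  set φ : ℝ≥0 → ℝ≥0∞ := fun t => if (N : ℝ≥0) ≤ t then
    ENNReal.ofReal ((t : ℝ) ^ d * Q.supDist t) else 0 with hφ
  -- The exponential bounds the holding probability from below, using `1 - x ≥ e^{-2x}` and holding
  -- time at most `N + 1`; the factor `1 / 2` is what survives the two losses of a quarter.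
  set p : ℝ := Real.exp (-(2 * α.bound * (N + 1))) / 2 with hp_def
  have hp : 0 < p := by positivity
  have hp1 : p < 1 := by
    have : Real.exp (-(2 * α.bound * (N + 1))) ≤ 1 := by
      rw [Real.exp_le_one_iff]
      have := α.bound_nonneg
      have : 0 ≤ 2 * α.bound * (N + 1) := by positivity
      linarith
    linarith
  -- `N + 1` bounds the holding time, during which the gap is at most `|||f|||`; the remaining `1`
  -- bounds the contribution of all later gaps.
  refine ⟨N + 2, p, by positivity, hp, hp1, fun f G ε hf hε hG η ξ => ?_⟩
  have hmain := resolvent_sub_le hP hQM α (f := f) (A := (N + 2) * (tripleNorm f).toReal) (p := p)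
    (by positivity) hp hp1.le ?_ hε hG η ξ
  · rwa [mul_div_right_comm] at hmain
  have hbound : ∀ᶠ h : ℝ≥0 in 𝓝[>] 0, (h : ℝ) * α.bound < 1 / 2 := by
    refine nhdsWithin_le_nhds ?_
    have h1 : Continuous fun h : ℝ≥0 => (h : ℝ) * α.bound := by fun_prop
    exact (h1.tendsto 0).eventually (Iio_mem_nhds (by simp))
  filter_upwards [hbound, self_mem_nhdsWithin, nhdsWithin_le_nhds (Iio_mem_nhds one_pos)]
    with h hb hh hh1
  have hh' : (0 : ℝ) < h := NNReal.coe_pos.2 hh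
  have hb1 : h * α.bound ≤ 1 := by linarith
  obtain ⟨u, hu, hsum⟩ := exists_riemann_sum_le (φ := φ) hNm hh
  replace hsum := hsum.trans hNle
  set k₀ : ℕ := ⌈(N : ℝ) / h⌉₊ with hk₀
  have hk₀N : (N : ℝ) ≤ k₀ * h := by
    have := Nat.le_ceil ((N : ℝ) / h)
    exact (div_le_iff₀ hh').1 this
  have hk₀h : k₀ * (h : ℝ) ≤ N + 1 := by
    have h1 := (Nat.ceil_lt_add_one (by positivity : 0 ≤ (N : ℝ) / h)).le
    have h2 := mul_le_mul_of_nonneg_right h1 hh'.le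
    rw [add_mul, div_mul_cancel₀ _ hh'.ne', one_mul] at h2
    have h3 : (h : ℝ) < 1 := by exact_mod_cast hh1
    linarith
  have htN : ∀ k, k₀ ≤ k → (N : ℝ≥0) ≤ u + k * h := fun k hk => by
    rw [← NNReal.coe_le_coe]
    push_cast
    have h1 : (k₀ : ℝ) ≤ k := by exact_mod_cast hk
    have h2 := mul_le_mul_of_nonneg_right h1 hh'.le
    have h3 : (0 : ℝ) ≤ u := u.2
    linarith
  have ht1 : ∀ k, k₀ ≤ k → 1 ≤ u + k * h := fun k hk =>
    le_trans (by exact_mod_cast hN1) (htN k hk)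
  have hφk : ∀ k, k₀ ≤ k → ENNReal.ofReal ((u + k * h : ℝ≥0) ^ d * Q.supDist (u + k * h)) =
      φ (u + k * h) := fun k hk => by rw [hφ]; simp only [if_pos (htN k hk)]
  refine ⟨u, hu, α.confinedKernel h a (fun k => u + k * h) k₀,
    α.isJointSubkernel_confinedKernel hh'.le, fun η ξ n => ⟨?_, ?_⟩⟩
  · calc _ ≤ ∑ k ∈ Finset.range n, (tripleNorm f * (if k < k₀ then ENNReal.ofReal h else 0) +
          tripleNorm f * ENNReal.ofReal c * (ENNReal.ofReal h * φ (u + k * h))) := by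
          refine Finset.sum_le_sum fun k _ => ?_
          have h1 := hQ.subWalkGap_confinedKernel_le hE α hb1 ha ht1 η ξ f k
          refine (mul_le_mul_right h1 _).trans ?_
          split_ifs with hk
          · rw [mul_comm]
            exact le_self_add
          · rw [hφk k (not_lt.1 hk), mul_zero, zero_add]
            exact le_of_eq (by ring)
      _ ≤ tripleNorm f * (k₀ * ENNReal.ofReal h) +
          tripleNorm f * ENNReal.ofReal c * ENNReal.ofReal δ := by
          rw [Finset.sum_add_distrib, ← Finset.mul_sum, ← Finset.mul_sum, ← Finset.mul_sum]
          gcongr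
          · rw [← Finset.sum_filter, Finset.sum_const, nsmul_eq_mul]
            gcongr
            calc _ ≤ (Finset.range k₀).card := Finset.card_le_card fun k hk => by
                  simpa using (Finset.mem_filter.1 hk).2
              _ = k₀ := Finset.card_range k₀
          · exact le_trans (mul_le_mul_right (ENNReal.sum_le_tsum _) _) hsum
      _ = tripleNorm f * ENNReal.ofReal (k₀ * h + c * δ) := by
          rw [ENNReal.ofReal_add (by positivity) (by positivity), ENNReal.ofReal_mul (by positivity),
            ENNReal.ofReal_mul (by positivity), ENNReal.ofReal_natCast]
          ring
      _ ≤ _ := by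
          rw [mul_comm (N + 2 : ℝ), ENNReal.ofReal_mul ENNReal.toReal_nonneg,
            ENNReal.ofReal_toReal hf.ne]
          exact mul_le_mul_right (ENNReal.ofReal_le_ofReal (by linarith)) _
  · have hβp : ENNReal.ofReal p + ENNReal.ofReal p ≤ ENNReal.ofReal (1 - h * α.bound) ^ k₀ := by
      rw [← ENNReal.ofReal_pow (by linarith), ← ENNReal.ofReal_add hp.le hp.le]
      refine ENNReal.ofReal_le_ofReal ?_
      have h1 := exp_le_one_sub (mul_nonneg hh'.le α.bound_nonneg) hb.le
      calc p + p = Real.exp (-(2 * α.bound * (N + 1))) := by rw [hp_def]; ring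
        _ ≤ Real.exp (-(2 * α.bound * (k₀ * h))) := by
            have := α.bound_nonneg
            gcongr
        _ = Real.exp (-(2 * (h * α.bound))) ^ k₀ := by
            rw [← Real.exp_nat_mul]
            congr 1
            ring
        _ ≤ _ := by gcongr
    have hp_le : ENNReal.ofReal p ≤ ENNReal.ofReal (1 - h * α.bound) ^ k₀ := le_self_add.trans hβp
    have := Q.isProbabilityMeasure η ξ
    rcases le_total n k₀ with hn | hn
    · have h1 : subWalkMass (Q.law η ξ) (α.confinedKernel h a (fun k => u + k * h) k₀)
          (fun k ω => ω.1.1 (u + k * h)) (fun k ω => ω.2.1 (u + k * h)) n =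
          ENNReal.ofReal (1 - h * α.bound) ^ n := by
        simp [subWalkMass, α.subWalk_confinedKernel_of_le hn]
      rw [h1]
      refine hp_le.trans (pow_le_pow_right_of_le_one' ?_ hn)
      rw [ENNReal.ofReal_le_one]
      have := mul_nonneg hh'.le α.bound_nonneg
      linarith
    · obtain ⟨j, rfl⟩ := Nat.exists_eq_add_of_le hn
      have h1 := hQ.le_subWalkMass_confinedKernel hE α hh hb1 ha hMa ht1 η ξ j
      set β := ENNReal.ofReal (1 - h * α.bound) ^ k₀ with hβ
      have h2 : ∑ i ∈ Finset.range j, ENNReal.ofReal h *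
          ENNReal.ofReal ((u + (k₀ + i : ℕ) * h : ℝ≥0) ^ d * Q.supDist (u + (k₀ + i : ℕ) * h)) ≤
          ENNReal.ofReal δ := by
        refine le_trans ?_ hsum
        rw [← Finset.mul_sum]
        gcongr
        calc _ = ∑ i ∈ Finset.range j, φ (u + (k₀ + i : ℕ) * h) :=
              Finset.sum_congr rfl fun i _ => hφk _ (by omega)
          _ ≤ ∑' i : ℕ, φ (u + (k₀ + i : ℕ) * h) := ENNReal.sum_le_tsum _
          _ ≤ _ := ENNReal.tsum_comp_le_tsum_of_injective (add_right_injective k₀)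
              fun k : ℕ => φ (u + k * h)
      have h3 : 2 * (∑' z, tripleNorm fun η => α.rate η z) * ENNReal.ofReal c *
          ENNReal.ofReal δ ≤ ENNReal.ofReal (1 / 4) := by
        rw [hBe, show (2 : ℝ≥0∞) = ENNReal.ofReal 2 by simp, ← ENNReal.ofReal_mul (by positivity),
          ← ENNReal.ofReal_mul (by positivity), ← ENNReal.ofReal_mul (by positivity)]
        exact ENNReal.ofReal_le_ofReal hBcδ
      have hβtop : β ≠ ∞ := ENNReal.pow_ne_top ENNReal.ofReal_ne_top
      -- The losses through differing rates and through escape are each at most `β / 4`.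
      have h4 : β ≤ subWalkMass (Q.law η ξ) (α.confinedKernel h a (fun k => u + k * h) k₀)
          (fun k ω => ω.1.1 (u + k * h)) (fun k ω => ω.2.1 (u + k * h)) (k₀ + j) +
          β * ENNReal.ofReal (1 / 2) := by
        refine h1.trans ?_
        rw [add_assoc, ← mul_add, show (1 / 2 : ℝ) = 1 / 4 + 1 / 4 by norm_num,
          ENNReal.ofReal_add (by norm_num) (by norm_num)]
        gcongr
        exact le_trans (mul_le_mul_right h2 _) h3
      have h5 : β = β * ENNReal.ofReal (1 / 2) + β * ENNReal.ofReal (1 / 2) := by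
        rw [← mul_add, ← ENNReal.ofReal_add (by norm_num) (by norm_num)]
        norm_num
      have h6 : β * ENNReal.ofReal (1 / 2) ≤ _ := (ENNReal.add_le_add_iff_right
        (ENNReal.mul_ne_top hβtop ENNReal.ofReal_ne_top)).1 (h5.symm.le.trans h4)
      refine le_trans ?_ h6
      calc ENNReal.ofReal p = (ENNReal.ofReal p + ENNReal.ofReal p) * ENNReal.ofReal (1 / 2) := by
            rw [← ENNReal.ofReal_add hp.le hp.le, ← ENNReal.ofReal_mul (by positivity)]
            congr 1
            ring
        _ ≤ _ := by gcongr

end General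

/-! ### Comparison of invariant measures -/

section Comparison

variable {d : ℕ} {E : Type*} [MetricSpace E] [CompactSpace E]

theorem JumpRates.dist0_self (α : JumpRates d E) : α.dist0 α = 0 := by
  simp [JumpRates.dist0, rateMoment]

/-- The jump operators see `G` only through its differences, so the oscillation of `G` suffices; its
norm would blow up as `ε → 0`. -/
theorem JumpRates.enorm_jumpOp_sub_le (α α' : JumpRates d E) {G : C(Config d E, ℝ)} {A : ℝ}
    (hG : ∀ η ξ, G η - G ξ ≤ A) (η : Config d E) :
    ‖α.jumpOp G η - α'.jumpOp G η‖ₑ ≤ α.dist0 α' * ENNReal.ofReal A := by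
  rw [← ((α.hasSum_jumpOp G η).sub (α'.hasSum_jumpOp G η)).tsum_eq]
  refine enorm_tsum_le_tsum_enorm.trans ?_
  rw [JumpRates.dist0, rateMoment, ← ENNReal.tsum_mul_right]
  refine ENNReal.tsum_le_tsum fun z => ?_
  rw [← sub_mul, enorm_mul, pow_zero, one_mul]
  refine mul_le_mul' (le_iSup (fun η => ‖α.rate η z - α'.rate η z‖ₑ) η) ?_
  rw [Real.enorm_eq_ofReal_abs]
  exact ENNReal.ofReal_le_ofReal (abs_sub_le_iff.2 ⟨hG _ _, hG _ _⟩)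

variable [MeasurableSpace E] [BorelSpace E]

theorem abs_integral_sub_integral_le {μ ν : ProbabilityMeasure (Config d E)}
    {G : C(Config d E, ℝ)} {A : ℝ} (hG : ∀ η ξ, G η - G ξ ≤ A) :
    |∫ η, G η ∂(μ : Measure (Config d E)) - ∫ η, G η ∂(ν : Measure (Config d E))| ≤ A := by
  have h : ∀ μ ν : ProbabilityMeasure (Config d E),
      ∫ η, G η ∂(μ : Measure (Config d E)) - ∫ η, G η ∂(ν : Measure (Config d E)) ≤ A := by
    intro μ ν
    have h1 : ∀ ξ, ∫ η, G η ∂(μ : Measure (Config d E)) - A ≤ G ξ := fun ξ => by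
      have := integral_mono (μ := (μ : Measure (Config d E))) (integrable_of_continuous G)
        (integrable_const (G ξ + A)) fun η => by linarith [hG η ξ]
      simp only [integral_const, probReal_univ, one_smul] at this
      linarith
    have h2 := integral_mono (μ := (ν : Measure (Config d E))) (integrable_const _)
      (integrable_of_continuous G) h1
    simp only [integral_const, probReal_univ, one_smul] at h2
    linarith
  exact abs_sub_le_iff.2 ⟨h μ ν, h ν μ⟩

variable {P : FellerProcess (Config d E)}

/-- Invariant measures for different rates, compared by means of the resolvent for one of them. -/
theorem ofReal_abs_integral_sub_le {α α' : JumpRates d E} {μ ν : ProbabilityMeasure (Config d E)}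
    (hμ : IsEnvProcessInvariant P α μ) (hν : IsEnvProcessInvariant P α' ν) {K : ℝ} (hK : 0 ≤ K)
    {f : C(Config d E, ℝ)} (hf : tripleNorm f < ∞)
    (hKf : ∀ (G : C(Config d E, ℝ)) (ε : ℝ), 0 < ε →
      P.semigroup.HasGenerator G (ε • G - f - α.jumpOp G) →
        ∀ η ξ, G η - G ξ ≤ K * (tripleNorm f).toReal) :
    ENNReal.ofReal |∫ η, f η ∂(μ : Measure (Config d E)) - ∫ η, f η ∂(ν : Measure (Config d E))| ≤
      ENNReal.ofReal K * α.dist0 α' * tripleNorm f := by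
  obtain ⟨T, hT, hμ⟩ := hμ
  obtain ⟨T', hT', hν⟩ := hν
  rw [isEnvProcessSemigroup_iff] at hT hT'
  set A := K * (tripleNorm f).toReal with hA
  have hA0 : 0 ≤ A := by positivity
  have key : ∀ ε : ℝ, 0 < ε → ENNReal.ofReal |∫ η, f η ∂(μ : Measure (Config d E)) -
      ∫ η, f η ∂(ν : Measure (Config d E))| ≤
      ENNReal.ofReal (ε * A) + α.dist0 α' * ENNReal.ofReal A := by
    intro ε hε
    obtain ⟨G, hG⟩ := T.exists_resolvent hε f
    have hS := (hT _ _).1 hG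
    have hosc := hKf G ε hε hS
    have hG' : T'.HasGenerator G (ε • G - f - α.jumpOp G + α'.jumpOp G) :=
      (hT' _ _).2 (by rwa [add_sub_cancel_right])
    have i : ∀ (ρ : ProbabilityMeasure (Config d E)) (g : C(Config d E, ℝ)),
        Integrable g (ρ : Measure (Config d E)) := fun ρ g => integrable_of_continuous g
    have h1 := hμ.integral_generator hG
    have h2 := hν.integral_generator hG'
    have h1' : ε * ∫ η, G η ∂(μ : Measure (Config d E)) -
        ∫ η, f η ∂(μ : Measure (Config d E)) = 0 := by
      rw [← integral_const_mul, ← integral_sub ((i μ G).const_mul ε) (i μ f)]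
      exact h1
    have h2' : ε * ∫ η, G η ∂(ν : Measure (Config d E)) - ∫ η, f η ∂(ν : Measure (Config d E)) -
        ∫ η, (α.jumpOp G - α'.jumpOp G) η ∂(ν : Measure (Config d E)) = 0 := by
      rw [← integral_const_mul, ← integral_sub ((i ν G).const_mul ε) (i ν f),
        ← integral_sub (f := fun η => ε * G η - f η) (((i ν G).const_mul ε).sub (i ν f)) (i ν _),
        ← h2]
      refine integral_congr_ae (Eventually.of_forall fun η => ?_)
      change ε * G η - f η - (α.jumpOp G η - α'.jumpOp G η) =
        ε * G η - f η - α.jumpOp G η + α'.jumpOp G η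
      ring
    -- The difference of the two stationarity identities. The first term vanishes as `ε → 0`, since
    -- the oscillation of `G` is bounded uniformly in `ε`.
    have e : ∫ η, f η ∂(μ : Measure (Config d E)) - ∫ η, f η ∂(ν : Measure (Config d E)) =
        ε * (∫ η, G η ∂(μ : Measure (Config d E)) - ∫ η, G η ∂(ν : Measure (Config d E))) +
        ∫ η, (α.jumpOp G - α'.jumpOp G) η ∂(ν : Measure (Config d E)) := by linarith
    rw [e, ← Real.enorm_eq_ofReal_abs]
    refine (enorm_add_le _ _).trans (add_le_add ?_ ?_)
    · rw [Real.enorm_eq_ofReal_abs, abs_mul, abs_of_pos hε]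
      exact ENNReal.ofReal_le_ofReal
        (mul_le_mul_of_nonneg_left (abs_integral_sub_integral_le hosc) hε.le)
    · refine (enorm_integral_le_lintegral_enorm _).trans ?_
      refine (lintegral_mono fun η => α.enorm_jumpOp_sub_le α' hosc η).trans ?_
      rw [lintegral_const, measure_univ, mul_one]
  have hlim : Tendsto (fun ε : ℝ => ENNReal.ofReal (ε * A) + α.dist0 α' * ENNReal.ofReal A)
      (𝓝[>] 0) (𝓝 (ENNReal.ofReal (0 * A) + α.dist0 α' * ENNReal.ofReal A)) := by
    have : Continuous fun ε : ℝ => ENNReal.ofReal (ε * A) + α.dist0 α' * ENNReal.ofReal A :=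
      (ENNReal.continuous_ofReal.comp (continuous_mul_const A)).add continuous_const
    exact (this.tendsto 0).mono_left nhdsWithin_le_nhds
  refine (ge_of_tendsto hlim ?_).trans (le_of_eq ?_)
  · filter_upwards [self_mem_nhdsWithin] with ε hε using key ε hε
  · rw [zero_mul, ENNReal.ofReal_zero, zero_add, hA, ENNReal.ofReal_mul hK,
      ENNReal.ofReal_toReal hf.ne]
    ring

end Comparison

/-! ### Positivity of the constant -/

section Positivity

variable {d : ℕ} {E : Type*} [MetricSpace E] [CompactSpace E] [MeasurableSpace E] [BorelSpace E]
  {P : FellerProcess (Config d E)}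

theorem EnvCoupling.ae_start (Q : EnvCoupling P) (η ξ : Config d E) :
    ∀ᵐ ω ∂(Q.law η ξ), ω.1.1 0 = η ∧ ω.2.1 0 = ξ := by
  have h1 : ∀ᵐ ω ∂(Q.law η ξ), ω.1.1 0 = η :=
    ae_of_ae_map measurable_fst.aemeasurable (by rw [Q.map_fst η ξ]; exact P.start η)
  have h2 : ∀ᵐ ω ∂(Q.law η ξ), ω.2.1 0 = ξ :=
    ae_of_ae_map measurable_snd.aemeasurable (by rw [Q.map_snd η ξ]; exact P.start ξ)
  exact h1.and h2

theorem EnvCoupling.tendsto_integral_dist (Q : EnvCoupling P) (hE : ∀ a b : E, dist a b ≤ 1)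
    (η ξ : Config d E) :
    Tendsto (fun t : ℝ≥0 => ∫ ω, dist (ω.1.1 t 0) (ω.2.1 t 0) ∂(Q.law η ξ)) (𝓝 0)
      (𝓝 (dist (η 0) (ξ 0))) := by
  have := Q.isProbabilityMeasure η ξ
  have e : dist (η 0) (ξ 0) = ∫ _, dist (η 0) (ξ 0) ∂(Q.law η ξ) := by simp
  rw [e]
  refine tendsto_integral_filter_of_dominated_convergence (fun _ => 1)
    (Eventually.of_forall fun t => (measurable_dist_eval t 0).aestronglyMeasurable)
    (Eventually.of_forall fun t => Eventually.of_forall fun ω => ?_) (integrable_const 1) ?_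
  · rw [Real.norm_of_nonneg dist_nonneg]
    exact hE _ _
  · filter_upwards [Q.ae_start η ξ] with ω hω
    have hcont : ∀ γ : CadlagPath (Config d E), Tendsto (fun t => γ.1 t 0) (𝓝 0) (𝓝 (γ.1 0 0)) := by
      intro γ
      have h := (γ.2 0).1
      rw [ContinuousWithinAt, show Ici (0 : ℝ≥0) = univ from Ici_bot, nhdsWithin_univ] at h
      exact ((continuous_apply (0 : Site d)).tendsto _).comp h
    have := (hcont ω.1).dist (hcont ω.2)
    rwa [hω.1, hω.2] at this

/-- Paths are right-continuous at time `0`, so two constant configurations with different values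
stay at positive expected distance for a short time. -/
theorem EnvCoupling.integral_supDist_pos [Nontrivial E] (Q : EnvCoupling P)
    (hE : ∀ a b : E, dist a b ≤ 1)
    (hQ : IntegrableOn (fun t : ℝ => Q.supDist t.toNNReal) (Ioi 0)) :
    0 < ∫ t in Ioi (0 : ℝ), Q.supDist t.toNNReal := by
  obtain ⟨a, b, hab⟩ := exists_pair_ne E
  have hlim := Q.tendsto_integral_dist hE (fun _ => a) (fun _ => b)
  have hev := (continuous_real_toNNReal.tendsto' 0 0 Real.toNNReal_zero).eventually
    (hlim.eventually (Ioi_mem_nhds (dist_pos.2 hab)))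
  obtain ⟨r, hr, hball⟩ := Metric.eventually_nhds_iff.1 hev
  rw [setIntegral_pos_iff_support_of_nonneg_ae
    (Eventually.of_forall fun t => Q.supDist_nonneg _) hQ]
  refine lt_of_lt_of_le ?_ (measure_mono (s := Ioo 0 r) fun t ht => ⟨?_, ht.1⟩)
  · rw [Real.volume_Ioo, sub_zero]
    exact ENNReal.ofReal_pos.2 hr
  · have h1 := hball (y := t) (by rw [Real.dist_eq, sub_zero, abs_of_pos ht.1]; exact ht.2)
    exact (lt_of_lt_of_le h1 (Q.integral_dist_le_supDist hE _ _ _)).ne'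

end Positivity

/-! ### Conclusion -/

theorem mainTheorem3 {d : ℕ} {E : Type*} [MetricSpace E] [CompactSpace E] [Nonempty E]
    [MeasurableSpace E] [BorelSpace E] (hE : ∀ a b : E, dist a b ≤ 1)
    (P : FellerProcess (Config d E)) (hP : P.TranslationInvariant)
    (Q : EnvCoupling P) (hQ : Q.TranslationInvariant) (hQM : Q.StrongMarginalMarkov)
    (hQd : IntegrableOn (fun t : ℝ => t ^ d * Q.supDist t.toNNReal) (Ioi 0)) :
    -- the environment process is well defined
    (∀ α : JumpRates d E, ∃! T, IsEnvProcessSemigroup P α T) ∧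
    -- `μ α` is its unique invariant probability measure
    ∃ μ : JumpRates d E → ProbabilityMeasure (Config d E),
      (∀ α ν, IsEnvProcessInvariant P α ν ↔ ν = μ α) ∧
      -- the estimate
      (∃ C p : JumpRates d E → ℝ,
        (∀ α, 0 ≤ C α ∧ (Nontrivial E → 0 < C α) ∧ 0 < p α ∧ p α ≤ 1 ∧
          (¬ α.EnvIndependent → p α < 1)) ∧
        (∀ α, α.EnvIndependent →
          p α = 1 ∧ C α = ∫ t in Ioi (0 : ℝ), Q.supDist t.toNNReal) ∧
        ∀ (α α' : JumpRates d E) (f : C(Config d E, ℝ)), tripleNorm f < ∞ →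
          ENNReal.ofReal |∫ η, f η ∂(μ α : Measure (Config d E)) -
              ∫ η, f η ∂(μ α' : Measure (Config d E))| ≤
            ENNReal.ofReal (C α / p α) * α.dist0 α' * tripleNorm f) ∧
      -- joint continuity in the rates and in `f` (modulo constants, controlled at a point `η₀`)
      ∀ (α : JumpRates d E) (f : C(Config d E, ℝ)), tripleNorm f < ∞ →
        ∀ ε > (0 : ℝ), ∃ δ > (0 : ℝ),
          ∀ (α' : JumpRates d E) (f' : C(Config d E, ℝ)) (η₀ : Config d E),
            α.dist0 α' < ENNReal.ofReal δ →
            tripleNorm (fun η => f η - f' η) < ENNReal.ofReal δ →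
            |f η₀ - f' η₀| < δ →
            |∫ η, f η ∂(μ α : Measure (Config d E)) -
              ∫ η, f' η ∂(μ α' : Measure (Config d E))| < ε := by
  classical
  refine ⟨existsUnique_isEnvProcessSemigroup P, ?_⟩
  have hint := EnvCoupling.integrableOn_supDist hE hQd
  have hint0 : 0 ≤ ∫ t in Ioi (0 : ℝ), Q.supDist t.toNNReal :=
    integral_nonneg fun t => Q.supDist_nonneg _
  have hosc : ∀ α : JumpRates d E, ∃ C p : ℝ, (0 ≤ C ∧ (Nontrivial E → 0 < C) ∧ 0 < p ∧ p ≤ 1 ∧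
      (¬ α.EnvIndependent → p < 1)) ∧ (α.EnvIndependent →
        p = 1 ∧ C = ∫ t in Ioi (0 : ℝ), Q.supDist t.toNNReal) ∧
      ∀ (f G : C(Config d E, ℝ)) (ε : ℝ), tripleNorm f < ∞ → 0 < ε →
        P.semigroup.HasGenerator G (ε • G - f - α.jumpOp G) →
          ∀ η ξ, G η - G ξ ≤ C / p * (tripleNorm f).toReal := by
    intro α
    by_cases hα : α.EnvIndependent
    · refine ⟨∫ t in Ioi (0 : ℝ), Q.supDist t.toNNReal, 1,
        ⟨hint0, fun _ => Q.integral_supDist_pos hE hint, one_pos, le_rfl, fun h => (h hα).elim⟩,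
        fun _ => ⟨rfl, rfl⟩, fun f G ε hf hε hG η ξ => ?_⟩
      rw [div_one]
      exact resolvent_sub_le_of_envIndependent hE hP hQ hQM hQd hα hf hε hG η ξ
    · obtain ⟨C, p, hC, hp, hp1, h⟩ := exists_resolvent_sub_le hE hP hQ hQM hQd α
      exact ⟨C, p, ⟨hC.le, fun _ => hC, hp, hp1.le, fun _ => hp1⟩, fun h => (hα h).elim, h⟩
  choose C p hCp hind hres using hosc
  have hCp0 : ∀ α, 0 ≤ C α / p α := fun α => div_nonneg (hCp α).1 (hCp α).2.2.1.le
  have hex : ∀ α : JumpRates d E, ∃ μ, IsEnvProcessInvariant P α μ := fun α => by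
    obtain ⟨T, hT, -⟩ := existsUnique_isEnvProcessSemigroup P α
    obtain ⟨μ, hμ⟩ := T.exists_isInvariant
    exact ⟨μ, T, hT, hμ⟩
  choose μ hμ using hex
  have hest : ∀ (α α' : JumpRates d E) (ν : ProbabilityMeasure (Config d E))
      (f : C(Config d E, ℝ)), IsEnvProcessInvariant P α' ν → tripleNorm f < ∞ →
      ENNReal.ofReal |∫ η, f η ∂(μ α : Measure (Config d E)) -
        ∫ η, f η ∂(ν : Measure (Config d E))| ≤
          ENNReal.ofReal (C α / p α) * α.dist0 α' * tripleNorm f := fun α α' ν f hν hf =>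
    ofReal_abs_integral_sub_le (hμ α) hν (hCp0 α) hf fun G ε => hres α f G ε hf
  refine ⟨μ, fun α ν => ⟨fun hν => ?_, fun h => h ▸ hμ α⟩, ⟨C, p, hCp, hind, fun α α' f hf =>
    hest α α' (μ α') f (hμ α') hf⟩, fun α f hf ε hε => ?_⟩
  -- The estimate is valid for any invariant law of the second rates. With equal rates its right
  -- side is zero, which gives uniqueness.
  · refine probabilityMeasure_eq_of_tripleNorm fun f hf => ?_
    have h := hest α α ν f hν hf
    rw [α.dist0_self, mul_zero, zero_mul, nonpos_iff_eq_zero, ENNReal.ofReal_eq_zero] at h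
    exact (sub_eq_zero.1 (abs_nonpos_iff.1 h)).symm
  · set K := C α / p α
    have hK : 0 ≤ K := hCp0 α
    set T := (tripleNorm f).toReal
    have hT : 0 ≤ T := ENNReal.toReal_nonneg
    -- `K T δ` comes from the change of rates and `2 δ` from the change of `f`: its value at `η₀`
    -- plus its oscillation. The constant `3` instead of `2` makes the inequality strict.
    refine ⟨ε / (K * T + 3), by positivity, fun α' f' η₀ hα' hf' hη₀ => ?_⟩
    set δ := ε / (K * T + 3) with hδ
    have hδ0 : 0 < δ := by positivity
    have h1 : |∫ η, f η ∂(μ α : Measure (Config d E)) - ∫ η, f η ∂(μ α' : Measure (Config d E))| ≤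
        K * δ * T := by
      refine (ENNReal.ofReal_le_ofReal_iff (by positivity)).1
        ((hest α α' (μ α') f (hμ α') hf).trans ?_)
      rw [ENNReal.ofReal_mul (by positivity), ENNReal.ofReal_mul hK, ENNReal.ofReal_toReal hf.ne]
      gcongr
    have hpt : ∀ η, |f η - f' η| ≤ 2 * δ := fun η => by
      have h2 := (enorm_sub_le_tripleNorm hE (f - f').continuous η η₀).trans hf'.le
      rw [Real.enorm_eq_ofReal_abs, ENNReal.ofReal_le_ofReal_iff hδ0.le] at h2
      have h3 : |(f η - f' η) - (f η₀ - f' η₀)| ≤ δ := h2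
      have h4 := abs_add_le ((f η - f' η) - (f η₀ - f' η₀)) (f η₀ - f' η₀)
      rw [sub_add_cancel] at h4
      linarith
    have h2 : |∫ η, f η ∂(μ α' : Measure (Config d E)) - ∫ η, f' η ∂(μ α' : Measure (Config d E))| ≤
        2 * δ := by
      rw [← integral_sub (integrable_of_continuous f) (integrable_of_continuous f')]
      simpa using norm_integral_le_of_norm_le_const (μ := (μ α' : Measure (Config d E)))
        (f := fun η => f η - f' η) (Eventually.of_forall hpt)
    calc _ ≤ K * δ * T + 2 * δ := (abs_sub_le _ _ _).trans (add_le_add h1 h2)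
      _ < (K * T + 3) * δ := by nlinarith
      _ = ε := by rw [hδ, mul_div_cancel₀ _ (by positivity)]

end
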